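/- A finite hypergraph $G=(V,\mathcal E)$ has a finite vertex set $V$ and a set of hyperedges $\mathcal E\subseteq 2^V$; the degree of a vertex is the number of hyperedges containing it. A set $I\subseteq V$ is independent if no hyperedge is contained in $I$. For an activity $\lambda>0$, the partition function of the hardcore model on $G$ is $Z_\lambda(G)=\sum_{I}\lambda^{|I|}$, the sum being over the independent sets $I$ of $G$. A deterministic FPTAS for a real-valued function $F$ on a class of finite objects is a deterministic algorithm which, given (a representation of) an object $x$ of the class and a rational $\varepsilon\in(0,1)$, outputs a rational number $\hat F$ with $|\hat F-F(x)|\le\varepsilon F(x)$, in time polynomial in the size of the input and $1/\varepsilon$. A positive real constant is called efficiently approximable if it has such an approximation scheme itself (as a function on a one-point class), i.e. if rational approximations of it within relative error $\varepsilon$ can be computed in time polynomial in $1/\varepsilon$ and the bit length of $\varepsilon$; every positive rational number is. Theorem. (i) Let $\Delta\ge 2$ be an integer and let $\lambda>0$ be an efficiently approximable constant with $$\lambda<\frac{(\Delta-1)^{\Delta-1}}{(\Delta-2)^{\Delta}},$$ where for $\Delta=2$ the right-hand side is read as $+\infty$, so that there is no condition on $\lambda$. Then there is a deterministic FPTAS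 for the partition function $Z_\lambda(G)$ of the hardcore model on finite hypergraphs $G$ of maximum degree at most $\Delta$. (ii) For every efficiently approximable constant $\mu>0$ there is a deterministic FPTAS for the weighted number of edge covers $\sum_{C}\mu^{|C|}$ of a finite simple graph $G=(V,E)$, where $C$ ranges over the sets $C\subseteq E$ such that every vertex lies in an edge of $C$. In both parts $\Delta$, $\lambda$ and $\mu$ are fixed: the algorithm and the polynomial bounding its running time may depend on them. -/

import Mathlib

/-! ## A deterministic machine model with a step count

First-order recursive programs over binary trees whose leaves are natural numbers (a LISP machine
with the logarithmic cost criterion). Trees are immutable and passed by reference, so building or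
projecting a pair and branching have unit cost; an arithmetic operation is charged the bit lengths
of its operands. The model is polynomially equivalent to multi-tape Turing machines. -/

/-- The values a program works on. A list is a right-nested chain of pairs ending in `nat 0`. -/
inductive Data where
  | nat (n : ℕ)
  | pair (x y : Data)

namespace Data

/-- The size of a value: the number of nodes plus the total number of bits of its numbers. -/
def size : Data → ℕ
  | nat n => n.size + 1
  | pair x y => x.size + y.size + 1

/-- A list of values as a value. -/
def ofList : List Data → Data
  | [] => nat 0
  | x :: l => pair x (ofList l)

end Data

/-- The arithmetic operations: addition, truncated subtraction, multiplication, integer division. -/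
inductive ArithOp where
  | add
  | sub
  | mul
  | div

/-- The value of an arithmetic operation. -/
def ArithOp.apply : ArithOp → ℕ → ℕ → ℕ
  | add, a, b => a + b
  | sub, a, b => a - b
  | mul, a, b => a * b
  | div, a, b => a / b

/-- Expressions with one free variable `arg`. -/
inductive Expr where
  /-- the argument -/
  | arg
  /-- a numeral -/
  | const (n : ℕ)
  /-- the first component of a pair -/
  | fst (e : Expr)
  /-- the second component of a pair -/
  | snd (e : Expr)
  /-- a pair -/
  | pair (e f : Expr)
  /-- an arithmetic operation on two numbers -/
  | arith (o : ArithOp) (e f : Expr)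
  /-- `f` if the value of `c` is not the number `0`, otherwise `g` -/
  | ite (c f g : Expr)
  /-- evaluate `e`, then `f` with the result as its argument -/
  | bind (e f : Expr)
  /-- call the `i`-th function of the program on the value of `e` -/
  | call (i : ℕ) (e : Expr)

/-- A program is a finite list of mutually recursive function bodies. -/
abbrev Program := List Expr

/-- `Eval P e x y t`: in the program `P`, the evaluation of the expression `e` at the argument `x`
terminates with the value `y` after `t` steps. -/
inductive Eval (P : Program) : Expr → Data → Data → ℕ → Prop where
  | arg (x : Data) : Eval P .arg x x 1
  | const (n : ℕ) (x : Data) : Eval P (.const n) x (.nat n) 1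
  | fst {e : Expr} {x y z : Data} {t : ℕ} :
      Eval P e x (.pair y z) t → Eval P (.fst e) x y (t + 1)
  | snd {e : Expr} {x y z : Data} {t : ℕ} :
      Eval P e x (.pair y z) t → Eval P (.snd e) x z (t + 1)
  | pair {e f : Expr} {x y z : Data} {s t : ℕ} :
      Eval P e x y s → Eval P f x z t → Eval P (.pair e f) x (.pair y z) (s + t + 1)
  | arith {o : ArithOp} {e f : Expr} {x : Data} {a b s t : ℕ} :
      Eval P e x (.nat a) s → Eval P f x (.nat b) t →
      Eval P (.arith o e f) x (.nat (o.apply a b)) (s + t + a.size + b.size + 1)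
  | iteTrue {c f g : Expr} {x y z : Data} {s t : ℕ} :
      Eval P c x y s → y ≠ .nat 0 → Eval P f x z t → Eval P (.ite c f g) x z (s + t + 1)
  | iteFalse {c f g : Expr} {x z : Data} {s t : ℕ} :
      Eval P c x (.nat 0) s → Eval P g x z t → Eval P (.ite c f g) x z (s + t + 1)
  | bind {e f : Expr} {x y z : Data} {s t : ℕ} :
      Eval P e x y s → Eval P f y z t → Eval P (.bind e f) x z (s + t + 1)
  | call {i : ℕ} {e b : Expr} {x y z : Data} {s t : ℕ} :
      P[i]? = some b → Eval P e x y s → Eval P b y z t → Eval P (.call i e) x z (s + t + 1)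

/-- Evaluation is deterministic: result and number of steps are determined by the argument. -/
theorem Eval.deterministic {P : Program} {e : Expr} {x y y' : Data} {t t' : ℕ}
    (h : Eval P e x y t) (h' : Eval P e x y' t') : y = y' ∧ t = t' := by
  induction h generalizing y' t' with
  | arg x => cases h'; simp
  | const n x => cases h'; simp
  | fst _ ih => cases h' with | fst h => have := ih h; simp_all
  | snd _ ih => cases h' with | snd h => have := ih h; simp_all
  | pair _ _ ih₁ ih₂ =>
    cases h' with | pair h₁ h₂ => have := ih₁ h₁; have := ih₂ h₂; simp_all
  | arith _ _ ih₁ ih₂ =>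
    cases h' with | arith h₁ h₂ => have := ih₁ h₁; have := ih₂ h₂; simp_all
  | iteTrue _ hne _ ih₁ ih₂ =>
    cases h' with
    | iteTrue h₁ _ h₂ => have := ih₁ h₁; have := ih₂ h₂; simp_all
    | iteFalse h₁ h₂ => exact absurd (ih₁ h₁).1 hne
  | iteFalse _ _ ih₁ ih₂ =>
    cases h' with
    | iteTrue h₁ hne h₂ => exact absurd (ih₁ h₁).1.symm hne
    | iteFalse h₁ h₂ => have := ih₁ h₁; have := ih₂ h₂; simp_all
  | bind _ _ ih₁ ih₂ =>
    cases h' with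
    | bind h₁ h₂ => obtain ⟨rfl, rfl⟩ := ih₁ h₁; obtain ⟨rfl, rfl⟩ := ih₂ h₂; simp
  | call hb _ _ ih₁ ih₂ =>
    cases h' with
    | call hb' h₁ h₂ =>
      obtain ⟨rfl, rfl⟩ := ih₁ h₁
      obtain rfl := Option.some.inj (hb.symm.trans hb')
      obtain ⟨rfl, rfl⟩ := ih₂ h₂
      simp

/-- The program `P`, started with its function number `0` on the input `x`, halts with the output
`y` after `t` steps. -/
def Program.Outputs (P : Program) (x y : Data) (t : ℕ) : Prop :=
  Eval P (.call 0 .arg) x y t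

/-- `HasFPTAS C enc F`: there is a deterministic fully polynomial-time approximation scheme for the
quantity `F` on the class `C` of instances, where `enc i d` says that `d` represents the
instance `i`. On every representation of every instance `i ∈ C` and every rational accuracy
`ε = a / b` with `0 < ε < 1`, one and the same program outputs a rational number `p / q` within
relative error `ε` of `F i`, in time polynomial in the size of its input and `1 / ε`. -/
def HasFPTAS {ι : Type} (C : Set ι) (enc : ι → Data → Prop) (F : ι → ℝ) : Prop :=
  ∃ (P : Program) (K : ℕ), ∀ i ∈ C, ∀ d : Data, enc i d → ∀ a b : ℕ, 0 < a → a < b →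
    ∃ p q t : ℕ, 0 < q ∧
      P.Outputs (.pair d (.pair (.nat a) (.nat b))) (.pair (.nat p) (.nat q)) t ∧
      |(p : ℝ) / q - F i| ≤ (a : ℝ) / b * F i ∧
      (t : ℝ) ≤ K * (((Data.pair d (.pair (.nat a) (.nat b))).size : ℝ) + (b : ℝ) / a) ^ K

/-- A positive constant is efficiently approximable if rational approximations of it within relative
error `ε` can be computed in time polynomial in `1 / ε` (and the bit length of `ε`). -/
def EfficientlyApproximable (r : ℝ) : Prop :=
  HasFPTAS (Set.univ : Set Unit) (fun _ d => d = .nat 0) (fun _ => r)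

/-! ## Hypergraphs, the hardcore model, edge covers -/

namespace Hypergraph

/-- The independent sets of a hypergraph: the sets of vertices containing no hyperedge. -/
def independentSets {α : Type*} (H : Hypergraph α) : Set (Set α) :=
  {I | I ⊆ H.vertexSet ∧ ∀ e ∈ H.edgeSet, ¬ e ⊆ I}

/-- The partition function of the hardcore model with activity `lam` on a finite hypergraph. -/
noncomputable def hardcorePartition {α : Type*} (H : Hypergraph α) (lam : ℝ) : ℝ :=
  ∑ᶠ I ∈ H.independentSets, lam ^ I.ncard

/-- The degree of a vertex: the number of hyperedges that contain it. -/
noncomputable def degree {α : Type*} (H : Hypergraph α) (v : α) : ℕ∞ :=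
  {e ∈ H.edgeSet | v ∈ e}.encard

/-- The edge covers: the sets of edges such that every vertex lies in one of them. -/
def edgeCovers {α : Type*} (H : Hypergraph α) : Set (Set (Set α)) :=
  {C | C ⊆ H.edgeSet ∧ ∀ v ∈ H.vertexSet, ∃ e ∈ C, v ∈ e}

/-- The weighted count of the edge covers of a finite (hyper)graph, each edge having weight `mu`. -/
noncomputable def edgeCoverPartition {α : Type*} (H : Hypergraph α) (mu : ℝ) : ℝ :=
  ∑ᶠ C ∈ H.edgeCovers, mu ^ C.ncard

/-- `H.IsEncodedBy d`: the value `d` is the pair of a list of the vertices of `H`, each exactly once,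
and a list of its hyperedges, each exactly once and given as the list of its vertices. -/
def IsEncodedBy (H : Hypergraph ℕ) (d : Data) : Prop :=
  ∃ (V : List ℕ) (E : List (List ℕ)),
    V.Nodup ∧ {v | v ∈ V} = H.vertexSet ∧
    (∀ l ∈ E, l.Nodup) ∧ (E.map fun l => {v | v ∈ l}).Nodup ∧
    {e | ∃ l ∈ E, e = {v | v ∈ l}} = H.edgeSet ∧
    d = .pair (.ofList (V.map .nat)) (.ofList (E.map fun l => .ofList (l.map .nat)))

/-- The finite hypergraphs, with natural numbers as names of the vertices, of maximum degree at
most `Δ`. -/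
def ofMaxDegree (Δ : ℕ) : Set (Hypergraph ℕ) :=
  {H | H.vertexSet.Finite ∧ ∀ v ∈ H.vertexSet, H.degree v ≤ Δ}

/-- The finite graphs, as the hypergraphs all of whose edges have two elements. -/
def finiteGraphs : Set (Hypergraph ℕ) :=
  {H | H.vertexSet.Finite ∧ ∀ e ∈ H.edgeSet, e.ncard = 2}

end Hypergraph

/-! Part (i) rests on a recursion for occupation ratios and on a coordinate in which it contracts.
Putting `v` into the set shortens its clauses, keeping it out deletes them, so the two clause lists
differ by the shortened clauses of `v`. Adding these one at a time gives `R_v = λ ∏ (1 - q_i)`,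
where `q_i` is the conditional probability that the i-th one is fully occupied. By the chain rule
`q_i` is a product of factors `R_u / (1 + R_u)` over the vertices of the clause, each ratio
belonging to a smaller instance. Degrees never grow, and as `u` lies in the clause under
examination, at most `d = Δ - 1` other clauses of `u` remain. The partition function is the product
of the factors `1 + R_v` met while the vertices are deleted one by one.

Ratios are measured by `arsinh √R` and probabilities by `artanh √q`; the coordinates of `R` and of
`R / (1 + R)` coincide. Multiplication in `[0, 1]` does not increase the maximal `artanh` distance
(`mul_le_tanh_add`), so a clause costs nothing whatever its length. The vertex step has partial
derivatives `-tanh h * tanh y_i`. With `f = λ ∏ (1 - q_i)`, Cauchy-Schwarz bounds the square of the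
ℓ¹ norm of the gradient by `f / (1 + f) * d ∑ q_i`, and `f (d ∑ q_i - 1) ≤ λ (d - 1)^(d + 1) / d^d`
(`prod_one_sub_mul_le`) keeps this away from 1 below the critical activity
(`tanh_clauseMap_mul_sum_le`).

Hyperedges may be long, so the recursion is truncated by a budget `N` and not by depth: a clause
with `k` vertices passes `N / (B (k + 1))` to each of them. With `B = 2 Δ` the budgets handed down
add up to at most `N / 2`, so time and bit lengths are linear in the budget up to polynomial
overhead (`fracBits_approxRatio_le`, `runs_ratio`). The loss of budget on long clauses is outweighed
by the exponential decay of `q_i` in `k`, and the error decays like a power `(N + 1)^(-γ)`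
(`abs_ratioCoord_approxRatio_sub_le`). Hence a polynomial budget suffices (`exists_budget`), and an
approximation of the activity from its own scheme does no harm, because the partition function is a
polynomial of degree at most `|V|` with nonnegative coefficients.

For part (ii), complements of edge covers are the independent sets of the dual hypergraph, whose
vertices are the edges and whose clauses are the stars (`edgeCoverPartition_eq`). An edge lies in
two stars, so `Δ = 2` and no activity is excluded. -/

open Real

/-! ## Contraction of the tree recursion -/

/-- `Close D x y`: in the coordinate `artanh` the distance of `x` and `y` is at most `artanh D`. -/
def Close (D x y : ℝ) : Prop := x * (1 + y * D) ≤ y + D ∧ y * (1 + x * D) ≤ x + D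

/-- With `D = tanh g`: if each of two factors moves by at most `g` in the `artanh` coordinate, so
does their product. After clearing denominators the gap between the two sides of `key` is exactly `D
(1 - D) (1 - AB) (1 - A) (1 - B)`. This is why the threshold does not depend on the sizes of the
hyperedges. -/
theorem mul_le_tanh_add {A B D a b : ℝ} (hA : 0 ≤ A) (hA1 : A ≤ 1) (hB : 0 ≤ B) (hB1 : B ≤ 1)
    (hD : 0 ≤ D) (hD1 : D ≤ 1) (hb : 0 ≤ b)
    (h₁ : a * (1 + A * D) ≤ A + D) (h₂ : b * (1 + B * D) ≤ B + D) :
    a * b * (1 + A * B * D) ≤ A * B + D := by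
  have hAD : 0 < 1 + A * D := by positivity
  have hBD : 0 < 1 + B * D := by positivity
  have key : (A + D) * (B + D) * (1 + A * B * D) ≤ (A * B + D) * ((1 + A * D) * (1 + B * D)) := by
    have hAB : A * B ≤ 1 := by nlinarith
    have : 0 ≤ (D * (1 - D)) * ((1 - A * B) * ((1 - A) * (1 - B))) :=
      mul_nonneg (mul_nonneg hD (by linarith)) (mul_nonneg (by linarith)
        (mul_nonneg (by linarith) (by linarith)))
    nlinarith [this]
  have h3 : a * b * ((1 + A * D) * (1 + B * D)) ≤ (A + D) * (B + D) := by
    calc a * b * ((1 + A * D) * (1 + B * D)) = (a * (1 + A * D)) * (b * (1 + B * D)) := by ring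
      _ ≤ (A + D) * (B + D) :=
        mul_le_mul h₁ h₂ (by positivity) (by positivity)
  have hpos : 0 < (1 + A * D) * (1 + B * D) := by positivity
  have : (a * b * (1 + A * B * D)) * ((1 + A * D) * (1 + B * D))
      ≤ (A * B + D) * ((1 + A * D) * (1 + B * D)) := by
    calc _ = a * b * ((1 + A * D) * (1 + B * D)) * (1 + A * B * D) := by ring
      _ ≤ (A + D) * (B + D) * (1 + A * B * D) := mul_le_mul_of_nonneg_right h3 (by positivity)
      _ ≤ _ := key
  exact le_of_mul_le_mul_right this hpos

theorem Close.mul {D a a' b b' : ℝ} (hD : 0 ≤ D) (hD1 : D ≤ 1) (ha : 0 ≤ a) (ha1 : a ≤ 1)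
    (ha' : 0 ≤ a') (ha1' : a' ≤ 1) (hb : 0 ≤ b) (hb1 : b ≤ 1) (hb' : 0 ≤ b') (hb1' : b' ≤ 1)
    (h : Close D a a') (h' : Close D b b') : Close D (a * b) (a' * b') :=
  ⟨mul_le_tanh_add ha' ha1' hb' hb1' hD hD1 hb h.1 h'.1,
    mul_le_tanh_add ha ha1 hb hb1 hD hD1 hb' h.2 h'.2⟩

theorem Close.refl {D x : ℝ} (hD : 0 ≤ D) (hx : 0 ≤ x) (hx1 : x ≤ 1) : Close D x x := by
  constructor <;> nlinarith [mul_nonneg hD (by nlinarith : (0 : ℝ) ≤ 1 - x * x)]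

/-! ### Hyperbolic functions and the two coordinates -/

theorem Real.tanh_nonneg {x : ℝ} (hx : 0 ≤ x) : 0 ≤ tanh x := by
  rw [tanh_eq_sinh_div_cosh]; exact div_nonneg (sinh_nonneg_iff.2 hx) (cosh_pos x).le

theorem Real.tanh_add_eq {x y : ℝ} : tanh (x + y) = (tanh x + tanh y) / (1 + tanh x * tanh y) := by
  have hx := (cosh_pos x).ne'
  have hy := (cosh_pos y).ne'
  rw [tanh_eq_sinh_div_cosh, tanh_eq_sinh_div_cosh, tanh_eq_sinh_div_cosh, sinh_add, cosh_add]
  have h : cosh x * cosh y + sinh x * sinh y ≠ 0 := by rw [← cosh_add]; exact (cosh_pos _).ne'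
  have h2 : 1 + sinh x / cosh x * (sinh y / cosh y) ≠ 0 := by
    intro h0; apply h; field_simp at h0; linarith
  field_simp

theorem Real.tanh_strictMono : StrictMono tanh := by
  intro x y h
  rw [← artanh_lt_artanh_iff ⟨neg_one_lt_tanh x, tanh_lt_one x⟩ ⟨neg_one_lt_tanh y, tanh_lt_one y⟩]
  simpa [artanh_tanh] using h

theorem tanh_mul_le_of_le_add {x y g : ℝ} (hy : 0 ≤ y) (hg : 0 ≤ g) (h : x ≤ y + g) :
    tanh x * (1 + tanh y * tanh g) ≤ tanh y + tanh g := by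
  have := tanh_strictMono.monotone h
  rw [tanh_add_eq, le_div_iff₀] at this
  · exact this
  · have := mul_nonneg (tanh_nonneg hy) (tanh_nonneg hg); linarith

theorem close_tanh {x y g : ℝ} (hx : 0 ≤ x) (hy : 0 ≤ y) (h : |x - y| ≤ g) :
    Close (tanh g) (tanh x) (tanh y) := by
  have hg : 0 ≤ g := (abs_nonneg _).trans h
  rw [abs_le] at h
  exact ⟨tanh_mul_le_of_le_add hy hg (by linarith), tanh_mul_le_of_le_add hx hg (by linarith)⟩

theorem abs_sub_le_of_close_tanh {x y g : ℝ} (hx : 0 ≤ x) (hy : 0 ≤ y) (hg : 0 ≤ g)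
    (h : Close (tanh g) (tanh x) (tanh y)) : |x - y| ≤ g := by
  have aux : ∀ {x y : ℝ}, 0 ≤ y → tanh x * (1 + tanh y * tanh g) ≤ tanh y + tanh g →
      x ≤ y + g := by
    intro x y hy h
    rw [← tanh_strictMono.le_iff_le, tanh_add_eq, le_div_iff₀]
    · exact h
    · have := mul_nonneg (tanh_nonneg hy) (tanh_nonneg hg); linarith
  have h1 := aux hy h.1
  have h2 := aux hx h.2
  rw [abs_le]; constructor <;> linarith

/-- The coordinate in which the recursion for the occupation ratios is a contraction. -/
noncomputable def ratioCoord (x : ℝ) : ℝ := arsinh (√x)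

theorem ratioCoord_nonneg (x : ℝ) : 0 ≤ ratioCoord x := arsinh_nonneg_iff.2 (sqrt_nonneg x)

theorem ratioCoord_mono {x y : ℝ} (h : x ≤ y) : ratioCoord x ≤ ratioCoord y :=
  arsinh_le_arsinh.2 (sqrt_le_sqrt h)

theorem tanh_ratioCoord {x : ℝ} (hx : 0 ≤ x) : tanh (ratioCoord x) = √(x / (1 + x)) := by
  rw [ratioCoord, tanh_arsinh, sq_sqrt hx, sqrt_div hx]

theorem one_add_eq_cosh_sq {x : ℝ} (hx : 0 ≤ x) : 1 + x = cosh (ratioCoord x) ^ 2 := by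
  rw [ratioCoord, cosh_arsinh, sq_sqrt hx, sq_sqrt (by linarith)]

theorem cosh_le_exp_mul_cosh {x y g : ℝ} (h : |x - y| ≤ g) : cosh x ≤ exp g * cosh y := by
  rw [abs_le] at h
  have h1 : exp x ≤ exp g * exp y := by rw [← exp_add]; exact exp_le_exp.2 (by linarith)
  have h2 : exp (-x) ≤ exp g * exp (-y) := by rw [← exp_add]; exact exp_le_exp.2 (by linarith)
  rw [cosh_eq, cosh_eq]; linarith

/-- A shift by `g` changes `cosh` by a factor of at most `exp g`, and `1 + x` is the square of
`cosh` at the coordinate of `x`. So additive errors in the coordinate become relative errors of the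
factors `1 + R` of the partition function. -/
theorem one_add_le_exp_mul {x y g : ℝ} (hx : 0 ≤ x) (hy : 0 ≤ y)
    (h : |ratioCoord x - ratioCoord y| ≤ g) : 1 + x ≤ exp (2 * g) * (1 + y) := by
  rw [one_add_eq_cosh_sq hx, one_add_eq_cosh_sq hy, two_mul, exp_add]
  have := pow_le_pow_left₀ (cosh_pos _).le (cosh_le_exp_mul_cosh h) 2
  nlinarith

theorem one_sub_tanh_sq (y : ℝ) : 1 - tanh y ^ 2 = exp (-(2 * log (cosh y))) := by
  have := (cosh_pos y)
  rw [exp_neg, two_mul, exp_add, exp_log this, tanh_eq_sinh_div_cosh]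
  have := cosh_sq y
  field_simp
  linarith

/-- The coordinate of the ratio computed from the coordinates `y` of the clauses. -/
noncomputable def clauseMap (lam : ℝ) (l : List ℝ) : ℝ :=
  ratioCoord (lam * (l.map fun y => 1 - tanh y ^ 2).prod)

theorem prod_one_sub_tanh_sq (l : List ℝ) :
    (l.map fun y => 1 - tanh y ^ 2).prod = exp (-(2 * (l.map fun y => log (cosh y)).sum)) := by
  induction l with
  | nil => simp
  | cons y l ih =>
    simp only [List.map_cons, List.prod_cons, List.sum_cons]
    rw [ih, one_sub_tanh_sq, ← exp_add]
    congr 1; ring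

/-- In this form the derivatives are visible: the derivative of `arsinh ∘ exp` is `tanh` of its
value and that of `log ∘ cosh` is `tanh`, so the partial derivatives of the vertex step are `-tanh
(clauseMap lam l) * tanh y`. -/
theorem clauseMap_eq {lam : ℝ} (hlam : 0 < lam) (l : List ℝ) :
    clauseMap lam l = arsinh (exp (log lam / 2 - (l.map fun y => log (cosh y)).sum)) := by
  rw [clauseMap, ratioCoord, prod_one_sub_tanh_sq]
  congr 1
  rw [sqrt_eq_iff_eq_sq (by positivity) (by positivity), sq, ← exp_add]
  conv_lhs => rw [← exp_log hlam, ← exp_add]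
  congr 1; ring

theorem hasDerivAt_sum_log_cosh {β : Type*} (l : List β) (y y' : β → ℝ) (s : ℝ) :
    HasDerivAt (fun s => (l.map fun t => log (cosh (y t + s * (y' t - y t)))).sum)
      (l.map fun t => tanh (y t + s * (y' t - y t)) * (y' t - y t)).sum s := by
  induction l with
  | nil => simpa using hasDerivAt_const s (0 : ℝ)
  | cons t l ih =>
    simp only [List.map_cons, List.sum_cons]
    refine HasDerivAt.add ?_ ih
    have h1 : HasDerivAt (fun s : ℝ => y t + s * (y' t - y t)) (y' t - y t) s := by
      simpa using ((hasDerivAt_id s).mul_const (y' t - y t)).const_add (y t)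
    have h2 := (h1.cosh).log (cosh_pos _).ne'
    exact h2.congr_deriv (by rw [tanh_eq_sinh_div_cosh]; ring)

theorem abs_sum_map_le {β : Type*} (l : List β) (f g : β → ℝ) (h : ∀ t ∈ l, |f t| ≤ g t) :
    |(l.map f).sum| ≤ (l.map g).sum := by
  induction l with
  | nil => simp
  | cons t l ih =>
    simp only [List.map_cons, List.sum_cons]
    refine (abs_add_le _ _).trans (add_le_add (h t (by simp)) (ih fun t ht => h t (by simp [ht])))

/-- Mean value estimate for `clauseMap`: `y`, `y'` are the two values of the coordinate and `w`
bounds their distance. -/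
theorem abs_clauseMap_sub_le {β : Type*} {lam K : ℝ} (hlam : 0 < lam) (l : List β) (y y' w : β → ℝ)
    (hw : ∀ t ∈ l, 0 ≤ y t ∧ 0 ≤ y' t ∧ |y' t - y t| ≤ w t)
    (hK : ∀ s ∈ Set.Icc (0 : ℝ) 1, tanh (clauseMap lam (l.map fun t => y t + s * (y' t - y t))) *
      (l.map fun t => tanh (y t + s * (y' t - y t)) * w t).sum ≤ K) :
    |clauseMap lam (l.map y') - clauseMap lam (l.map y)| ≤ K := by
  set S : ℝ → ℝ := fun s => (l.map fun t => log (cosh (y t + s * (y' t - y t)))).sum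
  set h : ℝ → ℝ := fun s => clauseMap lam (l.map fun t => y t + s * (y' t - y t)) with hh
  have heq : h = fun s => arsinh (exp (log lam / 2 - S s)) := by
    funext s; rw [hh]; simp only [clauseMap_eq hlam, List.map_map, S]; rfl
  have hd : ∀ s, HasDerivAt h (-(tanh (h s) *
      (l.map fun t => tanh (y t + s * (y' t - y t)) * (y' t - y t)).sum)) s := by
    intro s
    have h1 := (((hasDerivAt_sum_log_cosh l y y' s).const_sub (log lam / 2)).exp).arsinh
    rw [heq]
    refine h1.congr_deriv ?_
    simp only [tanh_arsinh, smul_eq_mul, S]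
    ring
  have hbound : ∀ s ∈ Set.Icc (0 : ℝ) 1, ‖-(tanh (h s) *
      (l.map fun t => tanh (y t + s * (y' t - y t)) * (y' t - y t)).sum)‖ ≤ K := by
    intro s hs
    have h0 : 0 ≤ tanh (h s) := tanh_nonneg (ratioCoord_nonneg _)
    rw [norm_neg, Real.norm_eq_abs, abs_mul, abs_of_nonneg h0]
    refine le_trans ?_ (hK s hs)
    refine mul_le_mul_of_nonneg_left ?_ h0
    refine abs_sum_map_le _ _ _ fun t ht => ?_
    obtain ⟨h1, h2, h3⟩ := hw t ht
    have : 0 ≤ y t + s * (y' t - y t) := by nlinarith [hs.1, hs.2]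
    rw [abs_mul, abs_of_nonneg (tanh_nonneg this)]
    exact mul_le_mul_of_nonneg_left h3 (tanh_nonneg this)
  have := (convex_Icc (0 : ℝ) 1).norm_image_sub_le_of_norm_hasDerivWithin_le
    (fun s _ => (hd s).hasDerivWithinAt) hbound (Set.left_mem_Icc.2 zero_le_one)
    (Set.right_mem_Icc.2 zero_le_one)
  simpa [hh, Function.comp_def] using this

/-! ### The uniqueness threshold -/

theorem sum_sq_le_mul_sum_sq {d : ℕ} (l : List ℝ) (hl : l.length ≤ d) :
    l.sum ^ 2 ≤ d * (l.map fun y => y ^ 2).sum := by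
  have aux : ∀ l : List ℝ, l.sum ^ 2 ≤ l.length * (l.map fun y => y ^ 2).sum := by
    intro l
    induction l with
    | nil => simp
    | cons a l ih =>
      simp only [List.sum_cons, List.length_cons, List.map_cons, Nat.cast_add, Nat.cast_one]
      set s := l.sum
      set Q := (l.map fun y => y ^ 2).sum
      rcases Nat.eq_zero_or_pos l.length with h0 | h0
      · have : l = [] := List.length_eq_zero_iff.1 h0
        simp [s, Q, this]
      · have hn : (0 : ℝ) < l.length := by exact_mod_cast h0
        have h2 : 2 * a * s * l.length ≤ (l.length * a ^ 2 + Q) * l.length := by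
          nlinarith [sq_nonneg (l.length * a - s)]
        have := le_of_mul_le_mul_right h2 hn
        nlinarith
  refine (aux l).trans (mul_le_mul_of_nonneg_right (by exact_mod_cast hl) ?_)
  exact List.sum_nonneg (by simp only [List.mem_map]; rintro _ ⟨y, _, rfl⟩; positivity)

/-- Each factor is bounded through `1 + x ≤ exp x` with `x = (1 - d q) / (d - 1)`. This is tight at
`q = 1 / d`, the fixed point on the regular tree at the critical activity. A list shorter than `d`
is padded by `q = 0`, at the cost of factors `c * exp (1 / (d - 1)) ≥ 1`. -/
theorem prod_one_sub_le {d : ℕ} (hd : 2 ≤ d) (l : List ℝ) (hl : l.length ≤ d)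
    (hq : ∀ q ∈ l, 0 ≤ q ∧ q ≤ 1) :
    (l.map fun q => 1 - q).prod ≤ (((d : ℝ) - 1) / d) ^ d * exp ((d - d * l.sum) / (d - 1)) := by
  have hd' : (2 : ℝ) ≤ d := by exact_mod_cast hd
  set c : ℝ := ((d : ℝ) - 1) / d
  have hc : 0 < c := div_pos (by linarith) (by linarith)
  have hstep : ∀ q : ℝ, 1 - q ≤ c * exp ((1 - d * q) / (d - 1)) := by
    intro q
    have := add_one_le_exp ((1 - d * q) / ((d : ℝ) - 1))
    calc 1 - q = c * ((1 - d * q) / ((d : ℝ) - 1) + 1) := by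
          simp only [c]; field_simp [show (d : ℝ) - 1 ≠ 0 by linarith]; ring
      _ ≤ _ := mul_le_mul_of_nonneg_left this hc.le
  have aux : ∀ l : List ℝ, (∀ q ∈ l, 0 ≤ q ∧ q ≤ 1) → (l.map fun q => 1 - q).prod ≤
      c ^ l.length * exp ((l.length - d * l.sum) / (d - 1)) := by
    intro l
    induction l with
    | nil => simp
    | cons q l ih =>
      intro h
      have h1 := ih fun q hq => h q (by simp [hq])
      have hq := h q (by simp)
      simp only [List.map_cons, List.prod_cons, List.length_cons, List.sum_cons]
      calc (1 - q) * (l.map fun q => 1 - q).prod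
          ≤ (c * exp ((1 - d * q) / (d - 1))) *
            (c ^ l.length * exp ((l.length - d * l.sum) / (d - 1))) := by
            refine mul_le_mul (hstep q) h1 ?_ (by positivity)
            exact List.prod_nonneg (by
              simp only [List.mem_map]; rintro _ ⟨y, hy, rfl⟩
              have := h y (by simp [hy]); linarith)
        _ = _ := by
            rw [show (((l.length + 1 : ℕ) : ℝ) - d * (q + l.sum)) / (d - 1) =
              (1 - d * q) / (d - 1) + (l.length - d * l.sum) / (d - 1) by push_cast; ring, exp_add]
            ring
  refine (aux l hq).trans ?_
  have h1 : (1 : ℝ) ≤ c * exp (1 / (d - 1)) := by simpa using hstep 0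
  have h2 : (c * exp (1 / ((d : ℝ) - 1))) ^ l.length ≤ (c * exp (1 / ((d : ℝ) - 1))) ^ d :=
    pow_le_pow_right₀ h1 hl
  rw [mul_pow, mul_pow, ← exp_nat_mul, ← exp_nat_mul] at h2
  have e1 : exp ((l.length - d * l.sum) / ((d : ℝ) - 1)) =
      exp (l.length * (1 / ((d : ℝ) - 1))) * exp (- (d * l.sum) / (d - 1)) := by
    rw [← exp_add]; congr 1; ring
  have e2 : exp ((d - d * l.sum) / ((d : ℝ) - 1)) =
      exp (d * (1 / ((d : ℝ) - 1))) * exp (- (d * l.sum) / (d - 1)) := by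
    rw [← exp_add]; congr 1; ring
  rw [e1, e2, ← mul_assoc, ← mul_assoc]
  exact mul_le_mul_of_nonneg_right h2 (exp_pos _).le

/-- The inverse of the critical activity for trees of branching number `d`. -/
noncomputable def invCritical (d : ℕ) : ℝ := ((d : ℝ) - 1) ^ (d + 1) / (d : ℝ) ^ d

/-- A second use of `1 + x ≤ exp x`, tight at `l.sum = 1`, produces the exponential that cancels the
one in `prod_one_sub_le`. For `d ≥ 2` both bounds are tight for `d` entries `1 / d`, so the constant
is the exact inverse of the critical activity. -/
theorem prod_one_sub_mul_le {d : ℕ} (hd : 1 ≤ d) (l : List ℝ) (hl : l.length ≤ d)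
    (hq : ∀ q ∈ l, 0 ≤ q ∧ q ≤ 1) :
    (l.map fun q => 1 - q).prod * (d * l.sum - 1) ≤ invCritical d := by
  have hprod : 0 ≤ (l.map fun q => 1 - q).prod := List.prod_nonneg (by
    simp only [List.mem_map]; rintro _ ⟨y, hy, rfl⟩; have := hq y hy; linarith)
  -- For `d = 1` the exponents above would divide by zero; here the sum is at most 1, so the left
  -- side is nonpositive, and `invCritical 1 = 0`.
  rcases Nat.lt_or_ge d 2 with h2 | h2
  · obtain rfl : d = 1 := by omega
    have : l.sum ≤ 1 := by
      match l, hl, hq with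
      | [], _, _ => simp
      | [a], _, h => simpa using (h a (by simp)).2
    simp only [invCritical]
    norm_num
    exact mul_nonpos_of_nonneg_of_nonpos hprod (by linarith)
  · have hd' : (2 : ℝ) ≤ d := by exact_mod_cast h2
    have hd1 : (0 : ℝ) < d - 1 := by linarith
    have hc0 : 0 ≤ invCritical d := by unfold invCritical; positivity
    rcases le_or_gt (d * l.sum - 1) 0 with h0 | h0
    · exact (mul_nonpos_of_nonneg_of_nonpos hprod h0).trans hc0
    · have h1 := prod_one_sub_le h2 l hl hq
      have h3 := add_one_le_exp ((d * l.sum - 1) / ((d : ℝ) - 1) - 1)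
      have h4 : d * l.sum - 1 ≤ (d - 1) * exp ((d * l.sum - d) / ((d : ℝ) - 1)) := by
        rw [show (d * l.sum - d) / ((d : ℝ) - 1) = (d * l.sum - 1) / ((d : ℝ) - 1) - 1 by
          field_simp; ring]
        calc d * l.sum - 1 = (d - 1) * ((d * l.sum - 1) / ((d : ℝ) - 1) - 1 + 1) := by
              field_simp; ring
          _ ≤ _ := mul_le_mul_of_nonneg_left h3 hd1.le
      calc _ ≤ ((((d : ℝ) - 1) / d) ^ d * exp ((d - d * l.sum) / (d - 1))) *
            ((d - 1) * exp ((d * l.sum - d) / ((d : ℝ) - 1))) :=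
            mul_le_mul h1 h4 h0.le (by positivity)
        _ = (((d : ℝ) - 1) / d) ^ d * (d - 1) *
            (exp ((d - d * l.sum) / (d - 1)) * exp ((d * l.sum - d) / ((d : ℝ) - 1))) := by ring
        _ = invCritical d := by
            rw [← exp_add, show (d - d * l.sum) / ((d : ℝ) - 1) + (d * l.sum - d) / ((d : ℝ) - 1)
              = 0 by ring, exp_zero, invCritical, div_pow]
            ring

/-- The square of the contraction factor for activities at most `lam` and `d` clauses. -/
noncomputable def contractionSq (d : ℕ) (lam : ℝ) : ℝ := 1 - (1 - lam * invCritical d) / (1 + lam)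

/-- The left side is the ℓ¹ norm of the gradient of the vertex step. With `f` the ratio and `q =
tanh y ^ 2`, its square is at most `f / (1 + f) * d ∑ q` by Cauchy-Schwarz, and
`prod_one_sub_mul_le` bounds `f (d ∑ q - 1)`. The uniform bound `lam'` is needed because the program
works with rational activities that vary with the input. -/
theorem tanh_clauseMap_mul_sum_le {d : ℕ} (hd : 1 ≤ d) {lam lam' : ℝ} (hlam : 0 < lam)
    (hle : lam ≤ lam') (hcrit : lam' * invCritical d < 1) (l : List ℝ) (hl : l.length ≤ d) :
    tanh (clauseMap lam l) * (l.map tanh).sum ≤ √(contractionSq d lam') := by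
  have hd1 : (1 : ℝ) ≤ d := by exact_mod_cast hd
  set q : List ℝ := l.map fun y => tanh y ^ 2 with hqdef
  have hq : ∀ x ∈ q, 0 ≤ x ∧ x ≤ 1 := by
    simp only [hqdef, List.mem_map]
    rintro _ ⟨y, _, rfl⟩
    exact ⟨by positivity, (tanh_sq_lt_one y).le⟩
  have hql : q.length ≤ d := by simpa [hqdef] using hl
  set p := (q.map fun x => 1 - x).prod with hp
  have hp0 : 0 ≤ p := List.prod_nonneg (by
    simp only [List.mem_map]; rintro _ ⟨x, hx, rfl⟩; have := hq x hx; linarith)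
  have hp1 : p ≤ 1 := by
    have : ∀ q : List ℝ, (∀ x ∈ q, 0 ≤ x ∧ x ≤ 1) → (q.map fun x => 1 - x).prod ≤ 1 := by
      intro q
      induction q with
      | nil => simp
      | cons x q ih =>
        intro h
        have hx := h x (by simp)
        simp only [List.map_cons, List.prod_cons]
        exact mul_le_one₀ (by linarith) (List.prod_nonneg (by
          simp only [List.mem_map]; rintro _ ⟨x, hx, rfl⟩; have := h x (by simp [hx]); linarith))
          (ih fun x hx => h x (by simp [hx]))
    exact this q hq
  have hcm : clauseMap lam l = ratioCoord (lam * p) := by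
    simp only [clauseMap, hp, hqdef, List.map_map]; rfl
  set f := lam * p
  have hf0 : 0 ≤ f := by positivity
  have hfl : f ≤ lam' := (mul_le_of_le_one_right hlam.le hp1).trans hle
  have hS : (l.map tanh).sum ^ 2 ≤ d * q.sum := by
    have := sum_sq_le_mul_sum_sq (d := d) (l.map tanh) (by simpa using hl)
    simpa [hqdef, List.map_map, Function.comp_def] using this
  have hinv : 0 ≤ invCritical d := by
    unfold invCritical
    have : (0 : ℝ) ≤ d - 1 := by linarith
    positivity
  have hmain : f * (d * q.sum - 1) ≤ lam' * invCritical d := by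
    have := prod_one_sub_mul_le hd q hql hq
    calc f * (d * q.sum - 1) = lam * (p * (d * q.sum - 1)) := by ring
      _ ≤ lam * invCritical d := mul_le_mul_of_nonneg_left this hlam.le
      _ ≤ _ := mul_le_mul_of_nonneg_right hle hinv
  rw [hcm, tanh_ratioCoord hf0]
  apply le_sqrt_of_sq_le
  rw [mul_pow, sq_sqrt (by positivity), div_mul_eq_mul_div, div_le_iff₀ (by positivity)]
  have hl' : 0 < 1 + lam' := by linarith
  calc f * (l.map tanh).sum ^ 2 ≤ f * (d * q.sum) := mul_le_mul_of_nonneg_left hS hf0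
    _ ≤ (1 + f) - (1 - lam' * invCritical d) := by linarith
    _ ≤ contractionSq d lam' * (1 + f) := by
      unfold contractionSq
      have : (1 - lam' * invCritical d) / (1 + lam') * (1 + f) ≤ 1 - lam' * invCritical d := by
        rw [div_mul_eq_mul_div, div_le_iff₀ hl']
        exact mul_le_mul_of_nonneg_left (by linarith) (by linarith)
      linarith

theorem contractionSq_lt_one {d : ℕ} {lam : ℝ} (hlam : 0 < lam)
    (hcrit : lam * invCritical d < 1) : contractionSq d lam < 1 := by
  have : 0 < (1 - lam * invCritical d) / (1 + lam) := div_pos (by linarith) (by linarith)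
  unfold contractionSq; linarith

/-- Dividing the budget by `B (k + 1)` enlarges an error of order `N^(-γ)` by `(B (k + 1))^γ`, while
a clause with `k` vertices enters the gradient with weight at most `r ^ k`. A small `γ` makes the
excess at most `η` for all `k` at once, by Bernoulli's inequality and `(k + 1) r^k ≤ 1 + r + ... +
r^k ≤ 1 / (1 - r)`. -/
theorem exists_exponent {r η B : ℝ} (hr0 : 0 ≤ r) (hr : r < 1) (hη : 0 < η) (hB : 1 ≤ B) :
    ∃ γ : ℝ, 0 < γ ∧ γ ≤ 1 ∧ ∀ k : ℕ, r ^ k * ((B * (k + 1)) ^ γ - 1) ≤ η := by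
  have h1r : 0 < 1 - r := by linarith
  refine ⟨min 1 (η * (1 - r) / B), by positivity, min_le_left _ _, fun k => ?_⟩
  set γ := min 1 (η * (1 - r) / B)
  have hγ0 : 0 < γ := by positivity
  have hγ1 : γ ≤ 1 := min_le_left _ _
  have hγ2 : γ ≤ η * (1 - r) / B := min_le_right _ _
  have hk : ((k : ℝ) + 1) * r ^ k * (1 - r) ≤ 1 := by
    have h1 : ((k : ℝ) + 1) * r ^ k ≤ ∑ i ∈ Finset.range (k + 1), r ^ i := by
      have : ∑ i ∈ Finset.range (k + 1), r ^ k ≤ ∑ i ∈ Finset.range (k + 1), r ^ i :=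
        Finset.sum_le_sum fun i hi =>
          pow_le_pow_of_le_one hr0 hr.le (by have := Finset.mem_range.1 hi; omega)
      simpa using this
    have h2 : (∑ i ∈ Finset.range (k + 1), r ^ i) * (1 - r) = 1 - r ^ (k + 1) :=
      geom_sum_mul_neg r (k + 1)
    calc _ ≤ (∑ i ∈ Finset.range (k + 1), r ^ i) * (1 - r) :=
          mul_le_mul_of_nonneg_right h1 h1r.le
      _ ≤ 1 := by rw [h2]; have := pow_nonneg hr0 (k + 1); linarith
  have hx : 0 ≤ B * ((k : ℝ) + 1) := by positivity
  have hbern : (B * ((k : ℝ) + 1)) ^ γ - 1 ≤ γ * (B * (k + 1)) := by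
    have := rpow_one_add_le_one_add_mul_self (s := B * ((k : ℝ) + 1) - 1) (by linarith) hγ0.le hγ1
    rw [show 1 + (B * ((k : ℝ) + 1) - 1) = B * (k + 1) by ring] at this
    linarith
  calc r ^ k * ((B * ((k : ℝ) + 1)) ^ γ - 1) ≤ r ^ k * (γ * (B * (k + 1))) :=
        mul_le_mul_of_nonneg_left hbern (by positivity)
    _ = γ * B * ((k + 1) * r ^ k) := by ring
    _ ≤ η * (1 - r) * ((k + 1) * r ^ k) := by
        refine mul_le_mul_of_nonneg_right ?_ (by positivity)
        rwa [le_div_iff₀ (by linarith)] at hγ2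
    _ = η * ((k + 1) * r ^ k * (1 - r)) := by ring
    _ ≤ η := mul_le_of_le_one_right hη.le hk

/-! ## Clause lists and the recursion for the occupation ratios -/

/-- Put the vertex `v` into the set: remove it from all clauses. -/
def eraseVertex (v : ℕ) (E : List (List ℕ)) : List (List ℕ) :=
  E.map fun e => e.filter fun x => x ≠ v

/-- Keep the vertex `v` out of the set: its clauses are satisfied. -/
def delVertex (v : ℕ) (E : List (List ℕ)) : List (List ℕ) :=
  E.filter fun e => v ∉ e

/-- The clauses of the vertex `v`, without `v`. -/
def linkClauses (v : ℕ) (E : List (List ℕ)) : List (List ℕ) :=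
  eraseVertex v (E.filter fun e => v ∈ e)

/-- The set `I` contains no clause. -/
def NoneFull (E : List (List ℕ)) (I : Finset ℕ) : Prop := ∀ e ∈ E, ∃ x ∈ e, x ∉ I

instance (E : List (List ℕ)) (I : Finset ℕ) : Decidable (NoneFull E I) := by
  unfold NoneFull; infer_instance

/-- The hardcore partition function of a clause list on the vertex set `V`. -/
noncomputable def indepSum (lam : ℝ) (V : Finset ℕ) (E : List (List ℕ)) : ℝ :=
  ∑ I ∈ V.powerset, if NoneFull E I then lam ^ I.card else 0

/-- The part of `indepSum` where all vertices of `e` are in the set. -/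
noncomputable def fullSum (lam : ℝ) (V : Finset ℕ) (e : List ℕ) (E : List (List ℕ)) : ℝ :=
  ∑ I ∈ V.powerset, if (∀ x ∈ e, x ∈ I) ∧ NoneFull E I then lam ^ I.card else 0

/-- The ratio of the weights of the independent sets with and without `v`. -/
noncomputable def exactRatio (lam : ℝ) (V : Finset ℕ) (v : ℕ) (E : List (List ℕ)) : ℝ :=
  lam * indepSum lam (V.erase v) (eraseVertex v E) / indepSum lam (V.erase v) (delVertex v E)

/-! ### Identities for the weights of independent sets -/

theorem indepSum_congr {lam : ℝ} {V : Finset ℕ} {E E' : List (List ℕ)}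
    (h : ∀ e, e ∈ E ↔ e ∈ E') : indepSum lam V E = indepSum lam V E' := by
  refine Finset.sum_congr rfl fun I _ => if_congr ?_ rfl rfl
  simp only [NoneFull, h]

theorem noneFull_delVertex {v : ℕ} {I : Finset ℕ} (hv : v ∉ I) (E : List (List ℕ)) :
    NoneFull (delVertex v E) I ↔ NoneFull E I := by
  simp only [NoneFull, delVertex, List.mem_filter, decide_eq_true_eq]
  refine ⟨fun h e he => ?_, fun h e he => h e he.1⟩
  by_cases hve : v ∈ e
  · exact ⟨v, hve, hv⟩
  · exact h e ⟨he, hve⟩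

theorem noneFull_insert {v : ℕ} {I : Finset ℕ} (E : List (List ℕ)) :
    NoneFull E (insert v I) ↔ NoneFull (eraseVertex v E) I := by
  simp only [NoneFull, eraseVertex, List.mem_map, forall_exists_index, and_imp,
    forall_apply_eq_imp_iff₂, List.mem_filter, decide_eq_true_eq, Finset.mem_insert, not_or]
  exact forall₂_congr fun e _ => exists_congr fun x => by tauto

theorem NoneFull.delVertex_of_eraseVertex {v : ℕ} {I : Finset ℕ} {E : List (List ℕ)}
    (h : NoneFull (eraseVertex v E) I) : NoneFull (delVertex v E) I := by
  intro e he
  simp only [delVertex, List.mem_filter] at he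
  obtain ⟨x, hx, hxI⟩ := h _ (List.mem_map.2 ⟨e, he.1, rfl⟩)
  exact ⟨x, (List.mem_filter.1 hx).1, hxI⟩

theorem indepSum_split (lam : ℝ) {V : Finset ℕ} {v : ℕ} (hv : v ∈ V) (E : List (List ℕ)) :
    indepSum lam V E = indepSum lam (V.erase v) (delVertex v E) +
      lam * indepSum lam (V.erase v) (eraseVertex v E) := by
  have hv' := Finset.notMem_erase v V
  conv_lhs => rw [← Finset.insert_erase hv]
  rw [indepSum, Finset.sum_powerset_insert hv', indepSum, indepSum, Finset.mul_sum]
  congr 1 <;> refine Finset.sum_congr rfl fun I hI => ?_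
  · exact if_congr (noneFull_delVertex (fun h => hv' (Finset.mem_powerset.1 hI h)) E).symm rfl rfl
  · have hvI : v ∉ I := fun h => hv' (Finset.mem_powerset.1 hI h)
    rw [Finset.card_insert_of_notMem hvI, mul_ite, mul_zero, pow_succ']
    exact if_congr (noneFull_insert E) rfl rfl

theorem fullSum_cons (lam : ℝ) {V : Finset ℕ} {u : ℕ} {e : List ℕ} (hu : u ∈ V) (hue : u ∉ e)
    (E : List (List ℕ)) :
    fullSum lam V (u :: e) E = lam * fullSum lam (V.erase u) e (eraseVertex u E) := by
  have hu' := Finset.notMem_erase u V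
  conv_lhs => rw [← Finset.insert_erase hu]
  rw [fullSum, Finset.sum_powerset_insert hu', fullSum, Finset.mul_sum]
  rw [Finset.sum_eq_zero, zero_add]
  · refine Finset.sum_congr rfl fun I hI => ?_
    have huI : u ∉ I := fun h => hu' (Finset.mem_powerset.1 hI h)
    have : (∀ x ∈ u :: e, x ∈ insert u I) ↔ ∀ x ∈ e, x ∈ I := by
      simp only [List.mem_cons, Finset.mem_insert]
      refine ⟨fun h x hx => ?_, fun h x hx => ?_⟩
      · rcases h x (Or.inr hx) with rfl | h
        · exact absurd hx hue
        · exact h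
      · rcases hx with rfl | hx
        · exact Or.inl rfl
        · exact Or.inr (h x hx)
    rw [Finset.card_insert_of_notMem huI, mul_ite, mul_zero, pow_succ']
    exact if_congr (and_congr this (noneFull_insert E)) rfl rfl
  · intro I hI
    have huI : u ∉ I := fun h => hu' (Finset.mem_powerset.1 hI h)
    exact if_neg fun h => huI (h.1 u (by simp))

theorem fullSum_nil (lam : ℝ) (V : Finset ℕ) (E : List (List ℕ)) :
    fullSum lam V [] E = indepSum lam V E := by
  exact Finset.sum_congr rfl fun I _ => if_congr (by simp) rfl rfl

theorem indepSum_cons_add_fullSum (lam : ℝ) (V : Finset ℕ) (e : List ℕ) (E : List (List ℕ)) :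
    indepSum lam V (e :: E) + fullSum lam V e E = indepSum lam V E := by
  simp only [indepSum, fullSum, ← Finset.sum_add_distrib]
  refine Finset.sum_congr rfl fun I _ => ?_
  have : NoneFull (e :: E) I ↔ ¬ (∀ x ∈ e, x ∈ I) ∧ NoneFull E I := by
    simp only [NoneFull, List.mem_cons, forall_eq_or_imp]; push Not; rfl
  rw [if_congr this rfl rfl]
  by_cases h1 : ∀ x ∈ e, x ∈ I <;> by_cases h2 : NoneFull E I
  · rw [if_neg (fun h => h.1 h1), if_pos ⟨h1, h2⟩, if_pos h2, zero_add]
  · rw [if_neg (fun h => h2 h.2), if_neg (fun h => h2 h.2), if_neg h2, zero_add]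
  · rw [if_pos ⟨h1, h2⟩, if_neg (fun h => h1 h.1), if_pos h2, add_zero]
  · rw [if_neg (fun h => h2 h.2), if_neg (fun h => h2 h.2), if_neg h2, zero_add]

theorem indepSum_nonneg {lam : ℝ} (hlam : 0 < lam) (V : Finset ℕ) (E : List (List ℕ)) :
    0 ≤ indepSum lam V E :=
  Finset.sum_nonneg fun I _ => by split_ifs <;> positivity

theorem fullSum_nonneg {lam : ℝ} (hlam : 0 < lam) (V : Finset ℕ) (e : List ℕ)
    (E : List (List ℕ)) : 0 ≤ fullSum lam V e E :=
  Finset.sum_nonneg fun I _ => by split_ifs <;> positivity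

theorem fullSum_le {lam : ℝ} (hlam : 0 < lam) (V : Finset ℕ) (e : List ℕ)
    (E : List (List ℕ)) : fullSum lam V e E ≤ indepSum lam V E := by
  have := indepSum_cons_add_fullSum lam V e E
  have := indepSum_nonneg hlam V (e :: E)
  linarith

theorem indepSum_pos {lam : ℝ} (hlam : 0 < lam) (V : Finset ℕ) {E : List (List ℕ)}
    (h : [] ∉ E) : 0 < indepSum lam V E := by
  refine Finset.sum_pos' (fun I _ => by split_ifs <;> positivity)
    ⟨∅, Finset.empty_mem_powerset V, ?_⟩
  rw [if_pos]
  · simp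
  · intro e he
    cases e with
    | nil => exact absurd he h
    | cons x e => exact ⟨x, by simp, by simp⟩

theorem indepSum_eq_zero (lam : ℝ) (V : Finset ℕ) {E : List (List ℕ)}
    (h : [] ∈ E) : indepSum lam V E = 0 := by
  refine Finset.sum_eq_zero fun I _ => if_neg fun hI => ?_
  obtain ⟨x, hx, _⟩ := hI [] h
  simp at hx

theorem indepSum_eraseVertex_le {lam : ℝ} (hlam : 0 < lam) (V : Finset ℕ) (v : ℕ)
    (E : List (List ℕ)) : indepSum lam V (eraseVertex v E) ≤ indepSum lam V (delVertex v E) := by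
  refine Finset.sum_le_sum fun I _ => ?_
  by_cases h : NoneFull (eraseVertex v E) I
  · rw [if_pos h, if_pos h.delVertex_of_eraseVertex]
  · rw [if_neg h]; split_ifs <;> positivity

theorem exactRatio_nonneg {lam : ℝ} (hlam : 0 < lam) (V : Finset ℕ) (v : ℕ)
    (E : List (List ℕ)) : 0 ≤ exactRatio lam V v E :=
  div_nonneg (mul_nonneg hlam.le (indepSum_nonneg hlam _ _)) (indepSum_nonneg hlam _ _)

theorem exactRatio_le {lam : ℝ} (hlam : 0 < lam) (V : Finset ℕ) (v : ℕ)
    (E : List (List ℕ)) : exactRatio lam V v E ≤ lam := by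
  rw [exactRatio, mul_div_assoc]
  exact mul_le_of_le_one_right hlam.le
    (div_le_one_of_le₀ (indepSum_eraseVertex_le hlam _ _ _) (indepSum_nonneg hlam _ _))

theorem indepSum_eq_mul {lam : ℝ} (hlam : 0 < lam) {V : Finset ℕ} {v : ℕ} (hv : v ∈ V)
    (E : List (List ℕ)) (h : [] ∉ delVertex v E) :
    indepSum lam V E = (1 + exactRatio lam V v E) * indepSum lam (V.erase v) (delVertex v E) := by
  have := indepSum_pos hlam (V.erase v) h
  rw [indepSum_split lam hv, exactRatio]
  field_simp

theorem nil_notMem_delVertex {E : List (List ℕ)} (h : [] ∉ E) (v : ℕ) : [] ∉ delVertex v E :=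
  fun h' => h (List.mem_filter.1 h').1

/-- Chain rule: `u` is occupied with probability `R / (1 + R)`, and given this the rest of the
clause is judged in the list with `u` erased. If that list has total weight zero, both sides vanish
by the convention for division by zero. -/
theorem fullSum_cons_div {lam : ℝ} (hlam : 0 < lam) {V : Finset ℕ} {u : ℕ} {e : List ℕ}
    (hu : u ∈ V) (hue : u ∉ e) {F : List (List ℕ)} (hF : [] ∉ F) :
    fullSum lam V (u :: e) F / indepSum lam V F =
      exactRatio lam V u F / (1 + exactRatio lam V u F) *
        (fullSum lam (V.erase u) e (eraseVertex u F) /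
          indepSum lam (V.erase u) (eraseVertex u F)) := by
  have h1 := indepSum_pos hlam (V.erase u) (nil_notMem_delVertex hF u)
  have h0 := exactRatio_nonneg hlam V u F
  rw [fullSum_cons lam hu hue, indepSum_eq_mul hlam hu F (nil_notMem_delVertex hF u)]
  rcases (indepSum_nonneg hlam (V.erase u) (eraseVertex u F)).eq_or_lt with h2 | h2
  · have h3 := fullSum_le hlam (V.erase u) e (eraseVertex u F)
    have h4 := fullSum_nonneg hlam (V.erase u) e (eraseVertex u F)
    rw [show fullSum lam (V.erase u) e (eraseVertex u F) = 0 by linarith]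
    simp
  · have : exactRatio lam V u F * indepSum lam (V.erase u) (delVertex u F) =
      lam * indepSum lam (V.erase u) (eraseVertex u F) := by
      rw [exactRatio]; field_simp
    field_simp
    linear_combination (-(fullSum lam (V.erase u) e (eraseVertex u F))) * this

/-- Duplicate-free clauses on `V`, each vertex lying in at most `D` of them. -/
structure BoundedClauses (V : Finset ℕ) (D : ℕ) (E : List (List ℕ)) : Prop where
  nodup : ∀ e ∈ E, e.Nodup
  subset : ∀ e ∈ E, ∀ x ∈ e, x ∈ V
  degree : ∀ v, E.countP (fun e => v ∈ e) ≤ D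

theorem BoundedClauses.perm {V : Finset ℕ} {D : ℕ} {E E' : List (List ℕ)}
    (h : BoundedClauses V D E) (p : E.Perm E') : BoundedClauses V D E' :=
  ⟨fun e he => h.nodup e (p.mem_iff.2 he), fun e he => h.subset e (p.mem_iff.2 he),
    fun v => (p.countP_eq _) ▸ h.degree v⟩

theorem BoundedClauses.sublist {V : Finset ℕ} {D : ℕ} {E E' : List (List ℕ)}
    (h : BoundedClauses V D E) (p : E'.Sublist E) : BoundedClauses V D E' :=
  ⟨fun e he => h.nodup e (p.subset he), fun e he => h.subset e (p.subset he),
    fun v => p.countP_le.trans (h.degree v)⟩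

theorem BoundedClauses.eraseVertex {V : Finset ℕ} {D : ℕ} {E : List (List ℕ)}
    (h : BoundedClauses V D E) (v : ℕ) : BoundedClauses (V.erase v) D (eraseVertex v E) := by
  refine ⟨?_, ?_, fun w => ?_⟩
  · simp only [_root_.eraseVertex, List.mem_map]
    rintro _ ⟨e, he, rfl⟩
    exact (h.nodup e he).filter _
  · simp only [_root_.eraseVertex, List.mem_map]
    rintro _ ⟨e, he, rfl⟩ x hx
    simp only [List.mem_filter, decide_eq_true_eq] at hx
    exact Finset.mem_erase.2 ⟨hx.2, h.subset e he x hx.1⟩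
  · refine le_trans ?_ (h.degree w)
    rw [_root_.eraseVertex, List.countP_map]
    refine List.countP_mono_left fun e _ h => ?_
    simp only [Function.comp_apply, decide_eq_true_eq, List.mem_filter] at h ⊢
    exact h.1

/-- Puts the numerator of `exactRatio` over the clause list of its denominator: it has the link
clauses in addition, and these can be added one at a time as in `noClauseFull`. -/
theorem linkClauses_append_delVertex_perm (v : ℕ) (E : List (List ℕ)) :
    (eraseVertex v E).Perm (linkClauses v E ++ delVertex v E) := by
  induction E with
  | nil => simp [eraseVertex, linkClauses, delVertex]
  | cons e E ih =>
    by_cases h : v ∈ e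
    · have h1 : linkClauses v (e :: E) = e.filter (fun x => x ≠ v) :: linkClauses v E := by
        simp [linkClauses, eraseVertex, h]
      have h2 : delVertex v (e :: E) = delVertex v E := by simp [delVertex, h]
      rw [h1, h2]
      exact ih.cons _
    · have h1 : linkClauses v (e :: E) = linkClauses v E := by
        simp [linkClauses, h]
      have h2 : delVertex v (e :: E) = e :: delVertex v E := by simp [delVertex, h]
      have h3 : e.filter (fun x => x ≠ v) = e := by
        rw [List.filter_eq_self]; intro x hx; simp; rintro rfl; exact h hx
      rw [h1, h2]
      refine List.Perm.trans ?_ List.perm_middle.symm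
      change (e.filter (fun x => x ≠ v) :: eraseVertex v E).Perm _
      rw [h3]
      exact ih.cons _

theorem length_linkClauses (v : ℕ) (E : List (List ℕ)) :
    (linkClauses v E).length = E.countP (fun e => v ∈ e) := by
  simp [linkClauses, eraseVertex, List.countP_eq_length_filter]

/-! ### The approximate recursion -/

/-- The real number represented by a fraction. -/
noncomputable def fracVal (x : ℕ × ℕ) : ℝ := (x.1 : ℝ) / x.2

/-- The approximate probability that all vertices of a clause are occupied; `r` approximates
occupation ratios, and the budget `M = 0` stands for truncation. -/
def allIn (r : ℕ → ℕ → List (List ℕ) → ℕ × ℕ) (M : ℕ) : List ℕ → List (List ℕ) → ℕ × ℕ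
  | [], _ => (1, 1)
  | u :: e, F => if M = 0 then (0, 1) else
      (((r M u F).1 * (allIn r M e (eraseVertex u F)).1),
        (((r M u F).1 + (r M u F).2) * (allIn r M e (eraseVertex u F)).2))

/-- The approximate probability that none of the clauses in the first list is fully occupied. -/
def noClauseFull (r : ℕ → ℕ → List (List ℕ) → ℕ × ℕ) (B N : ℕ) :
    List (List ℕ) → List (List ℕ) → ℕ × ℕ
  | [], _ => (1, 1)
  | e :: L, F =>
      let q := allIn r (N / (B * (e.length + 1))) e F
      let p := noClauseFull r B N L (e :: F)
      ((q.2 - q.1) * p.1, q.2 * p.2)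

/-- The approximate occupation ratio of a vertex, computed with budget `N`; the first numerical
argument bounds the depth of the recursion. -/
def approxRatio (lam : ℕ × ℕ) (B : ℕ) : ℕ → ℕ → ℕ → List (List ℕ) → ℕ × ℕ
  | 0, _, _, _ => (0, 1)
  | n + 1, N, v, E =>
      let p := noClauseFull (approxRatio lam B n) B N (linkClauses v E) (delVertex v E)
      (lam.1 * p.1, lam.2 * p.2)

/-- The approximate partition function. -/
def approxSum (lam : ℕ × ℕ) (B N : ℕ) : List ℕ → List (List ℕ) → ℕ × ℕ
  | [], E => if E = [] then (1, 1) else (0, 1)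
  | v :: V, E =>
      let x := approxRatio lam B N N v E
      let z := approxSum lam B N V (delVertex v E)
      ((x.1 + x.2) * z.1, x.2 * z.2)

section
variable {r : ℕ → ℕ → List (List ℕ) → ℕ × ℕ}

/-- Approximate probabilities are at most 1, so the truncated subtraction in `noClauseFull` is a
true subtraction. -/
theorem allIn_fst_le_snd (hr : ∀ M u F, 0 < (r M u F).2) (M : ℕ) (e : List ℕ)
    (F : List (List ℕ)) : (allIn r M e F).1 ≤ (allIn r M e F).2 ∧ 0 < (allIn r M e F).2 := by
  induction e generalizing F with
  | nil => simp [allIn]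
  | cons u e ih =>
    by_cases hM : M = 0
    · simp [allIn, hM]
    · have h := ih (eraseVertex u F)
      have := hr M u F
      simp only [allIn, if_neg hM]
      exact ⟨Nat.mul_le_mul (Nat.le_add_right _ _) h.1, Nat.mul_pos (by omega) h.2⟩

theorem noClauseFull_fst_le_snd (hr : ∀ M u F, 0 < (r M u F).2) (B N : ℕ)
    (L F : List (List ℕ)) :
    (noClauseFull r B N L F).1 ≤ (noClauseFull r B N L F).2 ∧ 0 < (noClauseFull r B N L F).2 := by
  induction L generalizing F with
  | nil => simp [noClauseFull]
  | cons e L ih =>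
    have h := ih (e :: F)
    have := allIn_fst_le_snd hr (N / (B * (e.length + 1))) e F
    simp only [noClauseFull]
    exact ⟨Nat.mul_le_mul (Nat.sub_le _ _) h.1, Nat.mul_pos this.2 h.2⟩

theorem fracVal_allIn_cons (hr : ∀ M u F, 0 < (r M u F).2) {M : ℕ} (hM : M ≠ 0) (u : ℕ)
    (e : List ℕ) (F : List (List ℕ)) :
    fracVal (allIn r M (u :: e) F) = fracVal (r M u F) / (1 + fracVal (r M u F)) *
      fracVal (allIn r M e (eraseVertex u F)) := by
  have h1 : (0 : ℝ) < (r M u F).2 := by exact_mod_cast hr M u F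
  have h2 : (0 : ℝ) < (allIn r M e (eraseVertex u F)).2 := by
    exact_mod_cast (allIn_fst_le_snd hr M e (eraseVertex u F)).2
  have h3 : (0 : ℝ) ≤ (r M u F).1 := by positivity
  simp only [fracVal, allIn, if_neg hM]
  push_cast
  field_simp
  ring

theorem fracVal_noClauseFull_cons (hr : ∀ M u F, 0 < (r M u F).2) (B N : ℕ) (e : List ℕ)
    (L F : List (List ℕ)) :
    fracVal (noClauseFull r B N (e :: L) F) =
      (1 - fracVal (allIn r (N / (B * (e.length + 1))) e F)) *
        fracVal (noClauseFull r B N L (e :: F)) := by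
  have h := allIn_fst_le_snd hr (N / (B * (e.length + 1))) e F
  have h1 : (0 : ℝ) < (allIn r (N / (B * (e.length + 1))) e F).2 := by exact_mod_cast h.2
  have h2 : (0 : ℝ) < (noClauseFull r B N L (e :: F)).2 := by
    exact_mod_cast (noClauseFull_fst_le_snd hr B N L (e :: F)).2
  simp only [fracVal, noClauseFull]
  rw [Nat.cast_mul, Nat.cast_mul, Nat.cast_sub h.1]
  field_simp

theorem noClauseFull_eq_zero {B N : ℕ} {L F : List (List ℕ)} (h : [] ∈ L) :
    (noClauseFull r B N L F).1 = 0 := by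
  induction L generalizing F with
  | nil => simp at h
  | cons e L ih =>
    simp only [noClauseFull]
    rcases List.mem_cons.1 h with rfl | h
    · simp [allIn]
    · simp [ih h]

end

theorem fracVal_nonneg (x : ℕ × ℕ) : 0 ≤ fracVal x := by unfold fracVal; positivity

theorem approxRatio_snd_pos {lam : ℕ × ℕ} (hlam : 0 < lam.2) (B n : ℕ) :
    ∀ N v E, 0 < (approxRatio lam B n N v E).2 := by
  induction n with
  | zero => simp [approxRatio]
  | succ n ih =>
    intro N v E
    simp only [approxRatio]
    exact Nat.mul_pos hlam (noClauseFull_fst_le_snd ih B N _ _).2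

theorem fracVal_approxRatio_succ (lam : ℕ × ℕ) (B n N v : ℕ) (E : List (List ℕ)) :
    fracVal (approxRatio lam B (n + 1) N v E) = fracVal lam *
      fracVal (noClauseFull (approxRatio lam B n) B N (linkClauses v E) (delVertex v E)) := by
  simp only [approxRatio, fracVal]; push_cast; exact mul_div_mul_comm _ _ _ _

theorem fracVal_approxRatio_le {lam : ℕ × ℕ} (hlam : 0 < lam.2) (B n N v : ℕ)
    (E : List (List ℕ)) : fracVal (approxRatio lam B n N v E) ≤ fracVal lam := by
  cases n with
  | zero => simpa [approxRatio, fracVal] using fracVal_nonneg lam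
  | succ n =>
    rw [fracVal_approxRatio_succ]
    refine mul_le_of_le_one_right (fracVal_nonneg _) ?_
    have := noClauseFull_fst_le_snd (approxRatio_snd_pos hlam B n) B N
      (linkClauses v E) (delVertex v E)
    exact div_le_one_of_le₀ (by exact_mod_cast this.1) (by positivity)

/-- An empty link clause forces `v` out of the set. The approximation sees this at every depth and
budget, which settles the case in which conditioning on `v` has weight zero. -/
theorem approxRatio_eq_zero {lam : ℕ × ℕ} {B n N v : ℕ} {E : List (List ℕ)}
    (h : [] ∈ linkClauses v E) : (approxRatio lam B n N v E).1 = 0 := by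
  cases n with
  | zero => rfl
  | succ n => simp [approxRatio, noClauseFull_eq_zero h]

/-! ## Error analysis of the recursion -/

theorem div_one_add_le {x y : ℝ} (hx : 0 ≤ x) (h : x ≤ y) : x / (1 + x) ≤ y / (1 + y) := by
  rw [div_le_div_iff₀ (by linarith) (by linarith)]; nlinarith

theorem div_one_add_mem {x : ℝ} (hx : 0 ≤ x) : 0 ≤ x / (1 + x) ∧ x / (1 + x) < 1 :=
  ⟨div_nonneg hx (by linarith), (div_lt_one (by linarith)).2 (by linarith)⟩

theorem BoundedClauses.tail_erase {V : Finset ℕ} {D u : ℕ} {e : List ℕ} {F : List (List ℕ)}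
    (h : BoundedClauses V D ((u :: e) :: F)) :
    BoundedClauses (V.erase u) D (e :: _root_.eraseVertex u F) := by
  have hnd := List.nodup_cons.1 (h.nodup (u :: e) (by simp))
  have he : (u :: e).filter (fun x => x ≠ u) = e := by
    rw [List.filter_cons_of_neg (by simp), List.filter_eq_self]
    intro x hx
    simpa using fun h : x = u => hnd.1 (h ▸ hx)
  have := h.eraseVertex u
  rwa [_root_.eraseVertex, List.map_cons, he] at this

/-- Every ratio is at most `lam'`, so each factor of the chain rule is at most `lam' / (1 + lam')`.
This decay in the clause length pays for the smaller budget of long clauses. -/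
theorem fullSum_div_le_pow {lam lam' : ℝ} (hlam : 0 < lam) (hle : lam ≤ lam') {D : ℕ} :
    ∀ (e : List ℕ) (F : List (List ℕ)) (V : Finset ℕ), BoundedClauses V D (e :: F) → [] ∉ F →
    fullSum lam V e F / indepSum lam V F ≤ (lam' / (1 + lam')) ^ e.length := by
  intro e
  induction e with
  | nil =>
    intro F V _ _
    simpa using div_le_one_of_le₀ (fullSum_le hlam V [] F) (indepSum_nonneg hlam V F)
  | cons u e ih =>
    intro F V hB hF
    have hnd := List.nodup_cons.1 (hB.nodup (u :: e) (by simp))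
    have hu : u ∈ V := hB.subset (u :: e) (by simp) u (by simp)
    have hR := exactRatio_nonneg hlam V u F
    have hRl := exactRatio_le hlam V u F
    have h1 := div_one_add_le hR (hRl.trans hle)
    have h2 := (div_one_add_mem (hR.trans (hRl.trans hle)))
    rw [fullSum_cons_div hlam hu hnd.1 hF, List.length_cons, pow_succ']
    have hq0 : 0 ≤ fullSum lam (V.erase u) e (eraseVertex u F) /
        indepSum lam (V.erase u) (eraseVertex u F) :=
      div_nonneg (fullSum_nonneg hlam _ _ _) (indepSum_nonneg hlam _ _)
    refine mul_le_mul h1 ?_ hq0 h2.1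
    by_cases hE : [] ∈ eraseVertex u F
    · rw [indepSum_eq_zero lam _ hE, div_zero]
      exact pow_nonneg h2.1 _
    · exact ih _ _ hB.tail_erase hE

theorem fracVal_allIn_le_pow {r : ℕ → ℕ → List (List ℕ) → ℕ × ℕ} {lam' : ℝ}
    (hlam' : 0 < lam') (hden : ∀ M u F, 0 < (r M u F).2) (hr : ∀ M u F, fracVal (r M u F) ≤ lam')
    (M : ℕ) (e : List ℕ) (F : List (List ℕ)) :
    fracVal (allIn r M e F) ≤ (lam' / (1 + lam')) ^ e.length := by
  have h2 := (div_one_add_mem hlam'.le)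
  induction e generalizing F with
  | nil => simp [allIn, fracVal]
  | cons u e ih =>
    by_cases hM : M = 0
    · simpa [allIn, hM, fracVal] using pow_nonneg h2.1 _
    · rw [fracVal_allIn_cons hden hM, List.length_cons, pow_succ']
      exact mul_le_mul (div_one_add_le (fracVal_nonneg _) (hr _ _ _)) (ih _) (fracVal_nonneg _) h2.1

/-- An error `g` of the ratio in its coordinate is an error `g` of `√(R / (1 + R))` in the `artanh`
coordinate, and `Close.mul` carries it through the product without growth. The strict inequality for
the degree in `hr` is available because `u` also lies in the clause that has been set aside. -/
theorem close_allIn {r : ℕ → ℕ → List (List ℕ) → ℕ × ℕ} {lam g : ℝ} {M D : ℕ}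
    (hlam : 0 < lam) (hM : M ≠ 0) (hg : 0 ≤ g) (hden : ∀ M u F, 0 < (r M u F).2)
    (hr0 : ∀ u F, [] ∈ linkClauses u F → (r M u F).1 = 0)
    (hr : ∀ V u F, BoundedClauses V D F → u ∈ V → F.countP (fun e => u ∈ e) < D →
      [] ∉ delVertex u F →
      |ratioCoord (fracVal (r M u F)) - ratioCoord (exactRatio lam V u F)| ≤ g) :
    ∀ (e : List ℕ) (F : List (List ℕ)) (V : Finset ℕ), BoundedClauses V D (e :: F) → [] ∉ F →
    Close (tanh g) (√(fracVal (allIn r M e F))) (√(fullSum lam V e F / indepSum lam V F)) := by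
  have hg0 := tanh_nonneg hg
  have hg1 := (tanh_lt_one g).le
  intro e
  induction e with
  | nil =>
    intro F V _ hF
    rw [fullSum_nil, div_self (indepSum_pos hlam V hF).ne']
    simpa [allIn, fracVal] using Close.refl hg0 zero_le_one le_rfl
  | cons u e ih =>
    intro F V hB hF
    have hnd := List.nodup_cons.1 (hB.nodup (u :: e) (by simp))
    have hu : u ∈ V := hB.subset (u :: e) (by simp) u (by simp)
    have hdeg : F.countP (fun e => u ∈ e) < D := by
      have := hB.degree u
      simp at this; omega
    rw [fullSum_cons_div hlam hu hnd.1 hF, fracVal_allIn_cons hden hM]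
    have hR := exactRatio_nonneg hlam V u F
    have hx := fracVal_nonneg (r M u F)
    -- Occupying `u` is impossible here: the approximate ratio is exactly 0 and the exact
    -- conditional probability is a quotient by 0, hence 0.
    by_cases hE : [] ∈ eraseVertex u F
    · have hlink : [] ∈ linkClauses u F := by
        rcases List.mem_append.1 ((linkClauses_append_delVertex_perm u F).mem_iff.1 hE) with h | h
        · exact h
        · exact absurd h (nil_notMem_delVertex hF u)
      have h1 : fracVal (r M u F) = 0 := by simp [fracVal, hr0 u F hlink]
      rw [h1, indepSum_eq_zero lam _ hE]
      simpa using Close.refl hg0 le_rfl zero_le_one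
    · have h1 := div_one_add_mem hR
      have h2 := div_one_add_mem hx
      have hc1 : Close (tanh g) (√(fracVal (r M u F) / (1 + fracVal (r M u F))))
          (√(exactRatio lam V u F / (1 + exactRatio lam V u F))) := by
        rw [← tanh_ratioCoord hx, ← tanh_ratioCoord hR]
        exact close_tanh (ratioCoord_nonneg _) (ratioCoord_nonneg _)
          (hr V u F (hB.sublist (List.sublist_cons_self _ _)) hu hdeg (nil_notMem_delVertex hF u))
      have hc2 := ih (eraseVertex u F) (V.erase u) hB.tail_erase hE
      have hq := allIn_fst_le_snd hden M e (eraseVertex u F)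
      rw [sqrt_mul h2.1, sqrt_mul h1.1]
      refine Close.mul hg0 hg1 (sqrt_nonneg _) (sqrt_le_one.2 h2.2.le) (sqrt_nonneg _)
        (sqrt_le_one.2 h1.2.le) (sqrt_nonneg _) (sqrt_le_one.2 ?_) (sqrt_nonneg _)
        (sqrt_le_one.2 ?_) hc1 hc2
      · exact div_le_one_of_le₀ (by exact_mod_cast hq.1) (by positivity)
      · exact div_le_one_of_le₀ (fullSum_le hlam _ _ _) (indepSum_nonneg hlam _ _)

/-- The coordinates of the clause probabilities in the exact and the approximate recursion. -/
theorem exists_coords_noClauseFull {r : ℕ → ℕ → List (List ℕ) → ℕ × ℕ} {lam lam' : ℝ} {D B N : ℕ}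
    (hlam : 0 < lam) (hle : lam ≤ lam') {G : ℕ → ℝ} (hG : ∀ M, 0 ≤ G M)
    (hG0 : G 0 = ratioCoord lam')
    (hden : ∀ M u F, 0 < (r M u F).2) (hrle : ∀ M u F, fracVal (r M u F) ≤ lam')
    (hr0 : ∀ M u F, [] ∈ linkClauses u F → (r M u F).1 = 0)
    (hr : ∀ k : ℕ, N / (B * (k + 1)) ≠ 0 → ∀ V u F, BoundedClauses V D F → u ∈ V →
      F.countP (fun e => u ∈ e) < D → [] ∉ delVertex u F →
      |ratioCoord (fracVal (r (N / (B * (k + 1))) u F)) - ratioCoord (exactRatio lam V u F)| ≤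
        G (N / (B * (k + 1))))
    (V : Finset ℕ) :
    ∀ L F : List (List ℕ), BoundedClauses V D (L ++ F) → [] ∉ L → [] ∉ F →
    ∃ ts : List (ℝ × ℝ × ℕ), ts.length = L.length ∧
      indepSum lam V (L ++ F) / indepSum lam V F = (ts.map fun t => 1 - tanh t.1 ^ 2).prod ∧
      fracVal (noClauseFull r B N L F) = (ts.map fun t => 1 - tanh t.2.1 ^ 2).prod ∧
      ∀ t ∈ ts, 0 ≤ t.1 ∧ 0 ≤ t.2.1 ∧ tanh t.1 ≤ √(lam' / (1 + lam')) ^ t.2.2 ∧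
        tanh t.2.1 ≤ √(lam' / (1 + lam')) ^ t.2.2 ∧
        |t.2.1 - t.1| ≤ G (N / (B * (t.2.2 + 1))) := by
  have hlam' : 0 < lam' := hlam.trans_le hle
  have hρ := div_one_add_mem hlam'.le
  set ρ := lam' / (1 + lam') with hρdef
  have hsρ1 : √ρ < 1 := by rw [sqrt_lt' one_pos]; simpa using hρ.2
  intro L
  induction L with
  | nil =>
    intro F _ _ hF
    exact ⟨[], by simp, by simp [div_self (indepSum_pos hlam V hF).ne'],
      by simp [noClauseFull, fracVal], by simp⟩
  | cons e L ih =>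
    intro F hB hL hF
    have hperm : (e :: L ++ F).Perm (L ++ e :: F) := List.perm_middle.symm
    have he : e ≠ [] := fun h => hL (by simp [h])
    have heF : [] ∉ e :: F := by
      rw [List.mem_cons, not_or]; exact ⟨fun h => he h.symm, hF⟩
    obtain ⟨ts, hlen, hex, hap, hts⟩ := ih (e :: F) (hB.perm hperm)
      (fun h => hL (by simp [h])) heF
    set M := N / (B * (e.length + 1)) with hMdef
    have hBe : BoundedClauses V D (e :: F) :=
      hB.sublist (List.Sublist.cons_cons e (List.sublist_append_right L F))
    set q := fullSum lam V e F / indepSum lam V F with hq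
    set q' := fracVal (allIn r M e F) with hq'
    have hq0 : 0 ≤ q := div_nonneg (fullSum_nonneg hlam _ _ _) (indepSum_nonneg hlam _ _)
    have hq0' : 0 ≤ q' := fracVal_nonneg _
    have hqle : q ≤ ρ ^ e.length := fullSum_div_le_pow hlam hle e F V hBe hF
    have hqle' : q' ≤ ρ ^ e.length := fracVal_allIn_le_pow hlam' hden hrle M e F
    have hsq : ∀ x, x ≤ ρ ^ e.length → √x ≤ √ρ ^ e.length := by
      intro x hx
      rw [sqrt_le_left (by positivity), ← pow_mul, mul_comm, pow_mul, sq_sqrt hρ.1]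
      exact hx
    -- Nonemptiness of the clause keeps both probabilities away from 1, where `artanh` would be
    -- infinite.
    have hpow : √ρ ^ e.length ≤ √ρ :=
      pow_le_of_le_one (sqrt_nonneg _) hsρ1.le (List.length_pos_iff.2 he).ne'
    have hmem : ∀ x, x ≤ ρ ^ e.length → √x ∈ Set.Ioo (-1 : ℝ) 1 := fun x hx =>
      ⟨by have := sqrt_nonneg x; linarith, (hsq x hx).trans_lt (hpow.trans_lt hsρ1)⟩
    have ht : tanh (artanh (√q)) = √q := tanh_artanh (hmem q hqle)
    have ht' : tanh (artanh (√q')) = √q' := tanh_artanh (hmem q' hqle')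
    -- The entries of a triple are the exact coordinate, the approximate coordinate and the length
    -- of the clause.
    refine ⟨(artanh (√q), artanh (√q'), e.length) :: ts, by simp [hlen], ?_, ?_, ?_⟩
    · simp only [List.map_cons, List.prod_cons, ← hex, ht, sq_sqrt hq0]
      have h1 := indepSum_cons_add_fullSum lam V e F
      have h2 := indepSum_pos hlam V hF
      have h3 := indepSum_pos hlam V heF
      rw [indepSum_congr fun x => hperm.mem_iff, hq]
      field_simp
      rw [← h1]; ring
    · rw [fracVal_noClauseFull_cons hden]
      simp only [List.map_cons, List.prod_cons, ← hap, ht', sq_sqrt hq0']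
      rfl
    · intro t htm
      rcases List.mem_cons.1 htm with rfl | htm
      · refine ⟨artanh_nonneg (sqrt_nonneg _), artanh_nonneg (sqrt_nonneg _),
          ht.trans_le (hsq q hqle), ht'.trans_le (hsq q' hqle'), ?_⟩
        change |artanh (√q') - artanh (√q)| ≤ G M
        -- Without budget the approximate probability is 0, and the error is the exact coordinate
        -- itself. It is at most `ratioCoord lam'`, whence the prescribed value of `G 0`.
        by_cases hM : M = 0
        · have : q' = 0 := by
            cases e with
            | nil => exact absurd rfl he
            | cons u e => simp [hq', allIn, hM, fracVal]
          rw [this, hM, hG0]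
          simp only [sqrt_zero, artanh_zero, zero_sub, abs_neg]
          rw [abs_of_nonneg (artanh_nonneg (sqrt_nonneg _)), ← tanh_strictMono.le_iff_le, ht,
            tanh_ratioCoord hlam'.le]
          exact (hsq q hqle).trans hpow
        · refine abs_sub_le_of_close_tanh (artanh_nonneg (sqrt_nonneg _))
            (artanh_nonneg (sqrt_nonneg _)) (hG _) ?_
          rw [ht, ht']
          exact close_allIn hlam hM (hG _) hden (hr0 M) (hr e.length hM) e F V hBe hF
      · exact hts t htm

/-- Writing `w = 1 + (w - 1)` separates the error of an undivided budget, to which the contraction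
applies, from the loss caused by dividing it. -/
theorem sum_tanh_mul_le {β : Type*} (l : List β) (y w : β → ℝ) {g η : ℝ} (hg : 0 ≤ g)
    (h : ∀ t ∈ l, tanh (y t) * (w t - 1) ≤ η) :
    (l.map fun t => tanh (y t) * (g * w t)).sum ≤
      g * ((l.map fun t => tanh (y t)).sum + l.length * η) := by
  induction l with
  | nil => simp
  | cons t l ih =>
    have h1 := ih fun t ht => h t (by simp [ht])
    have h2 := mul_le_mul_of_nonneg_left (h t (by simp)) hg
    simp only [List.map_cons, List.sum_cons, List.length_cons]
    push_cast
    nlinarith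

theorem sum_tanh_le_length (l : List ℝ) : (l.map tanh).sum ≤ l.length := by
  induction l with
  | nil => simp
  | cons y l ih =>
    simp only [List.map_cons, List.sum_cons, List.length_cons]
    push_cast
    have := (tanh_lt_one y).le
    linarith

/-- One step of the recursion: the error is contracted for at most `d` clauses, and multiplied by a
constant for more. -/
theorem abs_clauseMap_sub_le_of_coords {d : ℕ} (hd : 1 ≤ d) {lam lam' g η ρ : ℝ} {w : ℕ → ℝ}
    (hlam : 0 < lam) (hle : lam ≤ lam') (hcrit : lam' * invCritical d < 1) (hg : 0 ≤ g)
    (hη : 0 ≤ η) (hw : ∀ k, 1 ≤ w k ∧ ρ ^ k * (w k - 1) ≤ η) (ts : List (ℝ × ℝ × ℕ))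
    (hts : ∀ t ∈ ts, 0 ≤ t.1 ∧ 0 ≤ t.2.1 ∧ tanh t.1 ≤ ρ ^ t.2.2 ∧ tanh t.2.1 ≤ ρ ^ t.2.2 ∧
      |t.2.1 - t.1| ≤ g * w t.2.2) :
    (ts.length ≤ d → |clauseMap lam (ts.map fun t => t.2.1) - clauseMap lam (ts.map fun t => t.1)| ≤
      g * (√(contractionSq d lam') + d * η)) ∧
    |clauseMap lam (ts.map fun t => t.2.1) - clauseMap lam (ts.map fun t => t.1)| ≤
      g * (ts.length * (1 + η)) := by
  have key : ∀ s ∈ Set.Icc (0 : ℝ) 1,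
      tanh (clauseMap lam (ts.map fun t => t.1 + s * (t.2.1 - t.1))) *
        (ts.map fun t => tanh (t.1 + s * (t.2.1 - t.1)) * (g * w t.2.2)).sum ≤
      g * (tanh (clauseMap lam (ts.map fun t => t.1 + s * (t.2.1 - t.1))) *
        ((ts.map fun t => t.1 + s * (t.2.1 - t.1)).map tanh).sum + ts.length * η) := by
    intro s hs
    set T := tanh (clauseMap lam (ts.map fun t => t.1 + s * (t.2.1 - t.1))) with hT
    have hT0 : 0 ≤ T := tanh_nonneg (ratioCoord_nonneg _)
    have hT1 : T ≤ 1 := (tanh_lt_one _).le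
    have h1 := sum_tanh_mul_le ts (fun t => t.1 + s * (t.2.1 - t.1)) (fun t => w t.2.2) hg
      (η := η) (fun t ht => by
        obtain ⟨h1, h2, h3, h4, _⟩ := hts t ht
        refine le_trans (mul_le_mul_of_nonneg_right ?_ (by have := (hw t.2.2).1; linarith))
          (hw t.2.2).2
        -- The intermediate point lies between the endpoints, so the larger of the two bounds its
        -- `tanh`.
        rcases le_total t.1 t.2.1 with h | h
        · exact (tanh_strictMono.monotone (by nlinarith [hs.1, hs.2])).trans h4
        · exact (tanh_strictMono.monotone (by nlinarith [hs.1, hs.2])).trans h3)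
    rw [List.map_map]
    refine (mul_le_mul_of_nonneg_left h1 hT0).trans ?_
    have : T * (ts.length * η) ≤ ts.length * η := mul_le_of_le_one_left (by positivity) hT1
    have h2 := mul_le_mul_of_nonneg_left this hg
    simp only [Function.comp_def]
    linarith
  have hpts : ∀ t ∈ ts, 0 ≤ t.1 ∧ 0 ≤ t.2.1 ∧ |t.2.1 - t.1| ≤ g * w t.2.2 := fun t ht =>
    ⟨(hts t ht).1, (hts t ht).2.1, (hts t ht).2.2.2.2⟩
  refine ⟨fun hlen => ?_, ?_⟩
  · refine abs_clauseMap_sub_le hlam ts (fun t => t.1) (fun t => t.2.1) (fun t => g * w t.2.2) hpts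
      fun s hs => (key s hs).trans (mul_le_mul_of_nonneg_left ?_ hg)
    refine add_le_add (tanh_clauseMap_mul_sum_le hd hlam hle hcrit _ (by simpa using hlen)) ?_
    exact mul_le_mul_of_nonneg_right (by exact_mod_cast hlen) hη
  · refine abs_clauseMap_sub_le hlam ts (fun t => t.1) (fun t => t.2.1) (fun t => g * w t.2.2) hpts
      fun s hs => (key s hs).trans (mul_le_mul_of_nonneg_left ?_ hg)
    have h1 := sum_tanh_le_length (ts.map fun t => t.1 + s * (t.2.1 - t.1))
    rw [List.length_map] at h1
    have h2 : tanh (clauseMap lam (ts.map fun t => t.1 + s * (t.2.1 - t.1))) *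
        ((ts.map fun t => t.1 + s * (t.2.1 - t.1)).map tanh).sum ≤ ts.length := by
      have hT0 : 0 ≤ tanh (clauseMap lam (ts.map fun t => t.1 + s * (t.2.1 - t.1))) :=
        tanh_nonneg (ratioCoord_nonneg _)
      have hT1 := (tanh_lt_one (clauseMap lam (ts.map fun t => t.1 + s * (t.2.1 - t.1)))).le
      nlinarith [mul_le_mul_of_nonneg_left h1 hT0, (Nat.cast_nonneg ts.length : (0 : ℝ) ≤ _)]
    linarith

/-- The summand 1 absorbs the rounding: `⌊N / m⌋ + 1 ≥ (N + 1) / m`. It also gives the bound a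
meaning at budget 0. -/
theorem rpow_neg_budget_le {γ : ℝ} (hγ : 0 < γ) (N m : ℕ) (hm : 0 < m) :
    ((N / m : ℕ) + 1 : ℝ) ^ (-γ) ≤ ((N : ℝ) + 1) ^ (-γ) * (m : ℝ) ^ γ := by
  have hm' : (0 : ℝ) < m := by exact_mod_cast hm
  have h1 : ((N : ℝ) + 1) / m ≤ (N / m : ℕ) + 1 := by
    rw [div_le_iff₀ hm']
    have := Nat.lt_div_mul_add hm (a := N)
    have h2 : N + 1 ≤ (N / m + 1) * m := by rw [add_mul, one_mul]; omega
    exact_mod_cast h2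
  calc ((N / m : ℕ) + 1 : ℝ) ^ (-γ) ≤ (((N : ℝ) + 1) / m) ^ (-γ) :=
        rpow_le_rpow_of_nonpos (by positivity) h1 (by linarith)
    _ = _ := by
        rw [div_rpow (by positivity) hm'.le, rpow_neg hm'.le, div_inv_eq_mul]

/-- The error of the recursion with budget `N` decays polynomially in `N`. -/
theorem abs_ratioCoord_approxRatio_sub_le {d B : ℕ} (hd : 1 ≤ d) (hB : 2 ≤ B) {lam : ℕ × ℕ}
    {lam' γ η : ℝ} (hlam1 : 0 < lam.1) (hlam2 : 0 < lam.2) (hle : fracVal lam ≤ lam')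
    (hcrit : lam' * invCritical d < 1) (hγ : 0 < γ) (hη : 0 ≤ η)
    (hη1 : √(contractionSq d lam') + d * η ≤ 1)
    (hpow : ∀ k : ℕ, √(lam' / (1 + lam')) ^ k * (((B : ℝ) * (k + 1)) ^ γ - 1) ≤ η) (n : ℕ) :
    ∀ (N : ℕ) (V : Finset ℕ) (v : ℕ) (E : List (List ℕ)), N ≤ n → BoundedClauses V (d + 1) E →
      v ∈ V → [] ∉ delVertex v E →
      (E.countP (fun e => v ∈ e) < d + 1 →
        |ratioCoord (fracVal (approxRatio lam B n N v E)) -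
          ratioCoord (exactRatio (fracVal lam) V v E)| ≤
          ratioCoord lam' * ((N : ℝ) + 1) ^ (-γ)) ∧
      |ratioCoord (fracVal (approxRatio lam B n N v E)) -
          ratioCoord (exactRatio (fracVal lam) V v E)| ≤
          ratioCoord lam' * ((N : ℝ) + 1) ^ (-γ) * ((d + 1) * (1 + η)) := by
  have hlam : 0 < fracVal lam := by
    have h1 : (0 : ℝ) < lam.1 := by exact_mod_cast hlam1
    have h2 : (0 : ℝ) < lam.2 := by exact_mod_cast hlam2
    exact div_pos h1 h2
  induction n with
  | zero =>
    intro N V v E hN _ _ _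
    obtain rfl : N = 0 := by omega
    have h1 : |ratioCoord (fracVal (approxRatio lam B 0 0 v E)) -
        ratioCoord (exactRatio (fracVal lam) V v E)| ≤ ratioCoord lam' := by
      have : ratioCoord (fracVal (approxRatio lam B 0 0 v E)) = 0 := by
        simp [approxRatio, fracVal, ratioCoord]
      rw [this, zero_sub, abs_neg, abs_of_nonneg (ratioCoord_nonneg _)]
      exact ratioCoord_mono ((exactRatio_le hlam V v E).trans hle)
    simp only [Nat.cast_zero, zero_add, one_rpow, mul_one]
    refine ⟨fun _ => h1, h1.trans (le_mul_of_one_le_right (ratioCoord_nonneg _) ?_)⟩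
    have : (0 : ℝ) ≤ d := by positivity
    nlinarith
  | succ n ih =>
    intro N V v E hN hE hv hdel
    set C := ratioCoord lam'
    have hC : 0 ≤ C := ratioCoord_nonneg _
    have hGn : ∀ M : ℕ, 0 ≤ C * ((M : ℝ) + 1) ^ (-γ) := fun M => by positivity
    by_cases hL : [] ∈ linkClauses v E
    · have h1 : fracVal (approxRatio lam B (n + 1) N v E) = 0 := by
        simp [fracVal, approxRatio_eq_zero hL]
      have h2 : exactRatio (fracVal lam) V v E = 0 := by
        rw [exactRatio, indepSum_eq_zero]
        · simp
        · exact (linkClauses_append_delVertex_perm v E).mem_iff.2 (by simp [hL])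
      rw [h1, h2, sub_self, abs_zero]
      exact ⟨fun _ => hGn N, mul_nonneg (hGn N) (by positivity)⟩
    · have hBE := (hE.eraseVertex v).perm (linkClauses_append_delVertex_perm v E)
      obtain ⟨ts, hlen, hex, hap, hts⟩ := exists_coords_noClauseFull (B := B) (N := N) hlam hle
        (G := fun M => C * ((M : ℝ) + 1) ^ (-γ)) hGn (by simp [C])
        (approxRatio_snd_pos hlam2 B n)
        (fun M u F => (fracVal_approxRatio_le hlam2 B n M u F).trans hle)
        (fun M u F h => approxRatio_eq_zero h)
        (fun k hk W u F hF hu hdeg hdel' => by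
          refine (ih _ W u F ?_ hF hu hdel').1 hdeg
          -- The budget is at least halved, so it stays below the remaining recursion depth `n`.
          have h2 : 2 ≤ B * (k + 1) := by nlinarith
          have : N / (B * (k + 1)) ≤ N / 2 := Nat.div_le_div_left h2 (by norm_num)
          omega)
        (V.erase v) (linkClauses v E) (delVertex v E) hBE hL hdel
      have hclause1 : ratioCoord (fracVal (approxRatio lam B (n + 1) N v E)) =
          clauseMap (fracVal lam) (ts.map fun t => t.2.1) := by
        rw [fracVal_approxRatio_succ, hap, clauseMap, List.map_map]; rfl
      have hclause2 : ratioCoord (exactRatio (fracVal lam) V v E) =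
          clauseMap (fracVal lam) (ts.map fun t => t.1) := by
        rw [exactRatio, mul_div_assoc, indepSum_congr fun e =>
          (linkClauses_append_delVertex_perm v E).mem_iff, hex, clauseMap, List.map_map]; rfl
      rw [hclause1, hclause2]
      have hB1 : (1 : ℝ) ≤ B := by exact_mod_cast (by omega : 1 ≤ B)
      have hstep := abs_clauseMap_sub_le_of_coords hd hlam hle hcrit (hGn N) hη
        (w := fun k => ((B : ℝ) * (k + 1)) ^ γ)
        (fun k => ⟨one_le_rpow (by nlinarith [(Nat.cast_nonneg k : (0 : ℝ) ≤ k)]) hγ.le, hpow k⟩) ts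
        (fun t ht => by
          obtain ⟨h1, h2, h3, h4, h5⟩ := hts t ht
          refine ⟨h1, h2, h3, h4, h5.trans ?_⟩
          have := rpow_neg_budget_le hγ N (B * (t.2.2 + 1)) (by positivity)
          push_cast at this
          rw [mul_assoc]
          exact mul_le_mul_of_nonneg_left this hC)
      have hlen' : ts.length = E.countP (fun e => v ∈ e) := hlen.trans (length_linkClauses v E)
      -- The induction feeds on the first bound only, since below the root a vertex has at most `d`
      -- clauses. The root may have `d + 1` and pays a constant factor once.
      refine ⟨fun hdeg => ?_, ?_⟩
      · exact (hstep.1 (by omega)).trans (mul_le_of_le_one_right (hGn N) hη1)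
      · refine hstep.2.trans (mul_le_mul_of_nonneg_left ?_ (hGn N))
        refine mul_le_mul_of_nonneg_right ?_ (by linarith)
        have := hE.degree v
        rw [hlen']
        exact_mod_cast this

theorem BoundedClauses.delVertex {V : Finset ℕ} {D : ℕ} {E : List (List ℕ)}
    (h : BoundedClauses V D E) (v : ℕ) : BoundedClauses (V.erase v) D (delVertex v E) :=
  ((h.eraseVertex v).perm (linkClauses_append_delVertex_perm v E)).sublist
    (List.sublist_append_right _ _)

theorem approxSum_snd_pos {lam : ℕ × ℕ} (hlam : 0 < lam.2) (B N : ℕ) (V : List ℕ)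
    (E : List (List ℕ)) : 0 < (approxSum lam B N V E).2 := by
  induction V generalizing E with
  | nil => simp only [approxSum]; split_ifs <;> simp
  | cons v V ih => exact Nat.mul_pos (approxRatio_snd_pos hlam B N N v E) (ih _)

/-- Multiplicative error of the approximate partition function. -/
theorem approxSum_bounds {B N D : ℕ} {lam : ℕ × ℕ} {δ : ℝ} (hlam1 : 0 < lam.1) (hlam2 : 0 < lam.2)
    (h : ∀ (V : Finset ℕ) (v : ℕ) (E : List (List ℕ)), BoundedClauses V D E →
      v ∈ V → [] ∉ delVertex v E →
      |ratioCoord (fracVal (approxRatio lam B N N v E)) -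
          ratioCoord (exactRatio (fracVal lam) V v E)| ≤ δ) :
    ∀ (V : List ℕ) (E : List (List ℕ)), V.Nodup → BoundedClauses V.toFinset D E →
      fracVal (approxSum lam B N V E) ≤
        exp (2 * δ * V.length) * indepSum (fracVal lam) V.toFinset E ∧
      indepSum (fracVal lam) V.toFinset E ≤
        exp (2 * δ * V.length) * fracVal (approxSum lam B N V E) := by
  have hlam : 0 < fracVal lam := by
    have h1 : (0 : ℝ) < lam.1 := by exact_mod_cast hlam1
    have h2 : (0 : ℝ) < lam.2 := by exact_mod_cast hlam2
    exact div_pos h1 h2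
  intro V
  induction V with
  | nil =>
    intro E _ hE
    have : fracVal (approxSum lam B N [] E) = indepSum (fracVal lam) ([] : List ℕ).toFinset E := by
      cases E with
      | nil => simp [approxSum, fracVal, indepSum, NoneFull]
      | cons e E =>
        have he : e = [] := List.eq_nil_iff_forall_not_mem.2 fun x hx => by
          have := hE.subset e (by simp) x hx
          simp at this
        rw [indepSum_eq_zero _ _ (by simp [he])]
        simp [approxSum, fracVal]
    rw [this]; simp
  | cons v V ih =>
    intro E hV hE
    obtain ⟨hvV, hV⟩ := List.nodup_cons.1 hV
    have hers : (v :: V).toFinset.erase v = V.toFinset := by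
      rw [List.toFinset_cons, Finset.erase_insert (by simpa using hvV)]
    have hdE := hE.delVertex v
    rw [hers] at hdE
    obtain ⟨h1, h2⟩ := ih (delVertex v E) hV hdE
    have hval : fracVal (approxSum lam B N (v :: V) E) =
        (1 + fracVal (approxRatio lam B N N v E)) *
          fracVal (approxSum lam B N V (delVertex v E)) := by
      have h3 : (0 : ℝ) < (approxRatio lam B N N v E).2 := by
        exact_mod_cast approxRatio_snd_pos hlam2 B N N v E
      have h4 : (0 : ℝ) < (approxSum lam B N V (delVertex v E)).2 := by
        exact_mod_cast approxSum_snd_pos hlam2 B N V (delVertex v E)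
      simp only [fracVal, approxSum]
      push_cast
      field_simp
      rw [add_comm, mul_comm]
    have hvm : v ∈ (v :: V).toFinset := by simp
    by_cases hdel : [] ∈ delVertex v E
    · have h0 : indepSum (fracVal lam) (v :: V).toFinset E = 0 :=
        indepSum_eq_zero _ _ (List.mem_filter.1 hdel).1
      rw [indepSum_eq_zero _ _ hdel, mul_zero] at h1
      have h5 : fracVal (approxSum lam B N V (delVertex v E)) = 0 :=
        le_antisymm h1 (fracVal_nonneg _)
      rw [hval, h5, h0]; simp
    · have hd := h _ v E hE hvm hdel
      have hx := fracVal_nonneg (approxRatio lam B N N v E)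
      have hy := exactRatio_nonneg hlam (v :: V).toFinset v E
      have h3 := one_add_le_exp_mul hx hy hd
      have h4 := one_add_le_exp_mul hy hx (g := δ) (by rwa [abs_sub_comm])
      rw [hval, indepSum_eq_mul hlam hvm E hdel, hers]
      have hexp : exp (2 * δ * (v :: V).length) = exp (2 * δ) * exp (2 * δ * V.length) := by
        rw [← exp_add]; congr 1; rw [List.length_cons]; push_cast; ring
      rw [hexp]
      constructor
      · calc _ ≤ (exp (2 * δ) * (1 + exactRatio (fracVal lam) (v :: V).toFinset v E)) *
            (exp (2 * δ * V.length) * indepSum (fracVal lam) V.toFinset (delVertex v E)) :=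
            mul_le_mul h3 h1 (fracVal_nonneg _) (by positivity)
          _ = _ := by ring
      · calc _ ≤ (exp (2 * δ) * (1 + fracVal (approxRatio lam B N N v E))) *
            (exp (2 * δ * V.length) * fracVal (approxSum lam B N V (delVertex v E))) :=
            mul_le_mul h4 h2 (indepSum_nonneg hlam _ _) (by positivity)
          _ = _ := by ring

/-! ## Running programs -/

/-- `Runs P e x y T`: the evaluation of `e` at `x` yields `y` within `T` steps. -/
def Runs (P : Program) (e : Expr) (x y : Data) (T : ℕ) : Prop := ∃ t ≤ T, Eval P e x y t

namespace Runs

variable {P : Program} {e f c b : Expr} {x y z : Data} {S T : ℕ}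

theorem mono (h : Runs P e x y S) (hST : S ≤ T) : Runs P e x y T :=
  let ⟨t, ht, h⟩ := h; ⟨t, ht.trans hST, h⟩

theorem arg : Runs P .arg x x 1 := ⟨1, le_rfl, .arg x⟩

theorem const {n : ℕ} : Runs P (.const n) x (.nat n) 1 := ⟨1, le_rfl, .const n x⟩

theorem fst (h : Runs P e x (.pair y z) T) : Runs P (.fst e) x y (T + 1) :=
  let ⟨t, ht, h⟩ := h; ⟨t + 1, by omega, .fst h⟩

theorem snd (h : Runs P e x (.pair y z) T) : Runs P (.snd e) x z (T + 1) :=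
  let ⟨t, ht, h⟩ := h; ⟨t + 1, by omega, .snd h⟩

theorem pair (h : Runs P e x y S) (h' : Runs P f x z T) :
    Runs P (.pair e f) x (.pair y z) (S + T + 1) :=
  let ⟨t, ht, h⟩ := h; let ⟨t', ht', h'⟩ := h'; ⟨t + t' + 1, by omega, .pair h h'⟩

theorem arith {o : ArithOp} {m n : ℕ} (h : Runs P e x (.nat m) S) (h' : Runs P f x (.nat n) T) :
    Runs P (.arith o e f) x (.nat (o.apply m n)) (S + T + m.size + n.size + 1) :=
  let ⟨t, ht, h⟩ := h; let ⟨t', ht', h'⟩ := h'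
  ⟨t + t' + m.size + n.size + 1, by omega, .arith h h'⟩

theorem iteTrue (h : Runs P c x y S) (hy : y ≠ .nat 0) (h' : Runs P e x z T) :
    Runs P (.ite c e f) x z (S + T + 1) :=
  let ⟨t, ht, h⟩ := h; let ⟨t', ht', h'⟩ := h'; ⟨t + t' + 1, by omega, .iteTrue h hy h'⟩

theorem iteFalse (h : Runs P c x (.nat 0) S) (h' : Runs P f x z T) :
    Runs P (.ite c e f) x z (S + T + 1) :=
  let ⟨t, ht, h⟩ := h; let ⟨t', ht', h'⟩ := h'; ⟨t + t' + 1, by omega, .iteFalse h h'⟩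

theorem bind (h : Runs P e x y S) (h' : Runs P f y z T) :
    Runs P (.bind e f) x z (S + T + 1) :=
  let ⟨t, ht, h⟩ := h; let ⟨t', ht', h'⟩ := h'; ⟨t + t' + 1, by omega, .bind h h'⟩

theorem call {i : ℕ} (hb : P[i]? = some b) (h' : Runs P b y z T) (h : Runs P e x y S) :
    Runs P (.call i e) x z (S + T + 1) :=
  let ⟨t, ht, h⟩ := h; let ⟨t', ht', h'⟩ := h'; ⟨t + t' + 1, by omega, .call hb h h'⟩

end Runs

/-! ### Programs for lists and clauses -/

/-- A list of numbers as a value. -/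
def natList (l : List ℕ) : Data := .ofList (l.map .nat)

/-- A list of clauses as a value. -/
def clauseData (E : List (List ℕ)) : Data := .ofList (E.map natList)

/-- A fraction as a value. -/
def fracData (x : ℕ × ℕ) : Data := .pair (.nat x.1) (.nat x.2)

theorem natList_cons (x : ℕ) (l : List ℕ) : natList (x :: l) = .pair (.nat x) (natList l) := rfl

theorem clauseData_cons (e : List ℕ) (E : List (List ℕ)) :
    clauseData (e :: E) = .pair (natList e) (clauseData E) := rfl

namespace Code

/-- Nonzero iff the two numbers differ. -/
def neq (e f : Expr) : Expr := .arith .add (.arith .sub e f) (.arith .sub f e)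

/-- `(v, l) ↦ (v, head of l)`. -/
def headArg : Expr := .pair (.fst .arg) (.fst (.snd .arg))

/-- `(v, l) ↦ (v, tail of l)`. -/
def tailArg : Expr := .pair (.fst .arg) (.snd (.snd .arg))

/-- Membership in a list of numbers. -/
def mem : Expr := .ite (.snd .arg)
  (.ite (neq (.fst .arg) (.fst (.snd .arg))) (.call 1 tailArg) (.const 1)) (.const 0)

/-- Removal of a number from a list. -/
def remove : Expr := .ite (.snd .arg)
  (.ite (neq (.fst .arg) (.fst (.snd .arg)))
    (.pair (.fst (.snd .arg)) (.call 2 tailArg)) (.call 2 tailArg)) (.const 0)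

/-- The program for `eraseVertex`. -/
def erase : Expr := .ite (.snd .arg) (.pair (.call 2 headArg) (.call 3 tailArg)) (.const 0)

/-- The program for `linkClauses`. -/
def link : Expr := .ite (.snd .arg)
  (.ite (.call 1 headArg) (.pair (.call 2 headArg) (.call 4 tailArg)) (.call 4 tailArg)) (.const 0)

/-- The program for `delVertex`. -/
def del : Expr := .ite (.snd .arg)
  (.ite (.call 1 headArg) (.call 5 tailArg) (.pair (.fst (.snd .arg)) (.call 5 tailArg))) (.const 0)

/-- The length of a list. -/
def length : Expr := .ite .arg (.arith .add (.const 1) (.call 6 (.snd .arg))) (.const 0)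

/-- `((s, t), (x :: l, F)) ↦ x`. -/
def head : Expr := .fst (.fst (.snd .arg))

/-- `((s, t), (x :: l, F)) ↦ l`. -/
def tail : Expr := .snd (.fst (.snd .arg))

/-- The program for `approxRatio`. -/
def ratio : Expr :=
  .bind (.pair (.fst (.fst .arg))
      (.call 8 (.pair (.fst .arg) (.pair (.call 4 (.snd .arg)) (.call 5 (.snd .arg))))))
    (.pair (.arith .mul (.fst (.fst .arg)) (.fst (.snd .arg)))
      (.arith .mul (.snd (.fst .arg)) (.snd (.snd .arg))))

/-- The program for `noClauseFull`. -/
def noFull (B : ℕ) : Expr := .ite (.fst (.snd .arg))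
  (.bind
    (.pair
      (.call 9 (.pair (.pair (.fst (.fst .arg)) (.arith .div (.snd (.fst .arg))
        (.arith .mul (.const B) (.arith .add (.call 6 head) (.const 1)))))
        (.pair head (.snd (.snd .arg)))))
      (.call 8 (.pair (.fst .arg) (.pair tail (.pair head (.snd (.snd .arg)))))))
    (.pair
      (.arith .mul (.arith .sub (.snd (.fst .arg)) (.fst (.fst .arg))) (.fst (.snd .arg)))
      (.arith .mul (.snd (.fst .arg)) (.snd (.snd .arg)))))
  (.pair (.const 1) (.const 1))

/-- The program for `allIn`. -/
def allFull : Expr := .ite (.fst (.snd .arg))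
  (.ite (.snd (.fst .arg))
    (.bind
      (.pair (.call 7 (.pair (.fst .arg) (.pair head (.snd (.snd .arg)))))
        (.call 9 (.pair (.fst .arg) (.pair tail (.call 3 (.pair head (.snd (.snd .arg))))))))
      (.pair
        (.arith .mul (.fst (.fst .arg)) (.fst (.snd .arg)))
        (.arith .mul (.arith .add (.fst (.fst .arg)) (.snd (.fst .arg))) (.snd (.snd .arg)))))
    (.pair (.const 0) (.const 1)))
  (.pair (.const 1) (.const 1))

/-- The program for `approxSum`. -/
def sum : Expr := .ite (.fst (.snd .arg))
  (.bind
    (.pair (.call 7 (.pair (.fst .arg) (.pair head (.snd (.snd .arg)))))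
      (.call 10 (.pair (.fst .arg) (.pair tail (.call 5 (.pair head (.snd (.snd .arg))))))))
    (.pair
      (.arith .mul (.arith .add (.fst (.fst .arg)) (.snd (.fst .arg))) (.fst (.snd .arg)))
      (.arith .mul (.snd (.fst .arg)) (.snd (.snd .arg)))))
  (.ite (.snd (.snd .arg)) (.pair (.const 0) (.const 1)) (.pair (.const 1) (.const 1)))

end Code

/-- The program `P` contains the functions of the recursion at their places. -/
structure HasCore (B : ℕ) (P : Program) : Prop where
  mem : P[1]? = some Code.mem
  remove : P[2]? = some Code.remove
  erase : P[3]? = some Code.erase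
  link : P[4]? = some Code.link
  del : P[5]? = some Code.del
  length : P[6]? = some Code.length
  ratio : P[7]? = some Code.ratio
  noFull : P[8]? = some (Code.noFull B)
  allFull : P[9]? = some Code.allFull
  sum : P[10]? = some Code.sum

section
variable {B : ℕ} {P : Program} {S : ℕ}

theorem runs_neq {e f : Expr} {x : Data} {m n T T' : ℕ} (h : Runs P e x (.nat m) T)
    (h' : Runs P f x (.nat n) T') (hm : m.size ≤ S) (hn : n.size ≤ S) :
    Runs P (Code.neq e f) x (.nat ((m - n) + (n - m))) (2 * (T + T') + 6 * S + 3) := by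
  refine (Runs.arith (Runs.arith h h') (Runs.arith h' h)).mono ?_
  simp only [ArithOp.apply]
  have h1 := Nat.size_le_size (Nat.sub_le m n)
  have h2 := Nat.size_le_size (Nat.sub_le n m)
  omega

theorem Data.nat_ne_zero {n : ℕ} (h : n ≠ 0) : Data.nat n ≠ .nat 0 := fun h' => h (by injection h')

theorem runs_mem (hP : HasCore B P) {v : ℕ} (hv : v.size ≤ S) (l : List ℕ)
    (hl : ∀ x ∈ l, x.size ≤ S) :
    Runs P Code.mem (.pair (.nat v) (natList l)) (.nat (if v ∈ l then 1 else 0))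
      ((l.length + 1) * (6 * S + 40)) := by
  induction l with
  | nil =>
    refine Runs.mono (Runs.iteFalse (Runs.snd Runs.arg) Runs.const) ?_
    simp
  | cons x l ih =>
    have h1 := ih fun x hx => hl x (by simp [hx])
    have hx := hl x (by simp)
    rw [natList_cons]
    have h2 := runs_neq (P := P) (Runs.fst (Runs.arg (x := .pair (.nat v) (.pair (.nat x) (natList l)))))
      (Runs.fst (Runs.snd Runs.arg)) hv hx
    by_cases hvx : v = x
    · subst hvx
      rw [if_pos (by simp)]
      refine Runs.mono (Runs.iteTrue (Runs.snd Runs.arg) (by simp)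
        (Runs.iteFalse (by simpa using h2) Runs.const)) ?_
      simp only [List.length_cons]; nlinarith
    · have : (v ∈ x :: l) ↔ v ∈ l := by simp [hvx]
      simp only [this]
      refine Runs.mono (Runs.iteTrue (Runs.snd Runs.arg) (by simp)
        (Runs.iteTrue h2 (Data.nat_ne_zero (by omega)) (Runs.call hP.mem h1
          (Runs.pair (Runs.fst Runs.arg) (Runs.snd (Runs.snd Runs.arg)))))) ?_
      simp only [List.length_cons]; nlinarith

theorem runs_remove (hP : HasCore B P) {v : ℕ} (hv : v.size ≤ S) (l : List ℕ)
    (hl : ∀ x ∈ l, x.size ≤ S) :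
    Runs P Code.remove (.pair (.nat v) (natList l)) (natList (l.filter fun x => x ≠ v))
      ((l.length + 1) * (6 * S + 40)) := by
  induction l with
  | nil =>
    refine Runs.mono (Runs.iteFalse (Runs.snd Runs.arg) Runs.const) ?_
    simp
  | cons x l ih =>
    have h1 := ih fun x hx => hl x (by simp [hx])
    have hx := hl x (by simp)
    rw [natList_cons]
    have h2 := runs_neq (P := P) (Runs.fst (Runs.arg (x := .pair (.nat v) (.pair (.nat x) (natList l)))))
      (Runs.fst (Runs.snd Runs.arg)) hv hx
    have h3 := Runs.call hP.remove h1
      (Runs.pair (Runs.fst Runs.arg) (Runs.snd (Runs.snd (Runs.arg (x := .pair (.nat v) (.pair (.nat x) (natList l)))))))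
    by_cases hvx : v = x
    · subst hvx
      rw [List.filter_cons_of_neg (by simp)]
      refine Runs.mono (Runs.iteTrue (Runs.snd Runs.arg) (by simp)
        (Runs.iteFalse (by simpa using h2) h3)) ?_
      simp only [List.length_cons]; nlinarith
    · rw [List.filter_cons_of_pos (by simpa using Ne.symm hvx), natList_cons]
      refine Runs.mono (Runs.iteTrue (Runs.snd Runs.arg) (by simp)
        (Runs.iteTrue h2 (Data.nat_ne_zero (by omega)) (Runs.pair (Runs.fst (Runs.snd Runs.arg)) h3))) ?_
      simp only [List.length_cons]; nlinarith

theorem runs_length (hP : HasCore B P) (l : List Data) :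
    Runs P Code.length (.ofList l) (.nat l.length) ((l.length + 1) * (l.length + 12)) := by
  induction l with
  | nil => exact Runs.mono (Runs.iteFalse Runs.arg Runs.const) (by simp)
  | cons x l ih =>
    have := Runs.arith (o := .add) (Runs.const (n := 1))
      (Runs.call hP.length ih (Runs.snd (Runs.arg (x := .ofList (x :: l)))))
    simp only [ArithOp.apply, Nat.add_comm 1] at this
    refine Runs.mono (Runs.iteTrue Runs.arg (by simp [Data.ofList]) this) ?_
    have h1 : (l.length).size ≤ l.length := Nat.size_le.2 Nat.lt_two_pow_self
    have h2 : Nat.size 1 = 1 := Nat.size_one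
    simp only [List.length_cons]; nlinarith

/-- Bounds on the size of a clause list and on its degrees. -/
structure SmallClauses (S D : ℕ) (E : List (List ℕ)) : Prop where
  length : E.length ≤ S
  clause : ∀ e ∈ E, e.length ≤ S ∧ ∀ x ∈ e, x.size ≤ S
  degree : ∀ v, E.countP (fun e => v ∈ e) ≤ D

variable {D : ℕ}

theorem SmallClauses.perm {E E' : List (List ℕ)} (h : SmallClauses S D E) (p : E.Perm E') :
    SmallClauses S D E' :=
  ⟨p.length_eq ▸ h.length, fun e he => h.clause e (p.mem_iff.2 he),
    fun v => (p.countP_eq _) ▸ h.degree v⟩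

theorem SmallClauses.sublist {E E' : List (List ℕ)} (h : SmallClauses S D E) (p : E'.Sublist E) :
    SmallClauses S D E' :=
  ⟨p.length_le.trans h.length, fun e he => h.clause e (p.subset he),
    fun v => p.countP_le.trans (h.degree v)⟩

theorem SmallClauses.eraseVertex {E : List (List ℕ)} (h : SmallClauses S D E) (v : ℕ) :
    SmallClauses S D (eraseVertex v E) := by
  refine ⟨by simpa [_root_.eraseVertex] using h.length, ?_, fun w => ?_⟩
  · simp only [_root_.eraseVertex, List.mem_map]
    rintro _ ⟨e, he, rfl⟩
    exact ⟨(List.length_filter_le _ _).trans (h.clause e he).1,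
      fun x hx => (h.clause e he).2 x (List.mem_filter.1 hx).1⟩
  · refine le_trans ?_ (h.degree w)
    rw [_root_.eraseVertex, List.countP_map]
    refine List.countP_mono_left fun e _ h => ?_
    simp only [Function.comp_apply, decide_eq_true_eq, List.mem_filter] at h ⊢
    exact h.1

/-- The cost of a pass over one clause. -/
def clauseCost (S : ℕ) : ℕ := (S + 1) * (6 * S + 40)

theorem runs_erase (hP : HasCore B P) {v : ℕ} (hv : v.size ≤ S) (E : List (List ℕ))
    (hE : ∀ e ∈ E, e.length ≤ S ∧ ∀ x ∈ e, x.size ≤ S) :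
    Runs P Code.erase (.pair (.nat v) (clauseData E)) (clauseData (eraseVertex v E))
      ((E.length + 1) * (clauseCost S + 30)) := by
  induction E with
  | nil =>
    refine Runs.mono (Runs.iteFalse (Runs.snd Runs.arg) Runs.const) ?_
    simp
  | cons e E ih =>
    have h1 := ih fun x hx => hE x (by simp [hx])
    obtain ⟨he, he'⟩ := hE e (by simp)
    have h2 := (runs_remove hP hv e he').mono (T := clauseCost S)
      (Nat.mul_le_mul_right _ (by omega))
    rw [clauseData_cons, show eraseVertex v (e :: E) =
      e.filter (fun x => x ≠ v) :: eraseVertex v E from rfl, clauseData_cons]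
    refine Runs.mono (Runs.iteTrue (Runs.snd Runs.arg) (by simp)
      (Runs.pair (Runs.call hP.remove h2 (Runs.pair (Runs.fst Runs.arg)
        (Runs.fst (Runs.snd Runs.arg)))) (Runs.call hP.erase h1
          (Runs.pair (Runs.fst Runs.arg) (Runs.snd (Runs.snd Runs.arg)))))) ?_
    simp only [List.length_cons]; nlinarith

theorem runs_link (hP : HasCore B P) {v : ℕ} (hv : v.size ≤ S) (E : List (List ℕ))
    (hE : ∀ e ∈ E, e.length ≤ S ∧ ∀ x ∈ e, x.size ≤ S) :
    Runs P Code.link (.pair (.nat v) (clauseData E)) (clauseData (linkClauses v E))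
      ((E.length + 1) * (2 * clauseCost S + 40)) := by
  induction E with
  | nil =>
    refine Runs.mono (Runs.iteFalse (Runs.snd Runs.arg) Runs.const) ?_
    simp
  | cons e E ih =>
    have h1 := ih fun x hx => hE x (by simp [hx])
    obtain ⟨he, he'⟩ := hE e (by simp)
    have h2 := (runs_remove hP hv e he').mono (T := clauseCost S)
      (Nat.mul_le_mul_right _ (by omega))
    have h3 := (runs_mem hP hv e he').mono (T := clauseCost S)
      (Nat.mul_le_mul_right _ (by omega))
    rw [clauseData_cons]
    have h4 := Runs.call hP.link h1 (Runs.pair (Runs.fst Runs.arg)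
      (Runs.snd (Runs.snd (Runs.arg (x := .pair (.nat v) (.pair (natList e) (clauseData E)))))))
    have h5 := Runs.call hP.mem h3 (Runs.pair (Runs.fst Runs.arg)
      (Runs.fst (Runs.snd (Runs.arg (x := .pair (.nat v) (.pair (natList e) (clauseData E)))))))
    by_cases hve : v ∈ e
    · rw [if_pos hve] at h5
      have : linkClauses v (e :: E) = e.filter (fun x => x ≠ v) :: linkClauses v E := by
        simp [linkClauses, eraseVertex, hve]
      rw [this, clauseData_cons]
      refine Runs.mono (Runs.iteTrue (Runs.snd Runs.arg) (by simp)
        (Runs.iteTrue h5 (by simp) (Runs.pair (Runs.call hP.remove h2 (Runs.pair (Runs.fst Runs.arg)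
          (Runs.fst (Runs.snd Runs.arg)))) h4))) ?_
      simp only [List.length_cons]; nlinarith
    · rw [if_neg hve] at h5
      have : linkClauses v (e :: E) = linkClauses v E := by
        simp [linkClauses, hve]
      rw [this]
      refine Runs.mono (Runs.iteTrue (Runs.snd Runs.arg) (by simp) (Runs.iteFalse h5 h4)) ?_
      simp only [List.length_cons]; nlinarith

theorem runs_del (hP : HasCore B P) {v : ℕ} (hv : v.size ≤ S) (E : List (List ℕ))
    (hE : ∀ e ∈ E, e.length ≤ S ∧ ∀ x ∈ e, x.size ≤ S) :
    Runs P Code.del (.pair (.nat v) (clauseData E)) (clauseData (delVertex v E))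
      ((E.length + 1) * (clauseCost S + 40)) := by
  induction E with
  | nil =>
    refine Runs.mono (Runs.iteFalse (Runs.snd Runs.arg) Runs.const) ?_
    simp
  | cons e E ih =>
    have h1 := ih fun x hx => hE x (by simp [hx])
    obtain ⟨he, he'⟩ := hE e (by simp)
    have h3 := (runs_mem hP hv e he').mono (T := clauseCost S)
      (Nat.mul_le_mul_right _ (by omega))
    rw [clauseData_cons]
    have h4 := Runs.call hP.del h1 (Runs.pair (Runs.fst Runs.arg)
      (Runs.snd (Runs.snd (Runs.arg (x := .pair (.nat v) (.pair (natList e) (clauseData E)))))))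
    have h5 := Runs.call hP.mem h3 (Runs.pair (Runs.fst Runs.arg)
      (Runs.fst (Runs.snd (Runs.arg (x := .pair (.nat v) (.pair (natList e) (clauseData E)))))))
    by_cases hve : v ∈ e
    · rw [if_pos hve] at h5
      have : delVertex v (e :: E) = delVertex v E := by simp [delVertex, hve]
      rw [this]
      refine Runs.mono (Runs.iteTrue (Runs.snd Runs.arg) (by simp)
        (Runs.iteTrue h5 (by simp) h4)) ?_
      simp only [List.length_cons]; nlinarith
    · rw [if_neg hve] at h5
      have : delVertex v (e :: E) = e :: delVertex v E := by simp [delVertex, hve]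
      rw [this, clauseData_cons]
      refine Runs.mono (Runs.iteTrue (Runs.snd Runs.arg) (by simp) (Runs.iteFalse h5
        (Runs.pair (Runs.fst (Runs.snd Runs.arg)) h4))) ?_
      simp only [List.length_cons]; nlinarith

end

/-! ## Bit lengths and running time of the recursion -/

theorem Nat.size_mul_le (a b : ℕ) : (a * b).size ≤ a.size + b.size := by
  rw [Nat.size_le, pow_add]
  exact Nat.mul_lt_mul'' (Nat.lt_size_self a) (Nat.lt_size_self b)

theorem Nat.size_add_le (a b : ℕ) : (a + b).size ≤ max a.size b.size + 1 := by
  rw [Nat.size_le, pow_succ]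
  have h1 := (Nat.lt_size_self a).trans_le (Nat.pow_le_pow_right two_pos (le_max_left a.size b.size))
  have h2 := (Nat.lt_size_self b).trans_le (Nat.pow_le_pow_right two_pos (le_max_right a.size b.size))
  omega

theorem Nat.size_le_self' (n : ℕ) : n.size ≤ n := Nat.size_le.2 Nat.lt_two_pow_self

/-- The larger bit length of numerator and denominator. -/
def fracBits (x : ℕ × ℕ) : ℕ := max x.1.size x.2.size

theorem fracBits_le {x : ℕ × ℕ} {b : ℕ} : fracBits x ≤ b ↔ x.1.size ≤ b ∧ x.2.size ≤ b := by
  simp [fracBits]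

section
variable {r : ℕ → ℕ → List (List ℕ) → ℕ × ℕ} {B : ℕ} {S D : ℕ}

/-- Fractions are never reduced, so bit lengths add along products; a vertex contributes at most `c
* M + 1 ≤ M * (c + 1)` bits because `M` is positive whenever the recursion continues. -/
theorem fracBits_allIn_le {c M : ℕ} (hr : M ≠ 0 → ∀ u F, SmallClauses S D F →
      fracBits (r M u F) ≤ c * M) (e : List ℕ) (F : List (List ℕ))
    (hF : SmallClauses S D F) :
    fracBits (allIn r M e F) ≤ 1 + e.length * M * (c + 1) := by
  induction e generalizing F with
  | nil => simp [allIn, fracBits]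
  | cons u e ih =>
    by_cases hM : M = 0
    · simp [allIn, hM, fracBits]
    · have h1 := fracBits_le.1 (ih (eraseVertex u F) (hF.eraseVertex u))
      have h2 := fracBits_le.1 (hr hM u F hF)
      simp only [allIn, if_neg hM]
      have h3 := Nat.size_mul_le (r M u F).1 (allIn r M e (eraseVertex u F)).1
      have h4 := Nat.size_mul_le ((r M u F).1 + (r M u F).2) (allIn r M e (eraseVertex u F)).2
      have h5 := Nat.size_add_le (r M u F).1 (r M u F).2
      have h6 : c * M + 1 + (1 + e.length * M * (c + 1)) ≤
          1 + (u :: e).length * M * (c + 1) := by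
        have : 1 ≤ M := Nat.one_le_iff_ne_zero.2 hM
        simp only [List.length_cons]; nlinarith
      rw [fracBits_le]
      have h7 : max (r M u F).1.size (r M u F).2.size ≤ c * M := max_le h2.1 h2.2
      constructor
      · exact h3.trans (by omega)
      · exact h4.trans (by omega)

/-- The budgets of the `k` vertices of one clause add up to at most `N / B`. For at most `D` clauses
and `B = 2 * D` the total is at most `N / 2`, which makes bit lengths and running time linear in the
budget. -/
theorem budget_mul_le (B N k : ℕ) : B * (k * (N / (B * (k + 1)))) ≤ N := by
  calc B * (k * (N / (B * (k + 1)))) ≤ B * ((k + 1) * (N / (B * (k + 1)))) :=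
        Nat.mul_le_mul_left _ (Nat.mul_le_mul_right _ (Nat.le_succ k))
    _ = N / (B * (k + 1)) * (B * (k + 1)) := by ring
    _ ≤ N := Nat.div_mul_le_self _ _

/-- The bound is multiplied by `B` so that no rounded quotient `N / B` has to be summed. -/
theorem fracBits_noClauseFull_le {c N : ℕ} (hr : ∀ k, N / (B * (k + 1)) ≠ 0 → ∀ u F,
      SmallClauses S D F → fracBits (r (N / (B * (k + 1))) u F) ≤ c * (N / (B * (k + 1))))
    (L F : List (List ℕ)) (hLF : SmallClauses S D (L ++ F)) :
    B * fracBits (noClauseFull r B N L F) ≤ B + L.length * (B + (c + 1) * N) := by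
  induction L generalizing F with
  | nil => simp [noClauseFull, fracBits]
  | cons e L ih =>
    have h1 := ih (e :: F) (hLF.perm List.perm_middle.symm)
    have h2 := fracBits_allIn_le (hr e.length) e F
      (hLF.sublist (List.sublist_append_right (e :: L) F))
    have h3 := budget_mul_le B N e.length
    set q := allIn r (N / (B * (e.length + 1))) e F with hq
    set p := noClauseFull r B N L (e :: F) with hp
    have h4 : fracBits (noClauseFull r B N (e :: L) F) ≤ fracBits q + fracBits p := by
      have hq' := fracBits_le.1 (le_refl (fracBits q))
      have hp' := fracBits_le.1 (le_refl (fracBits p))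
      rw [fracBits_le]
      constructor
      · refine (Nat.size_mul_le _ _).trans (add_le_add ?_ hp'.1)
        exact (Nat.size_le_size (Nat.sub_le _ _)).trans hq'.2
      · exact (Nat.size_mul_le _ _).trans (add_le_add hq'.2 hp'.2)
    set M := N / (B * (e.length + 1))
    calc B * fracBits (noClauseFull r B N (e :: L) F) ≤ B * (fracBits q + fracBits p) :=
          Nat.mul_le_mul_left _ h4
      _ = B * fracBits q + B * fracBits p := by ring
      _ ≤ B * (1 + e.length * M * (c + 1)) + (B + L.length * (B + (c + 1) * N)) :=
          add_le_add (Nat.mul_le_mul_left _ h2) h1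
      _ = B + B * (e.length * M) * (c + 1) + (B + L.length * (B + (c + 1) * N)) := by ring
      _ ≤ B + N * (c + 1) + (B + L.length * (B + (c + 1) * N)) := by
          have := Nat.mul_le_mul_right (c + 1) h3
          omega
      _ = B + (e :: L).length * (B + (c + 1) * N) := by
          simp only [List.length_cons]; ring

end

theorem SmallClauses.link_append_del {S D : ℕ} {E : List (List ℕ)} (h : SmallClauses S D E)
    (v : ℕ) : SmallClauses S D (linkClauses v E ++ delVertex v E) :=
  (h.eraseVertex v).perm (linkClauses_append_delVertex_perm v E)

theorem SmallClauses.length_link_le {S D : ℕ} {E : List (List ℕ)} (h : SmallClauses S D E)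
    (v : ℕ) : (linkClauses v E).length ≤ D := by
  rw [length_linkClauses]; exact h.degree v

/-- The number of bits per unit of budget. -/
def bitRate (D b : ℕ) : ℕ := 2 * b + 2 * D + 3

/-- A rate of `c` bits per unit of budget reproduces itself: the calls contribute `c * N / 2`, and
the other half covers the overhead. `bitRate` is chosen so that this closes for `N ≥ 1`. -/
theorem fracBits_approxRatio_le {S D : ℕ} {lam : ℕ × ℕ} (hD : 0 < D) (n : ℕ) :
    ∀ N v E, 1 ≤ N → SmallClauses S D E →
      fracBits (approxRatio lam (2 * D) n N v E) ≤ bitRate D (fracBits lam) * N := by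
  set c := bitRate D (fracBits lam) with hc
  have hc3 : 2 * fracBits lam + 2 * D + 3 = c := rfl
  induction n with
  | zero =>
    intro N v E hN _
    have : fracBits (approxRatio lam (2 * D) 0 N v E) = 1 := by simp [approxRatio, fracBits]
    rw [this]; nlinarith
  | succ n ih =>
    intro N v E hN hE
    have h1 := fracBits_noClauseFull_le (r := approxRatio lam (2 * D) n) (B := 2 * D) (c := c)
      (N := N) (S := S) (D := D)
      (fun k hk u F hF => ih _ u F (Nat.one_le_iff_ne_zero.2 hk) hF)
      (linkClauses v E) (delVertex v E) (hE.link_append_del v)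
    have h2 := hE.length_link_le v
    set p := noClauseFull (approxRatio lam (2 * D) n) (2 * D) N (linkClauses v E) (delVertex v E)
    have h3 : fracBits (approxRatio lam (2 * D) (n + 1) N v E) ≤ fracBits lam + fracBits p := by
      have hq' := fracBits_le.1 (le_refl (fracBits lam))
      have hp' := fracBits_le.1 (le_refl (fracBits p))
      rw [fracBits_le]
      exact ⟨(Nat.size_mul_le _ _).trans (add_le_add hq'.1 hp'.1),
        (Nat.size_mul_le _ _).trans (add_le_add hq'.2 hp'.2)⟩
    have h4 : 2 * D * fracBits p ≤ D * (2 + (2 * D + (c + 1) * N)) := by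
      have := Nat.mul_le_mul_right (2 * D + (c + 1) * N) h2
      nlinarith
    have h5 : 2 * fracBits p ≤ 2 + (2 * D + (c + 1) * N) :=
      Nat.le_of_mul_le_mul_left (by linarith) hD
    refine h3.trans ?_
    have h6 : 2 * (fracBits lam + fracBits p) ≤ 2 * (c * N) := by nlinarith
    omega

/-- The overhead of one call in the recursion, apart from the recursive calls. -/
def callCost (S β : ℕ) : ℕ := 4 * ((S + 1) * (2 * clauseCost S + 40)) + 40 * β + 200

section
variable {B : ℕ} {P : Program} {S D : ℕ} {r : ℕ → ℕ → List (List ℕ) → ℕ × ℕ} {lam : ℕ × ℕ}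

/-- `A₁` is the cost of a ratio computation per unit of budget; `β` bounds the bit lengths that are
charged for arithmetic. -/
theorem runs_allFull (hP : HasCore B P) {M A₁ c β : ℕ}
    (hβ : ∀ k, k ≤ S → 1 + k * M * (c + 1) ≤ β) (hMβ : c * M ≤ β)
    (hbits : M ≠ 0 → ∀ u F, SmallClauses S D F → fracBits (r M u F) ≤ c * M)
    (hr : M ≠ 0 → ∀ u F, u.size ≤ S → SmallClauses S D F → Runs P Code.ratio
      (.pair (.pair (fracData lam) (.nat M)) (.pair (.nat u) (clauseData F)))
      (fracData (r M u F)) (A₁ * M))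
    (e : List ℕ) (F : List (List ℕ)) (he : e.length ≤ S) (hes : ∀ x ∈ e, x.size ≤ S)
    (hF : SmallClauses S D F) :
    Runs P Code.allFull (.pair (.pair (fracData lam) (.nat M)) (.pair (natList e) (clauseData F)))
      (fracData (allIn r M e F)) (callCost S β + e.length * M * (callCost S β + A₁)) := by
  have hA0 : callCost S β = 4 * ((S + 1) * (2 * clauseCost S + 40)) + 40 * β + 200 := rfl
  induction e generalizing F with
  | nil =>
    refine Runs.mono (Runs.iteFalse (Runs.fst (Runs.snd Runs.arg))
      (Runs.pair Runs.const Runs.const)) (by omega)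
  | cons u e ih =>
    rw [natList_cons]
    by_cases hM : M = 0
    · subst hM
      have : allIn r 0 (u :: e) F = (0, 1) := by simp [allIn]
      rw [this]
      refine Runs.mono (Runs.iteTrue (Runs.fst (Runs.snd Runs.arg)) (by simp)
        (Runs.iteFalse (Runs.snd (Runs.fst Runs.arg)) (Runs.pair Runs.const Runs.const))) (by omega)
    · have hus := hes u (by simp)
      have he' : e.length ≤ S := by simp at he; omega
      have h1 := ih (eraseVertex u F) he' (fun x hx => hes x (by simp [hx])) (hF.eraseVertex u)
      have h2 := hr hM u F hus hF
      have hb2 := fracBits_le.1 (hbits hM u F hF)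
      have hb1 := fracBits_le.1 (fracBits_allIn_le hbits e (eraseVertex u F) (hF.eraseVertex u))
      have h3 := (runs_erase hP hus F hF.clause).mono (T := (S + 1) * (2 * clauseCost S + 40))
        (Nat.mul_le_mul (by have := hF.length; omega) (by omega))
      have hval : allIn r M (u :: e) F = ((r M u F).1 * (allIn r M e (eraseVertex u F)).1,
        ((r M u F).1 + (r M u F).2) * (allIn r M e (eraseVertex u F)).2) := by
        simp only [allIn, if_neg hM]
      rw [hval]
      set x := r M u F
      set q := allIn r M e (eraseVertex u F)
      have hsum := Nat.size_add_le x.1 x.2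
      have hβ' := hβ e.length he'
      have hstep := Runs.iteTrue (P := P) (f := .pair (.const 1) (.const 1))
        (Runs.fst (Runs.snd (Runs.arg
          (x := .pair (.pair (fracData lam) (.nat M)) (.pair (.pair (.nat u) (natList e)) (clauseData F))))))
        (by simp) (Runs.iteTrue (f := .pair (.const 0) (.const 1)) (Runs.snd (Runs.fst Runs.arg)) (Data.nat_ne_zero hM)
          (Runs.bind
            (Runs.pair
              (Runs.call hP.ratio h2 (Runs.pair (Runs.fst Runs.arg)
                (Runs.pair (Runs.fst (Runs.fst (Runs.snd Runs.arg))) (Runs.snd (Runs.snd Runs.arg)))))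
              (Runs.call hP.allFull h1 (Runs.pair (Runs.fst Runs.arg)
                (Runs.pair (Runs.snd (Runs.fst (Runs.snd Runs.arg)))
                  (Runs.call hP.erase h3 (Runs.pair (Runs.fst (Runs.fst (Runs.snd Runs.arg)))
                    (Runs.snd (Runs.snd Runs.arg))))))))
            (Runs.pair
              (Runs.arith (o := .mul) (Runs.fst (Runs.fst Runs.arg)) (Runs.fst (Runs.snd Runs.arg)))
              (Runs.arith (o := .mul) (Runs.arith (o := .add) (Runs.fst (Runs.fst Runs.arg)) (Runs.snd (Runs.fst Runs.arg)))
                (Runs.snd (Runs.snd Runs.arg))))))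
      refine Runs.mono hstep ?_
      simp only [ArithOp.apply, List.length_cons]
      have hM1 : 1 ≤ M := Nat.one_le_iff_ne_zero.2 hM
      have h7 : callCost S β ≤ M * callCost S β := Nat.le_mul_of_pos_left _ hM1
      have h8 : (e.length + 1) * M * (callCost S β + A₁) =
        e.length * M * (callCost S β + A₁) + M * callCost S β + A₁ * M := by ring
      have h9 : max x.1.size x.2.size ≤ c * M := max_le hb2.1 hb2.2
      rw [h8]
      omega

theorem runs_noFull (hP : HasCore B P) {N A₁ c β : ℕ}
    (hβ : ∀ k l, k ≤ S → l ≤ S → 1 + k * (N / (B * (l + 1))) * (c + 1) ≤ β)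
    (hMβ : c * N ≤ β)
    (hNβ : N.size + B.size + S ≤ β)
    (hpβ : ∀ L F, SmallClauses S D (L ++ F) → fracBits (noClauseFull r B N L F) ≤ β)
    (hbits : ∀ k, N / (B * (k + 1)) ≠ 0 → ∀ u F, SmallClauses S D F →
      fracBits (r (N / (B * (k + 1))) u F) ≤ c * (N / (B * (k + 1))))
    (hr : ∀ k, N / (B * (k + 1)) ≠ 0 → ∀ u F, u.size ≤ S → SmallClauses S D F → Runs P Code.ratio
      (.pair (.pair (fracData lam) (.nat (N / (B * (k + 1))))) (.pair (.nat u) (clauseData F)))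
      (fracData (r (N / (B * (k + 1))) u F)) (A₁ * (N / (B * (k + 1)))))
    (L F : List (List ℕ)) (hLF : SmallClauses S D (L ++ F)) :
    ∃ T, Runs P (Code.noFull B)
      (.pair (.pair (fracData lam) (.nat N)) (.pair (clauseData L) (clauseData F)))
      (fracData (noClauseFull r B N L F)) T ∧
      B * T ≤ B * callCost S β + L.length * (B * (2 * callCost S β) + (callCost S β + A₁) * N) := by
  have hA0 : callCost S β = 4 * ((S + 1) * (2 * clauseCost S + 40)) + 40 * β + 200 := rfl
  induction L generalizing F with
  | nil =>
    refine ⟨_, Runs.iteFalse (Runs.fst (Runs.snd Runs.arg)) (Runs.pair Runs.const Runs.const), ?_⟩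
    exact (Nat.mul_le_mul_left B (by omega)).trans (Nat.le_add_right _ _)
  | cons e L ih =>
    obtain ⟨T₁, h1, hT₁⟩ := ih (e :: F) (hLF.perm List.perm_middle.symm)
    have hF := hLF.sublist (List.sublist_append_right (e :: L) F)
    obtain ⟨heS, heS'⟩ := hLF.clause e (by simp)
    have h2 := runs_allFull hP (β := β) (fun k hk => hβ k e.length hk heS)
      ((Nat.mul_le_mul_left c (Nat.div_le_self _ _)).trans hMβ) (hbits e.length) (hr e.length) e F
      heS heS' hF
    have hb2 := fracBits_le.1 ((fracBits_allIn_le (hbits e.length) e F hF).trans (hβ e.length e.length heS heS))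
    have hb1 := fracBits_le.1 (hpβ L (e :: F) (hLF.perm List.perm_middle.symm))
    have hlen := runs_length hP (e.map Data.nat)
    rw [List.length_map] at hlen
    have hlen' := hlen.mono (T := (S + 1) * (2 * clauseCost S + 40))
      (Nat.mul_le_mul (by omega) (by unfold clauseCost; nlinarith))
    have hbud := budget_mul_le B N e.length
    rw [show noClauseFull r B N (e :: L) F =
      (((allIn r (N / (B * (e.length + 1))) e F).2 - (allIn r (N / (B * (e.length + 1))) e F).1) *
        (noClauseFull r B N L (e :: F)).1,
        (allIn r (N / (B * (e.length + 1))) e F).2 * (noClauseFull r B N L (e :: F)).2) from rfl]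
    set q := allIn r (N / (B * (e.length + 1))) e F
    set p := noClauseFull r B N L (e :: F)
    have hstep := Runs.iteTrue (P := P) (f := .pair (.const 1) (.const 1))
      (Runs.fst (Runs.snd (Runs.arg
        (x := .pair (.pair (fracData lam) (.nat N)) (.pair (.pair (natList e) (clauseData L)) (clauseData F))))))
      (by simp)
      (Runs.bind
        (Runs.pair
          (Runs.call hP.allFull h2 (Runs.pair
            (Runs.pair (Runs.fst (Runs.fst Runs.arg)) (Runs.arith (o := .div)
              (Runs.snd (Runs.fst Runs.arg)) (Runs.arith (o := .mul) Runs.const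
                (Runs.arith (o := .add) (Runs.call hP.length hlen'
                  (Runs.fst (Runs.fst (Runs.snd Runs.arg)))) Runs.const))))
            (Runs.pair (Runs.fst (Runs.fst (Runs.snd Runs.arg))) (Runs.snd (Runs.snd Runs.arg)))))
          (Runs.call hP.noFull h1 (Runs.pair (Runs.fst Runs.arg)
            (Runs.pair (Runs.snd (Runs.fst (Runs.snd Runs.arg)))
              (Runs.pair (Runs.fst (Runs.fst (Runs.snd Runs.arg))) (Runs.snd (Runs.snd Runs.arg)))))))
        (Runs.pair
          (Runs.arith (o := .mul) (Runs.arith (o := .sub) (Runs.snd (Runs.fst Runs.arg))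
            (Runs.fst (Runs.fst Runs.arg))) (Runs.fst (Runs.snd Runs.arg)))
          (Runs.arith (o := .mul) (Runs.snd (Runs.fst Runs.arg)) (Runs.snd (Runs.snd Runs.arg)))))
    refine ⟨_, hstep, ?_⟩
    simp only [ArithOp.apply, List.length_cons]
    have s1 := Nat.size_le_size (Nat.sub_le q.2 q.1)
    have s2 := Nat.size_mul_le B (e.length + 1)
    have s3 : (e.length + 1).size ≤ e.length + 1 := Nat.size_le_self' _
    have s4 : e.length.size ≤ e.length := Nat.size_le_self' _
    have s5 : Nat.size 1 = 1 := Nat.size_one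
    set M := N / (B * (e.length + 1))
    set A := callCost S β
    refine (Nat.mul_le_mul_left B (m := T₁ + (A + e.length * M * (A + A₁)) + A) (by omega)).trans ?_
    have h9 : B * (e.length * M) * (A + A₁) ≤ N * (A + A₁) := Nat.mul_le_mul_right _ hbud
    calc B * (T₁ + (A + e.length * M * (A + A₁)) + A)
        = B * T₁ + B * (2 * A) + B * (e.length * M) * (A + A₁) := by ring
      _ ≤ (B * A + L.length * (B * (2 * A) + (A + A₁) * N)) + B * (2 * A) + N * (A + A₁) := by
        omega
      _ = _ := by ring

end

/-- A bound for the bit lengths in the recursion with budget at most `N`, for activities of `b`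
bits. -/
def bitBound (S D b N : ℕ) : ℕ := (S + D + 2) * (bitRate D b + 1) * N + 2 * D + S + 2 + b

/-- Since the recursive calls receive at most half of the budget, they use half of the allowed time,
and the rate `(4 * D + 5) * A` makes the other half cover the overhead of at most `D` clauses. The
bound `N₀` stays fixed through the recursion, so that the overhead `A` does not depend on the
current budget. -/
theorem runs_ratio {P : Program} {S D : ℕ} {lam : ℕ × ℕ} (hD : 0 < D)
    (hP : HasCore (2 * D) P) {N₀ : ℕ} (n : ℕ) :
    ∀ N v E, 1 ≤ N → N ≤ n → N ≤ N₀ → v.size ≤ S → SmallClauses S D E →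
      Runs P Code.ratio
        (.pair (.pair (fracData lam) (.nat N)) (.pair (.nat v) (clauseData E)))
        (fracData (approxRatio lam (2 * D) n N v E))
        ((4 * D + 5) * callCost S (bitBound S D (fracBits lam) N₀) * N) := by
  set c := bitRate D (fracBits lam) with hc
  set β := bitBound S D (fracBits lam) N₀ with hβ
  have hβ' : β = (S + D + 2) * (c + 1) * N₀ + 2 * D + S + 2 + fracBits lam := rfl
  have hA0 : callCost S β = 4 * ((S + 1) * (2 * clauseCost S + 40)) + 40 * β + 200 := rfl
  set A := callCost S β
  induction n with
  | zero => intro N v E h1 h2; omega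
  | succ n ih =>
    intro N v E hN hNn hNN hv hE
    have hDN : ∀ k, N / (2 * D * (k + 1)) ≤ N / 2 := fun k =>
      Nat.div_le_div_left (by nlinarith) (by norm_num)
    have hbits : ∀ k, N / (2 * D * (k + 1)) ≠ 0 → ∀ u F, SmallClauses S D F →
        fracBits (approxRatio lam (2 * D) n (N / (2 * D * (k + 1))) u F) ≤
          c * (N / (2 * D * (k + 1))) := fun k hk u F hF =>
      fracBits_approxRatio_le hD n _ u F (Nat.one_le_iff_ne_zero.2 hk) hF
    have hβk : ∀ k l, k ≤ S → l ≤ S → 1 + k * (N / (2 * D * (l + 1))) * (c + 1) ≤ β := by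
      intro k l hk _
      have h1 : k * (N / (2 * D * (l + 1))) ≤ S * N₀ :=
        Nat.mul_le_mul hk ((Nat.div_le_self _ _).trans hNN)
      have h2 := Nat.mul_le_mul_right (c + 1) h1
      have h3 : (S + D + 2) * (c + 1) * N₀ = S * N₀ * (c + 1) + (D + 2) * (c + 1) * N₀ := by ring
      omega
    have hpβ : ∀ L F, SmallClauses S D (L ++ F) →
        fracBits (noClauseFull (approxRatio lam (2 * D) n) (2 * D) N L F) ≤ β := by
      intro L F hLF
      have h1 := fracBits_noClauseFull_le hbits L F hLF
      have hL : L.length ≤ S := by have := hLF.length; simp at this; omega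
      have h2 : 2 * D * fracBits (noClauseFull (approxRatio lam (2 * D) n) (2 * D) N L F) ≤
          2 * D * (1 + S * (1 + (c + 1) * N)) := by
        refine h1.trans ?_
        have h3 : L.length * (2 * D + (c + 1) * N) ≤ S * (2 * D + 2 * D * ((c + 1) * N)) :=
          Nat.mul_le_mul hL (by nlinarith [Nat.zero_le ((c + 1) * N)])
        nlinarith
      have h3 := Nat.le_of_mul_le_mul_left h2 (by omega)
      have h4 : (c + 1) * N ≤ (c + 1) * N₀ := Nat.mul_le_mul_left _ hNN
      have h5 : S * ((c + 1) * N) ≤ S * ((c + 1) * N₀) := Nat.mul_le_mul_left _ h4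
      have h6 : (S + D + 2) * (c + 1) * N₀ = S * ((c + 1) * N₀) + (D + 2) * (c + 1) * N₀ := by ring
      have h7 : S * (1 + (c + 1) * N) = S + S * ((c + 1) * N) := by ring
      omega
    have hNle : (D + 2) * (c + 1) * N₀ ≤ (S + D + 2) * (c + 1) * N₀ :=
      Nat.mul_le_mul_right _ (Nat.mul_le_mul_right _ (by omega))
    have hN₀ : 2 * N₀ ≤ (D + 2) * (c + 1) * N₀ := Nat.mul_le_mul_right _ (by nlinarith)
    obtain ⟨T, h1, hT⟩ := runs_noFull hP (β := β) (A₁ := (4 * D + 5) * A) (c := c)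
      (r := approxRatio lam (2 * D) n) (lam := lam) (S := S) (D := D) (N := N)
      hβk
      (by
        have h1 : c * N ≤ (D + 2) * (c + 1) * N₀ :=
          Nat.mul_le_mul (by nlinarith) hNN
        omega)
      (by
        have h1 := Nat.size_le_self' N
        have h2 := Nat.size_le_self' (2 * D)
        omega)
      hpβ hbits
      (fun k hk u F hu hF => ih _ u F (Nat.one_le_iff_ne_zero.2 hk)
        (by have := hDN k; omega) ((Nat.div_le_self _ _).trans hNN) hu hF)
      (linkClauses v E) (delVertex v E) (hE.link_append_del v)
    have hb := fracBits_le.1 (hpβ _ _ (hE.link_append_del v))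
    have hl := fracBits_le.1 (le_refl (fracBits lam))
    have hlen := hE.length_link_le v
    have h3 := (runs_link hP hv E hE.clause).mono (T := (S + 1) * (2 * clauseCost S + 40))
        (Nat.mul_le_mul (by have := hE.length; omega) (by omega))
    have h4 := (runs_del hP hv E hE.clause).mono (T := (S + 1) * (2 * clauseCost S + 40))
        (Nat.mul_le_mul (by have := hE.length; omega) (by omega))
    rw [show approxRatio lam (2 * D) (n + 1) N v E =
      (lam.1 * (noClauseFull (approxRatio lam (2 * D) n) (2 * D) N (linkClauses v E)
        (delVertex v E)).1, lam.2 * (noClauseFull (approxRatio lam (2 * D) n) (2 * D) N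
          (linkClauses v E) (delVertex v E)).2) from rfl]
    set p := noClauseFull (approxRatio lam (2 * D) n) (2 * D) N (linkClauses v E) (delVertex v E)
    have hstep := Runs.bind (P := P)
      (Runs.pair (Runs.fst (Runs.fst (Runs.arg (x := .pair (.pair (fracData lam) (.nat N))
          (.pair (.nat v) (clauseData E))))))
        (Runs.call hP.noFull h1 (Runs.pair (Runs.fst Runs.arg)
          (Runs.pair (Runs.call hP.link h3 (Runs.snd Runs.arg))
            (Runs.call hP.del h4 (Runs.snd Runs.arg))))))
      (Runs.pair
        (Runs.arith (o := .mul) (Runs.fst (Runs.fst Runs.arg)) (Runs.fst (Runs.snd Runs.arg)))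
        (Runs.arith (o := .mul) (Runs.snd (Runs.fst Runs.arg)) (Runs.snd (Runs.snd Runs.arg))))
    refine Runs.mono hstep ?_
    have h5 : D * (2 * T) ≤ D * (2 * A + 4 * D * A + (A + (4 * D + 5) * A) * N) := by
      have := Nat.mul_le_mul_right (2 * D * (2 * A) + (A + (4 * D + 5) * A) * N) hlen
      nlinarith
    have h6 := Nat.le_of_mul_le_mul_left h5 hD
    have h7 : (4 * D + 5) * A * N * 2 = (4 * D + 5) * A * N + (4 * D + 4) * (A * N) + A * N := by ring
    have h8 : (4 * D + 4) * A ≤ (4 * D + 4) * (A * N) :=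
      Nat.mul_le_mul_left _ (Nat.le_mul_of_pos_right _ hN)
    have h9 : (A + (4 * D + 5) * A) * N = A * N + (4 * D + 5) * A * N := by ring
    have h10 : (4 * D + 4) * A = 4 * D * A + 4 * A := by ring
    omega

theorem fracBits_approxSum_le {S D N : ℕ} {lam : ℕ × ℕ} (hD : 0 < D) (hN : 1 ≤ N) (V : List ℕ)
    (E : List (List ℕ)) (hE : SmallClauses S D E) :
    fracBits (approxSum lam (2 * D) N V E) ≤ 1 + V.length * (bitRate D (fracBits lam) * N + 1) := by
  induction V generalizing E with
  | nil => simp only [approxSum]; split_ifs <;> simp [fracBits]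
  | cons v V ih =>
    have h1 := fracBits_le.1 (ih (delVertex v E) (hE.sublist List.filter_sublist))
    have h2 := fracBits_le.1 (fracBits_approxRatio_le (lam := lam) hD N N v E hN hE)
    set c := bitRate D (fracBits lam) * N
    have h5 := Nat.size_add_le (approxRatio lam (2 * D) N N v E).1
      (approxRatio lam (2 * D) N N v E).2
    have h6 : (v :: V).length * (c + 1) = V.length * (c + 1) + (c + 1) := by
      simp only [List.length_cons]; ring
    rw [fracBits_le, h6]
    constructor
    · refine (Nat.size_mul_le _ _).trans ?_
      omega
    · refine (Nat.size_mul_le _ _).trans ?_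
      omega

/-- The cost of the recursion for one vertex in `approxSum`. -/
def vertexCost (S D b N : ℕ) : ℕ :=
  (4 * D + 5) * callCost S (bitBound S D b N) * N +
    callCost S ((S + 1) * (bitRate D b * N + 2))

theorem runs_sum {P : Program} {S D N : ℕ} {lam : ℕ × ℕ} (hD : 0 < D) (hN : 1 ≤ N)
    (hP : HasCore (2 * D) P) (V : List ℕ) (E : List (List ℕ)) (hV : V.length ≤ S)
    (hVs : ∀ v ∈ V, v.size ≤ S) (hE : SmallClauses S D E) :
    Runs P Code.sum (.pair (.pair (fracData lam) (.nat N)) (.pair (natList V) (clauseData E)))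
      (fracData (approxSum lam (2 * D) N V E))
      ((V.length + 1) * vertexCost S D (fracBits lam) N) := by
  set A := callCost S ((S + 1) * (bitRate D (fracBits lam) * N + 2)) with hA
  have hA0 : A = 4 * ((S + 1) * (2 * clauseCost S + 40)) +
    40 * ((S + 1) * (bitRate D (fracBits lam) * N + 2)) + 200 := rfl
  set R := (4 * D + 5) * callCost S (bitBound S D (fracBits lam) N) * N with hR
  have hRA : vertexCost S D (fracBits lam) N = R + A := rfl
  rw [hRA]
  induction V generalizing E with
  | nil =>
    cases E with
    | nil =>
      refine Runs.mono (Runs.iteFalse (Runs.fst (Runs.snd Runs.arg))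
        (Runs.iteFalse (Runs.snd (Runs.snd Runs.arg)) (Runs.pair Runs.const Runs.const))) ?_
      simp; omega
    | cons e E =>
      refine Runs.mono (Runs.iteFalse (Runs.fst (Runs.snd Runs.arg))
        (Runs.iteTrue (Runs.snd (Runs.snd Runs.arg)) (by simp [clauseData_cons])
          (Runs.pair Runs.const Runs.const))) ?_
      simp; omega
  | cons v V ih =>
    have hvs := hVs v (by simp)
    have hVl : V.length + 1 ≤ S := by simpa using hV
    have hdel : SmallClauses S D (delVertex v E) := hE.sublist List.filter_sublist
    have h1 := ih (delVertex v E) (by omega) (fun x hx => hVs x (by simp [hx])) hdel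
    have h2 := runs_ratio (lam := lam) hD hP N N v E hN le_rfl le_rfl hvs hE
    have hb1 := fracBits_le.1 (fracBits_approxSum_le (lam := lam) hD hN V (delVertex v E) hdel)
    have hb2 := fracBits_le.1 (fracBits_approxRatio_le (lam := lam) hD N N v E hN hE)
    have h4 := (runs_del hP hvs E hE.clause).mono (T := (S + 1) * (2 * clauseCost S + 40))
        (Nat.mul_le_mul (by have := hE.length; omega) (by omega))
    rw [show approxSum lam (2 * D) N (v :: V) E =
      (((approxRatio lam (2 * D) N N v E).1 + (approxRatio lam (2 * D) N N v E).2) *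
        (approxSum lam (2 * D) N V (delVertex v E)).1, (approxRatio lam (2 * D) N N v E).2 *
        (approxSum lam (2 * D) N V (delVertex v E)).2) from rfl]
    set x := approxRatio lam (2 * D) N N v E
    set z := approxSum lam (2 * D) N V (delVertex v E)
    have hsum := Nat.size_add_le x.1 x.2
    have hstep := Runs.iteTrue (P := P)
      (f := .ite (.snd (.snd .arg)) (.pair (.const 0) (.const 1)) (.pair (.const 1) (.const 1)))
      (Runs.fst (Runs.snd (Runs.arg
        (x := .pair (.pair (fracData lam) (.nat N)) (.pair (.pair (.nat v) (natList V)) (clauseData E))))))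
      (by simp)
      (Runs.bind
        (Runs.pair
          (Runs.call hP.ratio h2 (Runs.pair (Runs.fst Runs.arg)
            (Runs.pair (Runs.fst (Runs.fst (Runs.snd Runs.arg))) (Runs.snd (Runs.snd Runs.arg)))))
          (Runs.call hP.sum h1 (Runs.pair (Runs.fst Runs.arg)
            (Runs.pair (Runs.snd (Runs.fst (Runs.snd Runs.arg)))
              (Runs.call hP.del h4 (Runs.pair (Runs.fst (Runs.fst (Runs.snd Runs.arg)))
                (Runs.snd (Runs.snd Runs.arg))))))))
        (Runs.pair
          (Runs.arith (o := .mul) (Runs.arith (o := .add) (Runs.fst (Runs.fst Runs.arg))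
            (Runs.snd (Runs.fst Runs.arg))) (Runs.fst (Runs.snd Runs.arg)))
          (Runs.arith (o := .mul) (Runs.snd (Runs.fst Runs.arg)) (Runs.snd (Runs.snd Runs.arg)))))
    refine Runs.mono hstep ?_
    simp only [ArithOp.apply, List.length_cons]
    set c := bitRate D (fracBits lam) * N
    have h5 : V.length * (c + 1) + (c + 1) ≤ S * (c + 1) := by
      have := Nat.mul_le_mul_right (c + 1) hVl
      linarith
    have h6 : (S + 1) * (c + 2) = S * (c + 1) + S + c + 2 := by ring
    have h7 : (V.length + 1 + 1) * (R + A) = (V.length + 1) * (R + A) + R + A := by ring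
    omega

/-! ### Using a program as a subroutine -/

/-- The largest bit length of a number in a value. -/
def Data.bits : Data → ℕ
  | .nat n => n.size
  | .pair x y => max x.bits y.bits

/-- The largest bit length of a numeral in an expression. -/
def Expr.constBits : Expr → ℕ
  | .arg => 0
  | .const n => n.size
  | .fst e => e.constBits
  | .snd e => e.constBits
  | .pair e f => max e.constBits f.constBits
  | .arith _ e f => max e.constBits f.constBits
  | .ite c e f => max c.constBits (max e.constBits f.constBits)
  | .bind e f => max e.constBits f.constBits
  | .call _ e => e.constBits

/-- Move all function calls by `k` places. -/
def Expr.shift (k : ℕ) : Expr → Expr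
  | .arg => .arg
  | .const n => .const n
  | .fst e => .fst (e.shift k)
  | .snd e => .snd (e.shift k)
  | .pair e f => .pair (e.shift k) (f.shift k)
  | .arith o e f => .arith o (e.shift k) (f.shift k)
  | .ite c e f => .ite (c.shift k) (e.shift k) (f.shift k)
  | .bind e f => .bind (e.shift k) (f.shift k)
  | .call i e => .call (k + i) (e.shift k)

theorem ArithOp.size_apply_le (o : ArithOp) (a b : ℕ) : (o.apply a b).size ≤ a.size + b.size + 1 := by
  cases o with
  | add => exact (Nat.size_add_le a b).trans (by omega)
  | sub => exact (Nat.size_le_size (Nat.sub_le a b)).trans (by omega)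
  | mul => exact (Nat.size_mul_le a b).trans (by omega)
  | div => exact (Nat.size_le_size (Nat.div_le_self a b)).trans (by omega)

/-- Arithmetic is charged the bit lengths of its operands, so numbers cannot outgrow the running
time. This bounds the fraction returned by the scheme for the constant. -/
theorem Eval.bits_le {P : Program} {c : ℕ} (hP : ∀ b ∈ P, b.constBits ≤ c) {e : Expr} {x y : Data}
    {t : ℕ} (h : Eval P e x y t) (he : e.constBits ≤ c) : y.bits ≤ max x.bits c + t := by
  induction h with
  | arg x => omega
  | const n x => simp only [Data.bits, Expr.constBits] at *; omega
  | fst _ ih => have := ih he; simp only [Data.bits] at this; omega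
  | snd _ ih => have := ih he; simp only [Data.bits] at this; omega
  | pair _ _ ih₁ ih₂ =>
    simp only [Expr.constBits] at he
    have := ih₁ (by omega); have := ih₂ (by omega)
    simp only [Data.bits]; omega
  | arith _ _ ih₁ ih₂ =>
    simp only [Data.bits]
    exact (ArithOp.size_apply_le _ _ _).trans (by omega)
  | iteTrue _ _ _ _ ih₂ =>
    simp only [Expr.constBits] at he
    have := ih₂ (by omega); omega
  | iteFalse _ _ _ ih₂ =>
    simp only [Expr.constBits] at he
    have := ih₂ (by omega); omega
  | bind _ _ ih₁ ih₂ =>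
    simp only [Expr.constBits] at he
    have := ih₁ (by omega); have := ih₂ (by omega); omega
  | call hb _ _ ih₁ ih₂ =>
    have := ih₁ he; have := ih₂ (hP _ (List.mem_of_getElem? hb)); omega

/-- Shifted calls reach only the copy of `P` appended after `Q`, so the evaluation is repeated step
for step. -/
theorem Eval.shift {P : Program} (Q : Program) {e : Expr} {x y : Data} {t : ℕ}
    (h : Eval P e x y t) :
    Eval (Q ++ P.map (Expr.shift Q.length)) (e.shift Q.length) x y t := by
  induction h with
  | arg x => exact .arg x
  | const n x => exact .const n x
  | fst _ ih => exact .fst ih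
  | snd _ ih => exact .snd ih
  | pair _ _ ih₁ ih₂ => exact .pair ih₁ ih₂
  | arith _ _ ih₁ ih₂ => exact .arith ih₁ ih₂
  | iteTrue _ hy _ ih₁ ih₂ => exact .iteTrue ih₁ hy ih₂
  | iteFalse _ _ ih₁ ih₂ => exact .iteFalse ih₁ ih₂
  | bind _ _ ih₁ ih₂ => exact .bind ih₁ ih₂
  | call hb _ _ ih₁ ih₂ =>
    refine .call ?_ ih₁ ih₂
    rw [List.getElem?_append_right (by omega)]
    simp [hb]

/-- A subroutine approximating a constant. -/
theorem EfficientlyApproximable.exists_subroutine {r : ℝ} (h : EfficientlyApproximable r) :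
    ∃ (P₀ : Program) (K : ℕ), ∀ Q : Program, ∀ X : ℕ, 1 < X → ∃ x : ℕ × ℕ, 0 < x.2 ∧
      Runs (Q ++ P₀.map (Expr.shift Q.length)) (.call Q.length .arg)
        (.pair (.nat 0) (.pair (.nat 1) (.nat X))) (fracData x) (K * (2 * X + 6) ^ K) ∧
      |fracVal x - r| ≤ 1 / X * r ∧ fracBits x ≤ X + K + K * (2 * X + 6) ^ K := by
  obtain ⟨P₀, K, hK⟩ := h
  obtain ⟨c, hc⟩ : ∃ c, ∀ b ∈ P₀, b.constBits ≤ c := by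
    refine ⟨(P₀.map Expr.constBits).sum, fun b hb => ?_⟩
    exact List.single_le_sum (by simp) _ (List.mem_map_of_mem hb)
  -- One exponent serves for the running time of the subroutine and for the numerals in its code.
  refine ⟨P₀, K + c, fun Q X hX => ?_⟩
  obtain ⟨p, q, t, hq, hout, herr, ht⟩ := hK () trivial (.nat 0) rfl 1 X one_pos hX
  have hsize : (Data.pair (.nat 0) (.pair (.nat 1) (.nat X))).size ≤ X + 6 := by
    have := Nat.size_le_self' X
    simp only [Data.size, Nat.size_zero, Nat.size_one]; omega
  have ht' : t ≤ K * (2 * X + 6) ^ K := by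
    have h1 : (t : ℝ) ≤ K * (2 * X + 6) ^ K := by
      refine ht.trans (mul_le_mul_of_nonneg_left ?_ (by positivity))
      refine pow_le_pow_left₀ (by positivity) ?_ _
      have : ((Data.pair (.nat 0) (.pair (.nat 1) (.nat X))).size : ℝ) ≤ X + 6 := by
        exact_mod_cast hsize
      simp only [Nat.cast_one, div_one]
      linarith
    exact_mod_cast h1
  have hmono : K * (2 * X + 6) ^ K ≤ (K + c) * (2 * X + 6) ^ (K + c) :=
    Nat.mul_le_mul (by omega) (Nat.pow_le_pow_right (by omega) (by omega))
  refine ⟨(p, q), hq, ⟨t, ht'.trans hmono, hout.shift Q⟩, by simpa [fracVal] using herr, ?_⟩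
  have hb := hout.bits_le hc (by simp [Expr.constBits])
  simp only [Data.bits, Nat.size_zero, Nat.size_one] at hb
  have := Nat.size_le_self' X
  have h1 : fracBits (p, q) ≤ max (max 0 (max 1 X.size)) c + t := hb
  omega

/-! ### The choice of the budget -/

theorem exp_le_one_add_two_mul {x : ℝ} (h0 : 0 ≤ x) (h1 : x ≤ 1 / 2) : exp x ≤ 1 + 2 * x := by
  have h2 : 1 - x ≤ exp (-x) := by have := add_one_le_exp (-x); linarith
  have h3 : exp x * exp (-x) = 1 := by rw [← exp_add]; simp
  have h4 : exp x * (1 - x) ≤ 1 :=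
    (mul_le_mul_of_nonneg_left h2 (exp_pos x).le).trans h3.le
  have h5 : 0 < 1 - x := by linarith
  have h6 : 1 ≤ (1 + 2 * x) * (1 - x) := by nlinarith
  exact le_of_mul_le_mul_right (h4.trans h6) h5

/-- `x` and `y` agree up to the factor `exp h`. -/
def ExpClose (h x y : ℝ) : Prop := x ≤ exp h * y ∧ y ≤ exp h * x

theorem ExpClose.mono {h h' x y : ℝ} (hc : ExpClose h x y) (hx : 0 ≤ x) (hy : 0 ≤ y)
    (hh : h ≤ h') : ExpClose h' x y :=
  ⟨hc.1.trans (mul_le_mul_of_nonneg_right (exp_le_exp.2 hh) hy),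
    hc.2.trans (mul_le_mul_of_nonneg_right (exp_le_exp.2 hh) hx)⟩

theorem ExpClose.trans {h h' x y z : ℝ} (hxy : ExpClose h x y) (hyz : ExpClose h' y z) :
    ExpClose (h + h') x z := by
  have e := exp_add h h'
  constructor
  · rw [e, mul_assoc]
    exact hxy.1.trans (mul_le_mul_of_nonneg_left hyz.1 (exp_pos _).le)
  · rw [e, mul_comm (exp h), mul_assoc]
    exact hyz.2.trans (mul_le_mul_of_nonneg_left hxy.2 (exp_pos _).le)

theorem ExpClose.mul {h h' x y x' y' : ℝ} (hc : ExpClose h x y) (hc' : ExpClose h' x' y')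
    (hx : 0 ≤ x) (hy : 0 ≤ y) (hx' : 0 ≤ x') (hy' : 0 ≤ y') :
    ExpClose (h + h') (x * x') (y * y') := by
  have e := exp_add h h'
  constructor
  · calc x * x' ≤ (exp h * y) * (exp h' * y') := mul_le_mul hc.1 hc'.1 hx' (by positivity)
      _ = _ := by rw [e]; ring
  · calc y * y' ≤ (exp h * x) * (exp h' * x') := mul_le_mul hc.2 hc'.2 hy' (by positivity)
      _ = _ := by rw [e]; ring

theorem ExpClose.pow {h x y : ℝ} (hc : ExpClose h x y) (hx : 0 ≤ x) (hy : 0 ≤ y) (n : ℕ) :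
    ExpClose (n * h) (x ^ n) (y ^ n) := by
  constructor
  · rw [exp_nat_mul, ← mul_pow]; exact pow_le_pow_left₀ hx hc.1 n
  · rw [exp_nat_mul, ← mul_pow]; exact pow_le_pow_left₀ hy hc.2 n

theorem ExpClose.inv {h x y : ℝ} (hc : ExpClose h x y) (hx : 0 < x) (hy : 0 < y) :
    ExpClose h x⁻¹ y⁻¹ := by
  constructor
  · rw [inv_le_iff_one_le_mul₀ hx, ← div_eq_mul_inv, div_mul_eq_mul_div, one_le_div hy]
    exact hc.2
  · rw [inv_le_iff_one_le_mul₀ hy, ← div_eq_mul_inv, div_mul_eq_mul_div, one_le_div hx]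
    exact hc.1

theorem expClose_of_abs_sub_le {x r : ℝ} {X : ℕ} (hr : 0 < r) (hX : 4 ≤ X)
    (h : |x - r| ≤ 1 / X * r) : 0 < x ∧ ExpClose (2 / X) x r := by
  have hX' : (4 : ℝ) ≤ X := by exact_mod_cast hX
  set u : ℝ := 1 / X with hu
  have hu0 : 0 < u := by positivity
  have hu1 : u ≤ 1 / 4 := by rw [hu]; exact one_div_le_one_div_of_le (by norm_num) hX'
  have h2 : (2 : ℝ) / X = 2 * u := by rw [hu]; ring
  rw [abs_le] at h
  have h3 : 1 + 2 * u ≤ exp (2 * u) := by have := add_one_le_exp (2 * u); linarith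
  have hx : 0 < x := by nlinarith
  refine ⟨hx, ?_, ?_⟩ <;> rw [h2]
  · nlinarith
  · have h4 : r ≤ (1 + 2 * u) * x := by nlinarith
    exact h4.trans (mul_le_mul_of_nonneg_right h3 hx.le)

/-- A polynomial of degree at most `V.card` with nonnegative coefficients: changing the activity by
`exp h` changes it by at most `exp (V.card * h)`. -/
theorem indepSum_le_exp_mul {h x y : ℝ} (hh : 0 ≤ h) (hx : 0 < x) (hy : 0 < y)
    (hxy : x ≤ exp h * y) (V : Finset ℕ) (E : List (List ℕ)) :
    indepSum x V E ≤ exp (V.card * h) * indepSum y V E := by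
  rw [indepSum, indepSum, Finset.mul_sum]
  refine Finset.sum_le_sum fun I hI => ?_
  split_ifs
  · have hcard : I.card ≤ V.card := Finset.card_le_card (Finset.mem_powerset.1 hI)
    calc x ^ I.card ≤ (exp h * y) ^ I.card := pow_le_pow_left₀ hx.le hxy _
      _ = exp (I.card * h) * y ^ I.card := by rw [mul_pow, ← exp_nat_mul]
      _ ≤ _ := by
        refine mul_le_mul_of_nonneg_right (exp_le_exp.2 ?_) (by positivity)
        exact mul_le_mul_of_nonneg_right (by exact_mod_cast hcard) hh
  · simp

theorem ExpClose.indepSum {h x y : ℝ} (hc : ExpClose h x y) (hh : 0 ≤ h) (hx : 0 < x) (hy : 0 < y)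
    (V : Finset ℕ) (E : List (List ℕ)) :
    ExpClose (V.card * h) (indepSum x V E) (indepSum y V E) :=
  ⟨indepSum_le_exp_mul hh hx hy hc.1 V E, indepSum_le_exp_mul hh hy hx hc.2 V E⟩

theorem invCritical_nonneg {d : ℕ} (hd : 1 ≤ d) : 0 ≤ invCritical d := by
  have : (0 : ℝ) ≤ d - 1 := by have : (1 : ℝ) ≤ d := by exact_mod_cast hd
                               linarith
  unfold invCritical; positivity

theorem fracVal_pos {x : ℕ × ℕ} (h1 : 0 < x.1) (h2 : 0 < x.2) : 0 < fracVal x :=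
  div_pos (by exact_mod_cast h1) (by exact_mod_cast h2)

/-- Below the critical activity the error decays polynomially in the budget. -/
theorem exists_rate {d : ℕ} (hd : 1 ≤ d) {lam : ℝ} (hlam : 0 < lam)
    (hcrit : lam * invCritical d < 1) :
    ∃ τ γ C : ℝ, 0 < τ ∧ 0 < γ ∧ 0 ≤ C ∧ ∀ (V : List ℕ) (E : List (List ℕ)) (N : ℕ) (x : ℕ × ℕ),
      V.Nodup → BoundedClauses V.toFinset (d + 1) E → 0 < x.1 → 0 < x.2 →
      fracVal x ≤ (1 + τ) * lam →
      ExpClose (2 * (C * ((N : ℝ) + 1) ^ (-γ)) * V.length)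
        (fracVal (approxSum x (2 * (d + 1)) N V E)) (indepSum (fracVal x) V.toFinset E) := by
  have hinv := invCritical_nonneg hd
  have hd1 : (1 : ℝ) ≤ d := by exact_mod_cast hd
  -- With `t = lam * invCritical d < 1`, the enlarged activity gives `(1 + τ) t = (3 t - t²) / 2 <
  -- 1`, so it is still subcritical.
  set τ : ℝ := (1 - lam * invCritical d) / 2 with hτ
  have hτ0 : 0 < τ := by rw [hτ]; linarith
  set lam' := (1 + τ) * lam with hlam'
  have hlam0' : 0 < lam' := by positivity
  have hcrit' : lam' * invCritical d < 1 := by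
    have h0 : 0 ≤ lam * invCritical d := by positivity
    rw [hlam', hτ]
    nlinarith
  have hα1 : √(contractionSq d lam') < 1 := by
    rw [sqrt_lt' one_pos]; simpa using contractionSq_lt_one hlam0' hcrit'
  -- The whole gap below 1 is spent on the loss of budget in at most `d` clauses; the error bound
  -- already decays with the budget, so no strict contraction has to remain.
  set η := (1 - √(contractionSq d lam')) / d with hη
  have hη0 : 0 < η := div_pos (by linarith) (by linarith)
  have hηd : √(contractionSq d lam') + d * η ≤ 1 := by
    rw [hη, mul_div_cancel₀ _ (by linarith : (d : ℝ) ≠ 0)]; linarith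
  have hρ := div_one_add_mem hlam0'.le
  obtain ⟨γ, hγ0, -, hγ⟩ := exists_exponent (r := √(lam' / (1 + lam'))) (η := η)
    (B := (2 * (d + 1) : ℕ)) (sqrt_nonneg _) (by rw [sqrt_lt' one_pos]; simpa using hρ.2) hη0
    (by exact_mod_cast (by omega : 1 ≤ 2 * (d + 1)))
  refine ⟨τ, γ, ratioCoord lam' * ((d + 1) * (1 + η)), hτ0, hγ0,
    mul_nonneg (ratioCoord_nonneg _) (by positivity), fun V E N x hV hE hx1 hx2 hle => ?_⟩
  refine approxSum_bounds hx1 hx2 (fun W v F hF hv hdel => ?_) V E hV hE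
  have := (abs_ratioCoord_approxRatio_sub_le hd (by omega : 2 ≤ 2 * (d + 1)) hx1 hx2 hle hcrit'
    hγ0 hη0.le hηd hγ N N W v F le_rfl hF hv hdel).2
  rwa [mul_right_comm] at this

/-- Below the critical activity a polynomial budget suffices. -/
theorem exists_budget {d : ℕ} (hd : 1 ≤ d) {lam : ℝ} (hlam : 0 < lam)
    (hcrit : lam * invCritical d < 1) :
    ∃ c s : ℕ, 16 ≤ c ∧ ∀ (V : List ℕ) (E : List (List ℕ)) (m X : ℕ) (x : ℕ × ℕ), V.Nodup →
      BoundedClauses V.toFinset (d + 1) E → 1 ≤ m → X = c * ((V.length + 1) * m) →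
      0 < x.1 → 0 < x.2 → ExpClose (2 / X) (fracVal x) lam →
      ExpClose (1 / (4 * m)) (fracVal (approxSum x (2 * (d + 1)) (X ^ s) V E))
        (indepSum (fracVal x) V.toFinset E) := by
  obtain ⟨τ, γ, C, hτ0, hγ0, hC0, hrate⟩ := exists_rate hd hlam hcrit
  -- The term `16` leaves room for the error of the activity, `4 / τ` keeps the rational activity
  -- below `(1 + τ) * lam`, and `8 * C` turns the error `C / X` per vertex into `1 / (4 * m)` in
  -- total.
  obtain ⟨c, hc⟩ := exists_nat_ge (16 + 4 / τ + 8 * C)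
  -- From `s * γ ≥ 1` the budget `X ^ s` has error rate at most `1 / X`.
  obtain ⟨s, hs⟩ := exists_nat_ge (1 / γ)
  have h4τ : 0 < 4 / τ := by positivity
  have hc16 : (16 : ℝ) ≤ c := by linarith
  refine ⟨c, s, by exact_mod_cast hc16, fun V E m X x hV hE hm hX hx1 hx2 hclose => ?_⟩
  have hm' : (1 : ℝ) ≤ m := by exact_mod_cast hm
  have hXr : (X : ℝ) = c * ((V.length + 1) * m) := by rw [hX]; push_cast; ring
  have hn0 : (0 : ℝ) ≤ V.length := by positivity
  have hXc : (c : ℝ) ≤ X := by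
    rw [hXr]; exact le_mul_of_one_le_right (by positivity) (by nlinarith)
  have hX0 : (0 : ℝ) < X := by linarith
  have hle : fracVal x ≤ (1 + τ) * lam := by
    have h1 : (2 : ℝ) / X ≤ 1 / 2 := by rw [div_le_div_iff₀ hX0 (by norm_num)]; linarith
    have h2 := exp_le_one_add_two_mul (by positivity) h1
    have h3 : 2 * (2 / (X : ℝ)) ≤ τ := by
      rw [← mul_div_assoc, div_le_iff₀ hX0]
      have : 4 / τ * τ = 4 := by field_simp
      nlinarith
    exact hclose.1.trans (mul_le_mul_of_nonneg_right (by linarith) hlam.le)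
  have hXγ : (((X ^ s : ℕ) : ℝ) + 1) ^ (-γ) ≤ 1 / X := by
    rw [rpow_neg (by positivity), ← one_div]
    refine one_div_le_one_div_of_le hX0 ?_
    have h1 : 1 ≤ s * γ := by rwa [div_le_iff₀ hγ0] at hs
    calc (X : ℝ) = (X : ℝ) ^ (1 : ℝ) := (rpow_one _).symm
      _ ≤ (X : ℝ) ^ ((s : ℝ) * γ) := rpow_le_rpow_of_exponent_le (by linarith) h1
      _ = (((X ^ s : ℕ) : ℝ)) ^ γ := by rw [rpow_mul hX0.le, rpow_natCast]; push_cast; rfl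
      _ ≤ _ := rpow_le_rpow (by positivity) (by linarith) hγ0.le
  refine (hrate V E (X ^ s) x hV hE hx1 hx2 hle).mono (fracVal_nonneg _)
    (indepSum_nonneg (fracVal_pos hx1 hx2) _ _) ?_
  have h1 : C * (((X ^ s : ℕ) : ℝ) + 1) ^ (-γ) ≤ C / X := by
    rw [div_eq_mul_one_div]; exact mul_le_mul_of_nonneg_left hXγ hC0
  have h2 : C * V.length * m * 8 ≤ c * (V.length * m) := by
    have h3 : 8 * C ≤ c := by linarith
    have := mul_le_mul_of_nonneg_right h3 (by positivity : 0 ≤ (V.length : ℝ) * m)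
    linarith
  calc 2 * (C * (((X ^ s : ℕ) : ℝ) + 1) ^ (-γ)) * V.length
      ≤ 2 * (C / X) * V.length :=
        mul_le_mul_of_nonneg_right (mul_le_mul_of_nonneg_left h1 two_pos.le) hn0
    _ = 2 * C * V.length / X := by ring
    _ ≤ 1 / (4 * m) := by
      rw [div_le_div_iff₀ hX0 (by positivity), hXr]
      nlinarith

/-- `m` exceeds `b / a = 1 / ε`, and `exp u ≤ 1 + 2 * u` at `u = 1 / (2 * m)` gives relative error
at most `1 / m ≤ ε`. -/
theorem abs_sub_le_of_expClose {x y : ℝ} {m a b : ℕ} (hx : 0 ≤ x) (hy : 0 ≤ y) (ha : 0 < a)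
    (hb : 0 < b) (hm : m = b / a + 1) (h : ExpClose (1 / (2 * m)) x y) :
    |x - y| ≤ (a : ℝ) / b * y := by
  have ha' : (0 : ℝ) < a := by exact_mod_cast ha
  have hb' : (0 : ℝ) < b := by exact_mod_cast hb
  have hm1 : (1 : ℝ) ≤ m := by rw [hm]; push_cast; linarith [(Nat.cast_nonneg (b / a) : (0 : ℝ) ≤ _)]
  have hmab : (b : ℝ) ≤ m * a := by
    have h1 := Nat.lt_div_mul_add ha (a := b)
    have : b ≤ m * a := by rw [hm, add_mul, one_mul]; omega
    exact_mod_cast this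
  have hε : 1 / (m : ℝ) ≤ a / b := by
    rw [div_le_div_iff₀ (by linarith) hb']; linarith
  set u : ℝ := 1 / (2 * m) with hu
  have hu0 : 0 < u := by positivity
  have hu1 : u ≤ 1 / 2 := by rw [hu, div_le_div_iff₀ (by positivity) (by norm_num)]; linarith
  have hum : 2 * u = 1 / m := by rw [hu]; field_simp
  have hexp := exp_le_one_add_two_mul hu0.le hu1
  have h1 : x ≤ (1 + 2 * u) * y := h.1.trans (mul_le_mul_of_nonneg_right hexp hy)
  have h2 : y ≤ (1 + 2 * u) * x := h.2.trans (mul_le_mul_of_nonneg_right hexp hx)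
  have h3 : |x - y| ≤ 2 * u * y := by
    rw [abs_le]
    constructor
    · rcases le_total x y with hxy | hxy
      · nlinarith
      · nlinarith
    · linarith
  refine h3.trans (mul_le_mul_of_nonneg_right ?_ hy)
  rw [hum]; exact hε

/-! ## Polynomial bounds -/

/-- `f` is bounded by a polynomial in `σ`. -/
def PolyBounded {ι : Type} (σ f : ι → ℕ) : Prop := ∃ K, ∀ i, f i ≤ (σ i + 2) ^ K

namespace PolyBounded

variable {ι : Type} {σ f g : ι → ℕ}

theorem mono (hg : PolyBounded σ g) (h : ∀ i, f i ≤ g i) : PolyBounded σ f :=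
  let ⟨K, hK⟩ := hg; ⟨K, fun i => (h i).trans (hK i)⟩

theorem self : PolyBounded σ σ := ⟨1, fun i => by simp⟩

theorem const (c : ℕ) : PolyBounded σ (fun _ => c) :=
  ⟨c, fun i => Nat.lt_two_pow_self.le.trans (Nat.pow_le_pow_left (by omega) c)⟩

theorem mul (hf : PolyBounded σ f) (hg : PolyBounded σ g) : PolyBounded σ (fun i => f i * g i) :=
  let ⟨K, hK⟩ := hf; let ⟨L, hL⟩ := hg
  ⟨K + L, fun i => by rw [pow_add]; exact Nat.mul_le_mul (hK i) (hL i)⟩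

theorem add (hf : PolyBounded σ f) (hg : PolyBounded σ g) : PolyBounded σ (fun i => f i + g i) :=
  let ⟨K, hK⟩ := hf; let ⟨L, hL⟩ := hg
  ⟨K + L + 1, fun i => by
    have h1 : (σ i + 2) ^ K ≤ (σ i + 2) ^ (K + L) := Nat.pow_le_pow_right (by omega) (by omega)
    have h2 : (σ i + 2) ^ L ≤ (σ i + 2) ^ (K + L) := Nat.pow_le_pow_right (by omega) (by omega)
    have h3 : (σ i + 2) ^ (K + L) * 2 ≤ (σ i + 2) ^ (K + L) * (σ i + 2) :=
      Nat.mul_le_mul_left _ (by omega)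
    have := hK i
    have := hL i
    change f i + g i ≤ _
    rw [pow_succ]; omega⟩

theorem pow (hf : PolyBounded σ f) (n : ℕ) : PolyBounded σ (fun i => f i ^ n) :=
  let ⟨K, hK⟩ := hf
  ⟨K * n, fun i => by rw [pow_mul]; exact Nat.pow_le_pow_left (hK i) n⟩

theorem vertexCost {S b N : ι → ℕ} (D : ℕ) (hS : PolyBounded σ S) (hb : PolyBounded σ b)
    (hN : PolyBounded σ N) : PolyBounded σ (fun i => vertexCost (S i) D (b i) (N i)) := by
  unfold _root_.vertexCost callCost bitBound bitRate clauseCost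
  repeat' first
    | with_reducible exact hS
    | with_reducible exact hb
    | with_reducible exact hN
    | with_reducible exact const _
    | with_reducible apply add
    | with_reducible apply mul

end PolyBounded

/-- The value encoding the lists `V` and `E`. -/
def instanceData (V : List ℕ) (E : List (List ℕ)) : Data := .pair (natList V) (clauseData E)

/-- The input on the lists `V`, `E` and the accuracy `a / b`. -/
def inputData (i : List ℕ × List (List ℕ) × ℕ × ℕ) : Data :=
  .pair (instanceData i.1 i.2.1) (.pair (.nat i.2.2.1) (.nat i.2.2.2))

/-- The parameter measuring running times. -/
def inputMeasure (i : List ℕ × List (List ℕ) × ℕ × ℕ) : ℕ :=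
  (inputData i).size + i.2.2.2 / i.2.2.1

theorem hasFPTAS_of_polyBounded {C : Set (Hypergraph ℕ)} {F : Hypergraph ℕ → ℝ} (P : Program)
    (T : List ℕ × List (List ℕ) × ℕ × ℕ → ℕ) (hT : PolyBounded inputMeasure T)
    (h : ∀ H ∈ C, ∀ V E, V.Nodup → {v | v ∈ V} = H.vertexSet → (∀ l ∈ E, l.Nodup) →
      (E.map fun l => {v | v ∈ l}).Nodup → {e | ∃ l ∈ E, e = {v | v ∈ l}} = H.edgeSet →
      ∀ a b : ℕ, 0 < a → a < b → ∃ x : ℕ × ℕ, 0 < x.2 ∧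
        Runs P (.call 0 .arg) (inputData (V, E, a, b)) (fracData x) (T (V, E, a, b)) ∧
        |fracVal x - F H| ≤ (a : ℝ) / b * F H) :
    HasFPTAS C Hypergraph.IsEncodedBy F := by
  obtain ⟨K, hK⟩ := hT
  -- The measure plus 2 is at most three times the real parameter, which is at least 1. The number
  -- `3 ^ K` can serve as factor and as exponent because `K < 3 ^ K`.
  refine ⟨P, 3 ^ K, fun H hH d hd a b ha hab => ?_⟩
  obtain ⟨V, E, h1, h2, h3, h4, h5, rfl⟩ := hd
  obtain ⟨x, hx, ⟨t, ht, hrun⟩, herr⟩ := h H hH V E h1 h2 h3 h4 h5 a b ha hab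
  refine ⟨x.1, x.2, t, hx, hrun, herr, ?_⟩
  have ht' : t ≤ ((inputData (V, E, a, b)).size + b / a + 2) ^ K := ht.trans (hK (V, E, a, b))
  have hab' : ((b / a : ℕ) : ℝ) ≤ (b : ℝ) / a := Nat.cast_div_le
  have hba : 1 ≤ (b : ℝ) / a := by
    rw [one_le_div (by exact_mod_cast ha)]; exact_mod_cast hab.le
  have hs : (0 : ℝ) ≤ (inputData (V, E, a, b)).size := by positivity
  change (t : ℝ) ≤ (3 ^ K : ℕ) * (((inputData (V, E, a, b)).size : ℝ) + (b : ℝ) / a) ^ 3 ^ K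
  set Y : ℝ := ((inputData (V, E, a, b)).size : ℝ) + (b : ℝ) / a with hY
  have hY1 : 1 ≤ Y := by linarith
  calc (t : ℝ) ≤ (((inputData (V, E, a, b)).size + b / a + 2 : ℕ) : ℝ) ^ K := by exact_mod_cast ht'
    _ ≤ (3 * Y) ^ K := pow_le_pow_left₀ (by positivity) (by push_cast; linarith) K
    _ = 3 ^ K * Y ^ K := mul_pow _ _ _
    _ ≤ (3 ^ K : ℕ) * Y ^ 3 ^ K := by
      push_cast
      refine mul_le_mul_of_nonneg_left ?_ (by positivity)
      exact pow_le_pow_right₀ hY1 (Nat.lt_pow_self (by norm_num)).le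

/-! ### Sizes of encoded lists -/

theorem Data.size_ofList (l : List Data) :
    (Data.ofList l).size = (l.map fun x => x.size + 1).sum + 1 := by
  induction l with
  | nil => simp [Data.ofList, Data.size]
  | cons x l ih => simp only [Data.ofList, Data.size, ih, List.map_cons, List.sum_cons]; omega

theorem Data.length_le_size_ofList (l : List Data) : l.length ≤ (Data.ofList l).size := by
  induction l with
  | nil => simp
  | cons x l ih => simp only [Data.ofList, Data.size, List.length_cons]; omega

theorem Data.size_le_of_mem {l : List Data} {x : Data} (h : x ∈ l) :
    x.size ≤ (Data.ofList l).size := by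
  rw [Data.size_ofList]
  have := List.single_le_sum (l := l.map fun x => x.size + 1) (by simp) _
    (List.mem_map_of_mem (f := fun x : Data => x.size + 1) h)
  omega

theorem length_le_size_natList (l : List ℕ) : l.length ≤ (natList l).size :=
  (List.length_map (as := l) Data.nat).symm.trans_le (Data.length_le_size_ofList _)

theorem size_le_of_mem_natList {l : List ℕ} {x : ℕ} (h : x ∈ l) : x.size ≤ (natList l).size := by
  have := Data.size_le_of_mem (List.mem_map_of_mem (f := Data.nat) h)
  simp only [Data.size] at this
  unfold natList; omega

theorem clause_le_size_clauseData {E : List (List ℕ)} {e : List ℕ} (h : e ∈ E) :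
    e.length ≤ (clauseData E).size ∧ ∀ x ∈ e, x.size ≤ (clauseData E).size := by
  have h1 : (natList e).size ≤ (clauseData E).size :=
    Data.size_le_of_mem (List.mem_map_of_mem (f := natList) h)
  exact ⟨(length_le_size_natList e).trans h1, fun x hx => (size_le_of_mem_natList hx).trans h1⟩

theorem length_le_size_clauseData (E : List (List ℕ)) : E.length ≤ (clauseData E).size :=
  (List.length_map (as := E) natList).symm.trans_le (Data.length_le_size_ofList _)

/-! ## The main programs -/

namespace Code

/-- From the instance and the accuracy `a / b` to `c * (length + 1) * (b / a + 1)` and the instance;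
the list is selected by `sel`. -/
def start (c : ℕ) (sel : Expr → Expr) : Expr :=
  .pair (.arith .mul (.const c) (.arith .mul
    (.arith .add (.call 6 (sel (.fst .arg))) (.const 1))
    (.arith .add (.arith .div (.snd (.snd .arg)) (.fst (.snd .arg))) (.const 1)))) (.fst .arg)

/-- A power with fixed exponent. -/
def power : ℕ → Expr → Expr
  | 0, _ => .const 1
  | s + 1, e => .arith .mul e (power s e)

/-- The approximation of the constant by the subroutine at place `k`, with accuracy `1 / e`. -/
def activity (k : ℕ) (e : Expr) : Expr :=
  .bind (.pair (.const 0) (.pair (.const 1) e)) (.call k .arg)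

/-- The main program for the hardcore model. -/
def mainHardcore (c s k : ℕ) : Expr :=
  .bind (start c .fst) (.bind
    (.pair (.pair (activity k (.fst .arg)) (power s (.fst .arg))) (.snd .arg)) (.call 10 .arg))

/-- The product of two fractions. -/
def mulFrac : Expr := .pair (.arith .mul (.fst (.fst .arg)) (.fst (.snd .arg)))
  (.arith .mul (.snd (.fst .arg)) (.snd (.snd .arg)))

/-- The indices of the edges containing a vertex. -/
def star : Expr := .ite (.snd (.snd .arg))
  (.ite (.call 1 (.pair (.fst .arg) (.fst (.snd (.snd .arg)))))
    (.pair (.fst (.snd .arg)) (.call 11 (.pair (.fst .arg)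
      (.pair (.arith .add (.fst (.snd .arg)) (.const 1)) (.snd (.snd (.snd .arg)))))))
    (.call 11 (.pair (.fst .arg)
      (.pair (.arith .add (.fst (.snd .arg)) (.const 1)) (.snd (.snd (.snd .arg)))))))
  (.const 0)

/-- The indices of the elements of a list. -/
def indices : Expr := .ite (.snd .arg)
  (.pair (.fst .arg) (.call 12 (.pair (.arith .add (.fst .arg) (.const 1)) (.snd (.snd .arg)))))
  (.const 0)

/-- The stars of all vertices. -/
def stars : Expr := .ite (.snd .arg)
  (.pair (.call 11 (.pair (.fst (.snd .arg)) (.pair (.const 0) (.fst .arg)))) (.call 13 tailArg))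
  (.const 0)

/-- The power of a fraction with the length of a list as exponent. -/
def fracPower : Expr := .ite (.snd .arg)
  (.bind (.pair (.fst .arg) (.call 14 tailArg)) mulFrac) (.pair (.const 1) (.const 1))

/-- The main program for edge covers. -/
def mainCover (c s k : ℕ) : Expr :=
  .bind (start c .snd) (.bind
    (.pair (activity k (.fst .arg)) (.pair (power s (.fst .arg)) (.snd .arg)))
    (.bind
      (.pair
        (.call 10 (.pair
          (.pair (.pair (.snd (.fst .arg)) (.fst (.fst .arg))) (.fst (.snd .arg)))
          (.pair (.call 12 (.pair (.const 0) (.snd (.snd (.snd .arg)))))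
            (.call 13 (.pair (.snd (.snd (.snd .arg))) (.fst (.snd (.snd .arg))))))))
        (.call 14 (.pair (.fst .arg) (.snd (.snd (.snd .arg))))))
      mulFrac))

/-- The functions of the recursion, after the main function. -/
def core (B : ℕ) : Program :=
  [mem, remove, erase, link, del, length, ratio, noFull B, allFull, sum]

end Code

section
variable {B : ℕ} {P : Program}

theorem runs_start (hP : HasCore B P) {c a b X : ℕ} {V : List ℕ} {E : List (List ℕ)}
    {sel : Expr → Expr} {l : List Data} (hc : 1 ≤ c)
    (hsel : ∀ e x T, Runs P e x (instanceData V E) T → Runs P (sel e) x (.ofList l) (T + 1))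
    (hl : l.length ≤ (inputData (V, E, a, b)).size)
    (hX : X = c * ((l.length + 1) * (b / a + 1))) :
    Runs P (Code.start c sel) (inputData (V, E, a, b)) (.pair (.nat X) (instanceData V E))
      (((inputData (V, E, a, b)).size + 1) * ((inputData (V, E, a, b)).size + 12) + 8 * X +
        4 * (inputData (V, E, a, b)).size + 60) := by
  set S := (inputData (V, E, a, b)).size with hS
  have hab : a.size + b.size ≤ S := by
    simp only [hS, inputData, Data.size]; omega
  have hlen := (runs_length hP l).mono (T := (S + 1) * (S + 12))
    (Nat.mul_le_mul (by omega) (by omega))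
  have h := Runs.pair (P := P) (Runs.arith (o := .mul) (Runs.const (n := c)) (Runs.arith (o := .mul)
    (Runs.arith (o := .add) (Runs.call hP.length hlen (hsel _ _ _ (Runs.fst
      (Runs.arg (x := inputData (V, E, a, b)))))) (Runs.const (n := 1)))
    (Runs.arith (o := .add) (Runs.arith (o := .div) (Runs.snd (Runs.snd Runs.arg))
      (Runs.fst (Runs.snd Runs.arg))) (Runs.const (n := 1)))))
    (Runs.fst (Runs.arg (x := inputData (V, E, a, b))))
  simp only [ArithOp.apply] at h
  rw [← hX] at h
  refine h.mono ?_
  have h1 : (l.length + 1) * (b / a + 1) ≤ X := by rw [hX]; exact Nat.le_mul_of_pos_left _ hc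
  have h2 : l.length + 1 ≤ X := (Nat.le_mul_of_pos_right _ (Nat.succ_pos _)).trans h1
  have h3 : b / a + 1 ≤ X := (Nat.le_mul_of_pos_left _ (by omega)).trans h1
  have h4 : c ≤ X := by rw [hX]; exact Nat.le_mul_of_pos_right _ (by positivity)
  have s1 := Nat.size_le_self' c
  have s2 := Nat.size_le_self' ((l.length + 1) * (b / a + 1))
  have s3 := Nat.size_le_self' (l.length + 1)
  have s4 := Nat.size_le_self' (b / a + 1)
  have s5 := Nat.size_le_self' (b / a)
  have s6 := Nat.size_le_self' l.length
  have s7 : Nat.size 1 = 1 := Nat.size_one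
  omega

theorem Nat.size_pow_le (X s : ℕ) : (X ^ s).size ≤ s * X.size + 1 := by
  induction s with
  | zero => simp
  | succ s ih => rw [pow_succ, add_mul, one_mul]; exact (Nat.size_mul_le _ _).trans (by omega)

theorem runs_power {e : Expr} {x : Data} {X T s₀ : ℕ} (he : Runs P e x (.nat X) T) {s : ℕ}
    (hs : s ≤ s₀) :
    Runs P (Code.power s e) x (.nat (X ^ s)) ((s + 1) * (T + (s₀ + 2) * (X + 1))) := by
  induction s with
  | zero => exact Runs.const.mono (by nlinarith)
  | succ s ih =>
    have h := Runs.arith (o := .mul) he (ih (by omega))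
    rw [pow_succ']
    refine Runs.mono h ?_
    have h1 := Nat.size_pow_le X s
    have h2 := Nat.size_le_self' X
    have h3 : s * X.size ≤ s₀ * X := Nat.mul_le_mul (by omega) h2
    have h4 : (s + 1 + 1) * (T + (s₀ + 2) * (X + 1)) =
      (s + 1) * (T + (s₀ + 2) * (X + 1)) + T + (s₀ * X + s₀ + 2 * X + 2) := by ring
    omega

theorem runs_activity {k T T' X : ℕ} {e : Expr} {y z : Data} (he : Runs P e y (.nat X) T)
    (h : Runs P (.call k .arg) (.pair (.nat 0) (.pair (.nat 1) (.nat X))) z T') :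
    Runs P (Code.activity k e) y z (T + T' + 10) :=
  (Runs.bind (Runs.pair Runs.const (Runs.pair Runs.const he)) h).mono (by omega)

theorem vertexCost_mono {S D b b' N : ℕ} (h : b ≤ b') : vertexCost S D b N ≤ vertexCost S D b' N := by
  unfold vertexCost callCost bitBound bitRate
  gcongr

end

theorem hasCore_append (B : ℕ) (main : Expr) (R : Program) :
    HasCore B (main :: Code.core B ++ R) :=
  ⟨rfl, rfl, rfl, rfl, rfl, rfl, rfl, rfl, rfl, rfl⟩

/-- A bound for the running time of the main programs on inputs of size `S`. -/
def mainTime (D K s S X : ℕ) : ℕ :=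
  (S + 1) * (S + 12) + 8 * X + 4 * S + 60 + K * (2 * X + 6) ^ K + (s + 1) * (10 + (s + 2) * (X + 1)) +
    (S + 1) * vertexCost S D (X + K + K * (2 * X + 6) ^ K) (X ^ s) + 100

theorem PolyBounded.mainTime {ι : Type} {σ S X : ι → ℕ} (D K s : ℕ) (hS : PolyBounded σ S)
    (hX : PolyBounded σ X) : PolyBounded σ (fun i => mainTime D K s (S i) (X i)) := by
  unfold _root_.mainTime
  have hb : PolyBounded σ (fun i => X i + K + K * (2 * X i + 6) ^ K) := by
    repeat' first
      | with_reducible exact hX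
      | with_reducible exact const _
      | with_reducible apply add
      | with_reducible apply mul
      | with_reducible apply pow
  have hv := PolyBounded.vertexCost D hS hb (hX.pow s)
  repeat' first
    | with_reducible exact hS
    | with_reducible exact hX
    | with_reducible exact hv
    | with_reducible exact const _
    | with_reducible apply add
    | with_reducible apply mul
    | with_reducible apply pow

theorem polyBounded_size : PolyBounded inputMeasure (fun i => (inputData i).size) :=
  PolyBounded.self.mono fun _ => Nat.le_add_right _ _

theorem polyBounded_accuracy (c : ℕ) {n : List ℕ × List (List ℕ) × ℕ × ℕ → ℕ}
    (hn : ∀ i, n i ≤ (inputData i).size) :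
    PolyBounded inputMeasure (fun i => c * ((n i + 1) * (i.2.2.2 / i.2.2.1 + 1))) :=
  (PolyBounded.const c).mul (((polyBounded_size.mono hn).add (.const 1)).mul
    ((PolyBounded.self.mono fun _ => Nat.le_add_left _ _).add (.const 1)))

/-! ### The hardcore model -/

theorem length_fst_le_size (i : List ℕ × List (List ℕ) × ℕ × ℕ) :
    i.1.length ≤ (inputData i).size := by
  have := length_le_size_natList i.1
  simp only [inputData, instanceData, Data.size]; omega

theorem length_snd_le_size (i : List ℕ × List (List ℕ) × ℕ × ℕ) :
    i.2.1.length ≤ (inputData i).size := by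
  have := length_le_size_clauseData i.2.1
  simp only [inputData, instanceData, Data.size]; omega

theorem mem_fst_size_le {i : List ℕ × List (List ℕ) × ℕ × ℕ} {v : ℕ} (h : v ∈ i.1) :
    v.size ≤ (inputData i).size := by
  have := size_le_of_mem_natList h
  simp only [inputData, instanceData, Data.size]; omega

theorem mem_snd_size_le {i : List ℕ × List (List ℕ) × ℕ × ℕ} {e : List ℕ} (h : e ∈ i.2.1) :
    e.length ≤ (inputData i).size ∧ ∀ x ∈ e, x.size ≤ (inputData i).size := by
  have := clause_le_size_clauseData h
  have h1 : (clauseData i.2.1).size ≤ (inputData i).size := by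
    simp only [inputData, instanceData, Data.size]; omega
  exact ⟨this.1.trans h1, fun x hx => (this.2 x hx).trans h1⟩

theorem hardcorePartition_eq {H : Hypergraph ℕ} {V : List ℕ} {E : List (List ℕ)} (lam : ℝ)
    (hV : {v | v ∈ V} = H.vertexSet) (hE : {e | ∃ l ∈ E, e = {v | v ∈ l}} = H.edgeSet) :
    H.hardcorePartition lam = indepSum lam V.toFinset E := by
  have himg : H.independentSets = (fun s : Finset ℕ => (s : Set ℕ)) ''
      ((V.toFinset.powerset.filter fun I => NoneFull E I : Finset (Finset ℕ)) : Set (Finset ℕ)) := by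
    ext I
    simp only [Hypergraph.independentSets, ← hV, ← hE, Set.mem_ofPred_eq, Set.mem_image,
      Finset.mem_coe, Finset.mem_filter, Finset.mem_powerset]
    constructor
    · rintro ⟨h1, h2⟩
      have hfin : I.Finite := (List.finite_toSet V).subset h1
      refine ⟨hfin.toFinset, ⟨fun x hx => ?_, fun e he => ?_⟩, by simp⟩
      · simpa using h1 (by simpa using hx)
      · have := h2 _ ⟨e, he, rfl⟩
        rw [Set.not_subset] at this
        obtain ⟨x, hx, hxI⟩ := this
        exact ⟨x, hx, by simpa using hxI⟩
    · rintro ⟨s, ⟨h1, h2⟩, rfl⟩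
      refine ⟨fun x hx => by simpa using h1 hx, ?_⟩
      rintro _ ⟨e, he, rfl⟩ hsub
      obtain ⟨x, hx, hxI⟩ := h2 e he
      exact hxI (hsub hx)
  rw [Hypergraph.hardcorePartition, himg, finsum_mem_image (Finset.coe_injective.injOn),
    finsum_mem_coe_finset, Finset.sum_filter, indepSum]
  exact Finset.sum_congr rfl fun I _ => by simp [Set.ncard_coe_finset]

/-- The encoding lists every hyperedge once as a set, so entries of the list containing `v`
correspond to distinct hyperedges. -/
theorem countP_le_of_degree_le {H : Hypergraph ℕ} {E : List (List ℕ)} {D v : ℕ}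
    (hnd : (E.map fun l => {v | v ∈ l}).Nodup)
    (hE : {e | ∃ l ∈ E, e = {v | v ∈ l}} = H.edgeSet) (h : H.degree v ≤ D) :
    E.countP (fun e => v ∈ e) ≤ D := by
  classical
  have hnd' : ((E.filter fun e => v ∈ e).map fun l => {v | v ∈ l}).Nodup :=
    hnd.sublist ((List.filter_sublist).map _)
  have hsub : ((((E.filter fun e => v ∈ e).map fun l => {v | v ∈ l}).toFinset :
      Finset (Set ℕ)) : Set (Set ℕ)) ⊆ {e ∈ H.edgeSet | v ∈ e} := by
    intro e he
    simp only [Finset.mem_coe, List.mem_toFinset, List.mem_map, List.mem_filter,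
      decide_eq_true_eq] at he
    obtain ⟨l, ⟨hl, hvl⟩, rfl⟩ := he
    exact ⟨hE ▸ ⟨l, hl, rfl⟩, hvl⟩
  have h1 := (Set.encard_le_encard hsub).trans h
  rw [Set.encard_coe_eq_coe_finsetCard, List.toFinset_card_of_nodup hnd', List.length_map,
    ← List.countP_eq_length_filter] at h1
  exact_mod_cast h1

theorem hasFPTAS_hardcorePartition {d : ℕ} (hd : 1 ≤ d) {lam : ℝ} (hlam : 0 < lam)
    (happ : EfficientlyApproximable lam) (hcrit : lam * invCritical d < 1) :
    HasFPTAS (Hypergraph.ofMaxDegree (d + 1)) Hypergraph.IsEncodedBy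
      (fun H => H.hardcorePartition lam) := by
  obtain ⟨c, s, hc, hbudget⟩ := exists_budget hd hlam hcrit
  obtain ⟨P₀, K, hsub⟩ := happ.exists_subroutine
  -- The main function and the ten core functions occupy the places 0 to 10, so the subroutine
  -- starts at 11.
  set Q : Program := Code.mainHardcore c s 11 :: Code.core (2 * (d + 1)) with hQ
  set P : Program := Q ++ P₀.map (Expr.shift Q.length) with hPdef
  have hP : HasCore (2 * (d + 1)) P := hasCore_append _ _ _
  refine hasFPTAS_of_polyBounded P
    (fun i => mainTime (d + 1) K s (inputData i).size (c * ((i.1.length + 1) * (i.2.2.2 / i.2.2.1 + 1))))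
    (PolyBounded.mainTime _ _ _ polyBounded_size (polyBounded_accuracy c length_fst_le_size)) ?_
  intro H hH V E hV hVset hE hEnd hEset a b ha hab
  set S := (inputData (V, E, a, b)).size with hS
  set X := c * ((V.length + 1) * (b / a + 1)) with hX
  have hcX : c ≤ X := by rw [hX]; exact Nat.le_mul_of_pos_right _ (by positivity)
  obtain ⟨x, hx2, hrun, herr, hbits⟩ := hsub Q X (by omega)
  obtain ⟨hxpos, hclose⟩ := expClose_of_abs_sub_le hlam (by omega) herr
  have hx1 : 0 < x.1 := by
    rcases Nat.eq_zero_or_pos x.1 with h | h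
    · simp [fracVal, h] at hxpos
    · exact h
  have hsubV : ∀ e ∈ E, ∀ v ∈ e, v ∈ V := by
    intro e he v hv
    have h1 : {v | v ∈ e} ∈ H.edgeSet := hEset ▸ ⟨e, he, rfl⟩
    have h2 : v ∈ H.vertexSet := H.subset_vertexSet_of_mem_edgeSet' h1 hv
    rw [← hVset] at h2
    exact h2
  have hdeg : ∀ v, E.countP (fun e => v ∈ e) ≤ d + 1 := by
    intro v
    by_cases hv : v ∈ V
    · exact countP_le_of_degree_le hEnd hEset (hH.2 v (hVset ▸ hv))
    · rw [List.countP_eq_zero.2]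
      · omega
      · intro e he h; exact hv (hsubV e he v (by simpa using h))
  have hB : BoundedClauses V.toFinset (d + 1) E :=
    ⟨hE, fun e he v hv => by simpa using hsubV e he v hv, hdeg⟩
  have hSm : SmallClauses S (d + 1) E :=
    ⟨length_snd_le_size (V, E, a, b), fun e he => mem_snd_size_le (i := (V, E, a, b)) he, hdeg⟩
  have hN : 1 ≤ X ^ s := Nat.one_le_pow _ _ (by omega)
  have hsum := runs_sum (lam := x) (N := X ^ s) (by omega) hN hP V E (length_fst_le_size (V, E, a, b))
    (fun v hv => mem_fst_size_le (i := (V, E, a, b)) hv) hSm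
  refine ⟨approxSum x (2 * (d + 1)) (X ^ s) V E, approxSum_snd_pos hx2 _ _ _ _, ?_, ?_⟩
  · have hstart := runs_start hP (X := X) (a := a) (b := b) (V := V) (E := E) (c := c) (sel := .fst)
      (l := V.map .nat) (by omega) (fun e x T h => h.fst)
      (by simpa using length_fst_le_size (V, E, a, b)) (by simp [hX])
    have hmain := Runs.bind hstart (Runs.bind
      (Runs.pair (Runs.pair (runs_activity (Runs.fst Runs.arg) hrun)
        (runs_power (s₀ := s) (s := s) (Runs.fst Runs.arg) le_rfl)) (Runs.snd Runs.arg))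
      (Runs.call hP.sum hsum Runs.arg))
    have hcall := Runs.call (P := P) (i := 0) (b := Code.mainHardcore c s 11) rfl hmain Runs.arg
    refine hcall.mono ?_
    have h1 : (V.length + 1) * vertexCost S (d + 1) (fracBits x) (X ^ s) ≤
        (S + 1) * vertexCost S (d + 1) (X + K + K * (2 * X + 6) ^ K) (X ^ s) :=
      Nat.mul_le_mul (by exact Nat.succ_le_succ (length_fst_le_size (V, E, a, b))) (vertexCost_mono hbits)
    have h2 : (s + 1) * (1 + 1 + (s + 2) * (X + 1)) ≤ (s + 1) * (10 + (s + 2) * (X + 1)) :=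
      Nat.mul_le_mul_left _ (by omega)
    simp only [mainTime]
    rw [← hS]
    omega
  · have h1 := hbudget V E (b / a + 1) X x hV hB (Nat.le_add_left 1 _) hX hx1 hx2 hclose
    have h2 := hclose.indepSum (by positivity) hxpos hlam V.toFinset E
    rw [← hardcorePartition_eq lam hVset hEset] at h2
    have hZ : 0 ≤ H.hardcorePartition lam := by
      rw [hardcorePartition_eq lam hVset hEset]; exact indepSum_nonneg hlam _ _
    refine abs_sub_le_of_expClose (fracVal_nonneg _) hZ ha (by omega) rfl
      ((h1.trans h2).mono (fracVal_nonneg _) hZ ?_)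
    rw [List.toFinset_card_of_nodup hV]
    have hX0 : (0 : ℝ) < X := by exact_mod_cast (by omega : 0 < X)
    have hm0 : (0 : ℝ) < ((b / a + 1 : ℕ) : ℝ) := by positivity
    have hc' : (16 : ℝ) ≤ c := by exact_mod_cast hc
    have h3 : (V.length : ℝ) * (2 / X) ≤ 1 / (4 * ((b / a + 1 : ℕ) : ℝ)) := by
      rw [← mul_div_assoc, div_le_div_iff₀ hX0 (by positivity)]
      have hXr : (X : ℝ) = c * ((V.length + 1) * ((b / a + 1 : ℕ) : ℝ)) := by
        rw [hX]; push_cast; ring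
      rw [hXr]
      nlinarith [mul_nonneg (Nat.cast_nonneg V.length : (0 : ℝ) ≤ _) hm0.le]
    -- Half of the allowed error is for the truncated recursion, half for replacing the activity by
    -- a rational number.
    have h4 : 1 / (2 * ((b / a + 1 : ℕ) : ℝ)) = 1 / (4 * ((b / a + 1 : ℕ) : ℝ)) +
        1 / (4 * ((b / a + 1 : ℕ) : ℝ)) := by field_simp; norm_num
    rw [h4]
    linarith

/-! ### Edge covers -/

/-- The indices, counted from `i`, of the lists in `E` that contain `v`. -/
def starFrom (v : ℕ) : ℕ → List (List ℕ) → List ℕ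
  | _, [] => []
  | i, e :: E => if v ∈ e then i :: starFrom v (i + 1) E else starFrom v (i + 1) E

/-- The stars of the vertices: the clauses of the constraint satisfaction dual. -/
def starClauses (V : List ℕ) (E : List (List ℕ)) : List (List ℕ) := V.map fun v => starFrom v 0 E

theorem mem_starFrom {v j i : ℕ} {E : List (List ℕ)} :
    j ∈ starFrom v i E ↔ ∃ k < E.length, j = i + k ∧ v ∈ E.getD k [] := by
  induction E generalizing i with
  | nil => simp [starFrom]
  | cons e E ih =>
    have h : (∃ k < (e :: E).length, j = i + k ∧ v ∈ (e :: E).getD k []) ↔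
        (j = i ∧ v ∈ e) ∨ ∃ k < E.length, j = i + 1 + k ∧ v ∈ E.getD k [] := by
      constructor
      · rintro ⟨k, hk, rfl, hv⟩
        cases k with
        | zero => exact Or.inl ⟨rfl, by simpa using hv⟩
        | succ k => exact Or.inr ⟨k, by simpa using hk, by omega, by simpa using hv⟩
      · rintro (⟨rfl, hv⟩ | ⟨k, hk, rfl, hv⟩)
        · exact ⟨0, by simp, rfl, by simpa using hv⟩
        · exact ⟨k + 1, by simpa using hk, by omega, by simpa using hv⟩
    rw [h, starFrom]
    split_ifs with hv <;> simp [ih, hv]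

theorem nodup_starFrom (v i : ℕ) (E : List (List ℕ)) : (starFrom v i E).Nodup := by
  induction E generalizing i with
  | nil => simp [starFrom]
  | cons e E ih =>
    rw [starFrom]
    split_ifs
    · refine List.nodup_cons.2 ⟨fun h => ?_, ih _⟩
      obtain ⟨k, _, hk, _⟩ := mem_starFrom.1 h
      omega
    · exact ih _

theorem length_starFrom_le (v i : ℕ) (E : List (List ℕ)) : (starFrom v i E).length ≤ E.length := by
  induction E generalizing i with
  | nil => simp [starFrom]
  | cons e E ih =>
    have := ih (i + 1)
    rw [starFrom]
    split_ifs <;> simp only [List.length_cons] <;> omega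

/-- The stars containing the index `i` belong to the endpoints of the i-th edge, so dual degrees are
bounded by edge sizes. -/
theorem countP_starClauses_le {V : List ℕ} {E : List (List ℕ)} {D : ℕ} (hV : V.Nodup)
    (hE : ∀ e ∈ E, e.length ≤ D) (i : ℕ) :
    (starClauses V E).countP (fun e => i ∈ e) ≤ D := by
  rw [starClauses, List.countP_map, List.countP_eq_length_filter]
  have hsub : ∀ v ∈ V.filter ((fun e => decide (i ∈ e)) ∘ fun v => starFrom v 0 E),
      i < E.length ∧ v ∈ E.getD i [] := by
    intro v hv
    obtain ⟨k, hk, hik, hvk⟩ := mem_starFrom.1 (of_decide_eq_true (List.mem_filter.1 hv).2)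
    obtain rfl : i = k := by omega
    exact ⟨hk, hvk⟩
  by_cases hi : i < E.length
  · refine ((hV.filter _).subperm fun v hv => (hsub v hv).2).length_le.trans ?_
    rw [List.getD_eq_getElem _ _ hi]
    exact hE _ (List.getElem_mem hi)
  · rw [List.eq_nil_iff_forall_not_mem.2 fun v hv => hi (hsub v hv).1]
    simp

theorem boundedClauses_starClauses {V : List ℕ} {E : List (List ℕ)} {D : ℕ} (hV : V.Nodup)
    (hE : ∀ e ∈ E, e.length ≤ D) :
    BoundedClauses (List.range' 0 E.length).toFinset D (starClauses V E) := by
  refine ⟨?_, ?_, countP_starClauses_le hV hE⟩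
  · simp only [starClauses, List.mem_map]
    rintro _ ⟨v, _, rfl⟩
    exact nodup_starFrom _ _ _
  · simp only [starClauses, List.mem_map]
    rintro _ ⟨v, _, rfl⟩ j hj
    obtain ⟨k, hk, rfl, _⟩ := mem_starFrom.1 hj
    simpa [List.mem_range'] using hk

theorem smallClauses_starClauses {V : List ℕ} {E : List (List ℕ)} {D S : ℕ} (hV : V.Nodup)
    (hE : ∀ e ∈ E, e.length ≤ D) (hVS : V.length ≤ S) (hES : E.length ≤ S) :
    SmallClauses S D (starClauses V E) := by
  refine ⟨by simpa [starClauses] using hVS, ?_, countP_starClauses_le hV hE⟩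
  simp only [starClauses, List.mem_map]
  rintro _ ⟨v, _, rfl⟩
  refine ⟨(length_starFrom_le _ _ _).trans hES, fun j hj => ?_⟩
  obtain ⟨k, hk, rfl, _⟩ := mem_starFrom.1 hj
  have := Nat.size_le_self' (0 + k)
  omega

theorem noneFull_starClauses {V : List ℕ} {E : List (List ℕ)} {I : Finset ℕ} :
    NoneFull (starClauses V E) I ↔ ∀ v ∈ V, ∃ k < E.length, k ∉ I ∧ v ∈ E.getD k [] := by
  simp only [NoneFull, starClauses, List.mem_map, forall_exists_index, and_imp,
    forall_apply_eq_imp_iff₂, mem_starFrom, zero_add]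
  refine forall₂_congr fun v _ => ⟨?_, ?_⟩
  · rintro ⟨x, ⟨k, hk, rfl, hv⟩, hx⟩; exact ⟨x, hk, hx, hv⟩
  · rintro ⟨k, hk, hx, hv⟩; exact ⟨k, ⟨k, hk, rfl, hv⟩, hx⟩

/-- Complements of edge covers are the independent sets of the dual hypergraph. -/
theorem edgeCoverPartition_eq {H : Hypergraph ℕ} {V : List ℕ} {E : List (List ℕ)} {mu : ℝ}
    (hmu : 0 < mu) (hV : {v | v ∈ V} = H.vertexSet) (hnd : (E.map fun l => {v | v ∈ l}).Nodup)
    (hE : {e | ∃ l ∈ E, e = {v | v ∈ l}} = H.edgeSet) :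
    H.edgeCoverPartition mu =
      mu ^ E.length * indepSum mu⁻¹ (List.range' 0 E.length).toFinset (starClauses V E) := by
  classical
  set φ : ℕ → Set ℕ := fun k => {v | v ∈ E.getD k []} with hφ
  have hR : (List.range' 0 E.length).toFinset = Finset.range E.length := by
    ext k; simp [List.mem_range']
  have hφE : ∀ e, e ∈ H.edgeSet ↔ ∃ k < E.length, e = φ k := by
    intro e
    rw [← hE]
    constructor
    · rintro ⟨l, hl, rfl⟩
      obtain ⟨k, hk, rfl⟩ := List.getElem_of_mem hl
      exact ⟨k, hk, by simp only [hφ, List.getD_eq_getElem _ _ hk]⟩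
    · rintro ⟨k, hk, rfl⟩
      exact ⟨E[k], List.getElem_mem hk, by simp only [hφ, List.getD_eq_getElem _ _ hk]⟩
  have hinj : Set.InjOn φ (Finset.range E.length : Set ℕ) := by
    intro j hj k hk hjk
    simp only [Finset.coe_range, Set.mem_Iio] at hj hk
    have h1 := (List.nodup_iff_injective_get.1 hnd) (a₁ := ⟨j, by simpa using hj⟩)
      (a₂ := ⟨k, by simpa using hk⟩)
    simp only [hφ, List.getD_eq_getElem _ _ hj, List.getD_eq_getElem _ _ hk] at hjk
    simpa using h1 (by simpa using hjk)
  -- A star contained in `I` is a vertex missed by the complement. The weight `mu ^ (E.length -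
  -- I.card)` becomes the activity `mu⁻¹` with the global factor `mu ^ E.length`.
  set g : Finset ℕ → Set (Set ℕ) := fun I => φ '' (Finset.range E.length \ I : Finset ℕ) with hg
  have himg : H.edgeCovers = g '' (((Finset.range E.length).powerset.filter fun I =>
      NoneFull (starClauses V E) I : Finset (Finset ℕ)) : Set (Finset ℕ)) := by
    ext C
    simp only [Hypergraph.edgeCovers, ← hV, Set.mem_ofPred_eq, Set.mem_image, Finset.mem_coe,
      Finset.mem_filter, Finset.mem_powerset, noneFull_starClauses]
    constructor
    · rintro ⟨h1, h2⟩
      refine ⟨(Finset.range E.length).filter fun k => φ k ∉ C, ⟨Finset.filter_subset _ _, ?_⟩, ?_⟩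
      · intro v hv
        obtain ⟨e, he, hve⟩ := h2 v hv
        obtain ⟨k, hk, rfl⟩ := (hφE e).1 (h1 he)
        exact ⟨k, hk, by simp [he], hve⟩
      · ext e
        simp only [hg, Set.mem_image, Finset.mem_coe, Finset.mem_sdiff, Finset.mem_filter,
          Finset.mem_range, not_and, not_not]
        constructor
        · rintro ⟨k, ⟨hk, hkC⟩, rfl⟩; exact hkC hk
        · intro he
          obtain ⟨k, hk, rfl⟩ := (hφE e).1 (h1 he)
          exact ⟨k, ⟨hk, fun _ => he⟩, rfl⟩
    · rintro ⟨I, ⟨_, h2⟩, rfl⟩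
      constructor
      · rintro _ ⟨k, hk, rfl⟩
        simp only [Finset.mem_coe, Finset.mem_sdiff, Finset.mem_range] at hk
        exact (hφE _).2 ⟨k, hk.1, rfl⟩
      · intro v hv
        obtain ⟨k, hk, hkI, hvk⟩ := h2 v hv
        exact ⟨φ k, ⟨k, by simp [hk, hkI], rfl⟩, hvk⟩
  have hginj : Set.InjOn g (((Finset.range E.length).powerset.filter fun I =>
      NoneFull (starClauses V E) I : Finset (Finset ℕ)) : Set (Finset ℕ)) := by
    intro I hI J hJ hIJ
    simp only [Finset.mem_coe, Finset.mem_filter, Finset.mem_powerset] at hI hJ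
    have h1 := (hinj.image_eq_image_iff (by simp) (by simp)).1 hIJ
    rw [← Finset.sdiff_sdiff_eq_self hI.1, ← Finset.sdiff_sdiff_eq_self hJ.1,
      Finset.coe_injective h1]
  rw [Hypergraph.edgeCoverPartition, himg, finsum_mem_image hginj, finsum_mem_coe_finset,
    Finset.sum_filter, hR, indepSum, Finset.mul_sum]
  refine Finset.sum_congr rfl fun I hI => ?_
  have hI' := Finset.mem_powerset.1 hI
  split_ifs with h
  · have hcard : (g I).ncard = E.length - I.card := by
      rw [hg, (hinj.mono (by simp)).ncard_image,
        Set.ncard_coe_finset, Finset.card_sdiff_of_subset hI', Finset.card_range]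
    have hle : I.card ≤ E.length := by simpa using Finset.card_le_card hI'
    rw [hcard, pow_sub₀ _ hmu.ne' hle, inv_pow]
  · simp

section
variable {B : ℕ} {P : Program} {S : ℕ}

theorem runs_star (hP : HasCore B P) (h11 : P[11]? = some Code.star) {v : ℕ} (hv : v.size ≤ S)
    (i : ℕ) (E : List (List ℕ)) (hi : i + E.length ≤ S)
    (hE : ∀ e ∈ E, e.length ≤ S ∧ ∀ x ∈ e, x.size ≤ S) :
    Runs P Code.star (.pair (.nat v) (.pair (.nat i) (clauseData E)))
      (natList (starFrom v i E)) ((E.length + 1) * (clauseCost S + 2 * S + 60)) := by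
  induction E generalizing i with
  | nil => exact Runs.mono (Runs.iteFalse (Runs.snd (Runs.snd Runs.arg)) Runs.const) (by simp)
  | cons e E ih =>
    simp only [List.length_cons] at hi
    have h1 := ih (i + 1) (by omega) fun x hx => hE x (by simp [hx])
    obtain ⟨he, he'⟩ := hE e (by simp)
    have h2 := (runs_mem hP hv e he').mono (T := clauseCost S) (Nat.mul_le_mul_right _ (by omega))
    rw [clauseData_cons]
    set A : Data := .pair (.nat v) (.pair (.nat i) (.pair (natList e) (clauseData E))) with hA
    have h3 : Runs P (.arith .add (.fst (.snd .arg)) (.const 1)) A (.nat (i + 1)) (S + 7) := by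
      refine (Runs.arith (o := .add) (Runs.fst (Runs.snd Runs.arg)) Runs.const).mono ?_
      have := Nat.size_le_self' i
      have : Nat.size 1 = 1 := Nat.size_one
      omega
    have h4 := Runs.call h11 h1 (Runs.pair (Runs.fst (Runs.arg (x := A)))
      (Runs.pair h3 (Runs.snd (Runs.snd (Runs.snd Runs.arg)))))
    have h5 := Runs.call hP.mem h2 (Runs.pair (Runs.fst (Runs.arg (x := A)))
      (Runs.fst (Runs.snd (Runs.snd Runs.arg))))
    rw [starFrom]
    split_ifs with hve
    · rw [natList_cons]
      rw [if_pos hve] at h5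
      refine Runs.mono (Runs.iteTrue (Runs.snd (Runs.snd Runs.arg)) (by simp)
        (Runs.iteTrue h5 (by simp) (Runs.pair (Runs.fst (Runs.snd Runs.arg)) h4))) ?_
      simp only [List.length_cons]; nlinarith
    · rw [if_neg hve] at h5
      refine Runs.mono (Runs.iteTrue (Runs.snd (Runs.snd Runs.arg)) (by simp)
        (Runs.iteFalse h5 h4)) ?_
      simp only [List.length_cons]; nlinarith

theorem runs_indices (h12 : P[12]? = some Code.indices) (i : ℕ) (E : List (List ℕ))
    (hi : i + E.length ≤ S) :
    Runs P Code.indices (.pair (.nat i) (clauseData E)) (natList (List.range' i E.length))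
      ((E.length + 1) * (S + 40)) := by
  induction E generalizing i with
  | nil => exact Runs.mono (Runs.iteFalse (Runs.snd Runs.arg) Runs.const) (by simp)
  | cons e E ih =>
    simp only [List.length_cons] at hi
    have h1 := ih (i + 1) (by omega)
    rw [clauseData_cons, List.length_cons, List.range'_succ, natList_cons]
    have h3 : Runs P (.arith .add (.fst .arg) (.const 1))
        (.pair (.nat i) (.pair (natList e) (clauseData E))) (.nat (i + 1)) (S + 7) := by
      refine (Runs.arith (o := .add) (Runs.fst Runs.arg) Runs.const).mono ?_
      have := Nat.size_le_self' i
      have : Nat.size 1 = 1 := Nat.size_one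
      omega
    refine Runs.mono (Runs.iteTrue (Runs.snd Runs.arg) (by simp) (Runs.pair (Runs.fst Runs.arg)
      (Runs.call h12 h1 (Runs.pair h3 (Runs.snd (Runs.snd Runs.arg)))))) ?_
    nlinarith

theorem runs_stars (hP : HasCore B P) (h11 : P[11]? = some Code.star)
    (h13 : P[13]? = some Code.stars) (V : List ℕ) (E : List (List ℕ))
    (hV : ∀ v ∈ V, v.size ≤ S) (hES : E.length ≤ S)
    (hE : ∀ e ∈ E, e.length ≤ S ∧ ∀ x ∈ e, x.size ≤ S) :
    Runs P Code.stars (.pair (clauseData E) (natList V)) (clauseData (starClauses V E))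
      ((V.length + 1) * ((S + 1) * (clauseCost S + 2 * S + 60) + 40)) := by
  induction V with
  | nil => exact Runs.mono (Runs.iteFalse (Runs.snd Runs.arg) Runs.const) (by simp)
  | cons v V ih =>
    have h1 := ih fun x hx => hV x (by simp [hx])
    have h2 := (runs_star hP h11 (hV v (by simp)) 0 E (by omega) hE).mono
      (T := (S + 1) * (clauseCost S + 2 * S + 60)) (Nat.mul_le_mul_right _ (by omega))
    rw [natList_cons, show starClauses (v :: V) E = starFrom v 0 E :: starClauses V E from rfl,
      clauseData_cons]
    refine Runs.mono (Runs.iteTrue (Runs.snd Runs.arg) (by simp) (Runs.pair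
      (Runs.call h11 h2 (Runs.pair (Runs.fst (Runs.snd Runs.arg))
        (Runs.pair Runs.const (Runs.fst Runs.arg))))
      (Runs.call h13 h1 (Runs.pair (Runs.fst Runs.arg) (Runs.snd (Runs.snd Runs.arg)))))) ?_
    simp only [List.length_cons]; nlinarith

theorem runs_mulFrac (x y : ℕ × ℕ) :
    Runs P Code.mulFrac (.pair (fracData x) (fracData y)) (fracData (x.1 * y.1, x.2 * y.2))
      (2 * (fracBits x + fracBits y) + 20) := by
  refine (Runs.pair (Runs.arith (o := .mul) (Runs.fst (Runs.fst Runs.arg))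
    (Runs.fst (Runs.snd Runs.arg))) (Runs.arith (o := .mul) (Runs.snd (Runs.fst Runs.arg))
    (Runs.snd (Runs.snd Runs.arg)))).mono ?_
  have hx := fracBits_le.1 (le_refl (fracBits x))
  have hy := fracBits_le.1 (le_refl (fracBits y))
  omega

theorem fracBits_pow_le (x : ℕ × ℕ) (n : ℕ) :
    fracBits (x.1 ^ n, x.2 ^ n) ≤ n * fracBits x + 1 := by
  have hx := fracBits_le.1 (le_refl (fracBits x))
  exact fracBits_le.2 ⟨(Nat.size_pow_le _ _).trans (Nat.succ_le_succ (Nat.mul_le_mul_left _ hx.1)),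
    (Nat.size_pow_le _ _).trans (Nat.succ_le_succ (Nat.mul_le_mul_left _ hx.2))⟩

theorem runs_fracPower (h14 : P[14]? = some Code.fracPower) (x : ℕ × ℕ) (E : List (List ℕ))
    (hES : E.length ≤ S) :
    Runs P Code.fracPower (.pair (fracData x) (clauseData E))
      (fracData (x.1 ^ E.length, x.2 ^ E.length))
      ((E.length + 1) * (2 * ((S + 1) * (fracBits x + 1)) + 60)) := by
  induction E with
  | nil =>
    exact Runs.mono (Runs.iteFalse (Runs.snd Runs.arg) (Runs.pair Runs.const Runs.const)) (by simp)
  | cons e E ih =>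
    simp only [List.length_cons] at hES
    have h1 := ih (by omega)
    rw [clauseData_cons, List.length_cons, pow_succ', pow_succ']
    have h2 := fracBits_pow_le x E.length
    have h3 : E.length * fracBits x + 1 + fracBits x ≤ (S + 1) * (fracBits x + 1) := by nlinarith
    refine Runs.mono (Runs.iteTrue (Runs.snd Runs.arg) (by simp) (Runs.bind (Runs.pair
      (Runs.fst Runs.arg) (Runs.call h14 h1 (Runs.pair (Runs.fst Runs.arg)
        (Runs.snd (Runs.snd Runs.arg))))) (runs_mulFrac x (x.1 ^ E.length, x.2 ^ E.length)))) ?_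
    rw [add_mul (E.length + 1), one_mul]
    omega

end

/-- A bound for the running time of the parts of the edge cover program outside the recursion. -/
def coverTime (D β S N : ℕ) : ℕ :=
  (S + 1) * ((S + 1) * (clauseCost S + 2 * S + 60) + 40) + (S + 1) * (S + 40) +
    (S + 1) * (2 * ((S + 1) * (β + 1)) + 60) +
    2 * ((1 + S * (bitRate D β * N + 1)) + (S * β + 1)) + 100

theorem PolyBounded.coverTime {ι : Type} {σ β S N : ι → ℕ} (D : ℕ) (hβ : PolyBounded σ β)
    (hS : PolyBounded σ S) (hN : PolyBounded σ N) :
    PolyBounded σ (fun i => coverTime D (β i) (S i) (N i)) := by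
  unfold _root_.coverTime clauseCost bitRate
  repeat' first
    | with_reducible exact hβ
    | with_reducible exact hS
    | with_reducible exact hN
    | with_reducible exact const _
    | with_reducible apply add
    | with_reducible apply mul

theorem fracVal_swap (x : ℕ × ℕ) : fracVal (x.2, x.1) = (fracVal x)⁻¹ := by
  simp [fracVal]

theorem fracBits_swap (x : ℕ × ℕ) : fracBits (x.2, x.1) = fracBits x := max_comm _ _

theorem hasFPTAS_edgeCoverPartition {mu : ℝ} (hmu : 0 < mu) (happ : EfficientlyApproximable mu) :
    HasFPTAS Hypergraph.finiteGraphs Hypergraph.IsEncodedBy (fun G => G.edgeCoverPartition mu) := by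
  -- The dual of a graph has degree at most 2, so `d = 1` and `invCritical 1 = 0`: every activity is
  -- subcritical.
  obtain ⟨c, s, hc, hbudget⟩ := exists_budget (d := 1) le_rfl (inv_pos.2 hmu)
    (by simp [invCritical])
  obtain ⟨P₀, K, hsub⟩ := happ.exists_subroutine
  -- Four functions for the dual follow the core, so the subroutine starts at place 15.
  set Q : Program := Code.mainCover c s 15 :: Code.core (2 * 2) ++
    [Code.star, Code.indices, Code.stars, Code.fracPower] with hQ
  set P : Program := Q ++ P₀.map (Expr.shift Q.length) with hPdef
  have hP : HasCore (2 * 2) P := by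
    rw [hPdef, hQ, List.append_assoc]; exact hasCore_append _ _ _
  have hXpoly := polyBounded_accuracy c length_snd_le_size
  refine hasFPTAS_of_polyBounded P
    (fun i => mainTime 2 K s (inputData i).size (c * ((i.2.1.length + 1) * (i.2.2.2 / i.2.2.1 + 1))) +
      coverTime 2 (c * ((i.2.1.length + 1) * (i.2.2.2 / i.2.2.1 + 1)) + K +
        K * (2 * (c * ((i.2.1.length + 1) * (i.2.2.2 / i.2.2.1 + 1))) + 6) ^ K) (inputData i).size
        ((c * ((i.2.1.length + 1) * (i.2.2.2 / i.2.2.1 + 1))) ^ s))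
    ((PolyBounded.mainTime _ _ _ polyBounded_size hXpoly).add (PolyBounded.coverTime _
      ((hXpoly.add (.const K)).add ((PolyBounded.const K).mul
        ((((PolyBounded.const 2).mul hXpoly).add (.const 6)).pow K))) polyBounded_size
      (hXpoly.pow s))) ?_
  intro H hH V E hV hVset hE hEnd hEset a b ha hab
  set S := (inputData (V, E, a, b)).size with hS
  set X := c * ((E.length + 1) * (b / a + 1)) with hX
  have hcX : c ≤ X := by rw [hX]; exact Nat.le_mul_of_pos_right _ (by positivity)
  obtain ⟨x, hx2, hrun, herr, hbits⟩ := hsub Q X (by omega)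
  obtain ⟨hxpos, hclose⟩ := expClose_of_abs_sub_le hmu (by omega) herr
  have hx1 : 0 < x.1 := by
    rcases Nat.eq_zero_or_pos x.1 with h | h
    · simp [fracVal, h] at hxpos
    · exact h
  have hE2 : ∀ e ∈ E, e.length ≤ 2 := by
    intro e he
    have h1 := hH.2 {v | v ∈ e} (hEset ▸ ⟨e, he, rfl⟩)
    have h2 : {v | v ∈ e} = ((e.toFinset : Finset ℕ) : Set ℕ) := by ext v; simp
    rw [h2, Set.ncard_coe_finset, List.toFinset_card_of_nodup (hE e he)] at h1
    exact h1.le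
  have hVS : V.length ≤ S := length_fst_le_size (V, E, a, b)
  have hES : E.length ≤ S := length_snd_le_size (V, E, a, b)
  have hES' : ∀ e ∈ E, e.length ≤ S ∧ ∀ x ∈ e, x.size ≤ S :=
    fun e he => mem_snd_size_le (i := (V, E, a, b)) he
  have hVS' : ∀ v ∈ V, v.size ≤ S := fun v hv => mem_fst_size_le (i := (V, E, a, b)) hv
  set W := List.range' 0 E.length with hW
  set F := starClauses V E with hF
  have hWlen : W.length = E.length := List.length_range'
  have hWnd : W.Nodup := List.nodup_range'
  have hWS : ∀ v ∈ W, v.size ≤ S := by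
    intro v hv
    have h1 : v < E.length := by simpa [hW, List.mem_range'] using hv
    have := Nat.size_le_self' v
    omega
  have hB : BoundedClauses W.toFinset (1 + 1) F := boundedClauses_starClauses hV hE2
  have hSm : SmallClauses S 2 F := smallClauses_starClauses hV hE2 hVS hES
  have hN : 1 ≤ X ^ s := Nat.one_le_pow _ _ (by omega)
  -- `x` approximates `mu`; swapping numerator and denominator gives the dual activity `mu⁻¹`.
  set z := approxSum (x.2, x.1) (2 * 2) (X ^ s) W F with hz
  have hz2 : 0 < z.2 := approxSum_snd_pos (lam := (x.2, x.1)) hx1 _ _ _ _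
  have hxM := fracBits_pow_le x E.length
  have hzbits := fracBits_approxSum_le (S := S) (lam := (x.2, x.1)) two_pos hN W F hSm
  set β := X + K + K * (2 * X + 6) ^ K with hβ
  rw [fracBits_swap, hWlen] at hzbits
  have hzbits' : fracBits z ≤ 1 + S * (bitRate 2 β * X ^ s + 1) := by
    refine hzbits.trans ?_
    unfold bitRate
    gcongr
  have hxM' : fracBits (x.1 ^ E.length, x.2 ^ E.length) ≤ S * β + 1 :=
    hxM.trans (by gcongr)
  refine ⟨(z.1 * x.1 ^ E.length, z.2 * x.2 ^ E.length), by positivity, ?_, ?_⟩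
  · have hstart := runs_start hP (X := X) (a := a) (b := b) (V := V) (E := E) (c := c) (sel := .snd)
      (l := E.map natList) (by omega) (fun e x T h => h.snd)
      (by simpa using hES) (by simp [hX])
    have hsum := runs_sum (lam := (x.2, x.1)) (N := X ^ s) two_pos hN hP W F (S := S)
      (by omega) hWS hSm
    rw [hWlen, fracBits_swap] at hsum
    have hidx := runs_indices (P := P) (S := S) rfl 0 E (by omega)
    have hstars := runs_stars (S := S) hP rfl rfl V E hVS' hES hES'
    have hpow := runs_fracPower (P := P) (S := S) rfl x E hES
    set A : Data := .pair (fracData x) (.pair (.nat (X ^ s)) (instanceData V E)) with hA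
    have hE0 : Runs P (.snd (.snd (.snd .arg))) A (clauseData E) 4 :=
      Runs.snd (Runs.snd (Runs.snd Runs.arg))
    have hV0 : Runs P (.fst (.snd (.snd .arg))) A (natList V) 4 :=
      Runs.fst (Runs.snd (Runs.snd Runs.arg))
    have hmain := Runs.bind hstart (Runs.bind
      (Runs.pair (runs_activity (Runs.fst Runs.arg) hrun)
        (Runs.pair (runs_power (s₀ := s) (s := s) (Runs.fst Runs.arg) le_rfl) (Runs.snd Runs.arg)))
      (Runs.bind (Runs.pair (Runs.call hP.sum hsum (Runs.pair
          (Runs.pair (Runs.pair (Runs.snd (Runs.fst (Runs.arg (x := A)))) (Runs.fst (Runs.fst Runs.arg)))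
            (Runs.fst (Runs.snd Runs.arg)))
          (Runs.pair (Runs.call (i := 12) rfl hidx (Runs.pair Runs.const hE0))
            (Runs.call (i := 13) rfl hstars (Runs.pair hE0 hV0)))))
        (Runs.call (i := 14) rfl hpow (Runs.pair (Runs.fst Runs.arg) hE0)))
        (runs_mulFrac z (x.1 ^ E.length, x.2 ^ E.length))))
    have hcall := Runs.call (P := P) (i := 0) (b := Code.mainCover c s 15) rfl hmain Runs.arg
    refine hcall.mono ?_
    have h1 : (E.length + 1) * vertexCost S 2 (fracBits x) (X ^ s) ≤
        (S + 1) * vertexCost S 2 β (X ^ s) :=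
      Nat.mul_le_mul (by omega) (vertexCost_mono hbits)
    have h2 : (s + 1) * (1 + 1 + (s + 2) * (X + 1)) ≤ (s + 1) * (10 + (s + 2) * (X + 1)) :=
      Nat.mul_le_mul_left _ (by omega)
    have h3 : (E.length + 1) * (S + 40) ≤ (S + 1) * (S + 40) := Nat.mul_le_mul_right _ (by omega)
    have h4 : (V.length + 1) * ((S + 1) * (clauseCost S + 2 * S + 60) + 40) ≤
      (S + 1) * ((S + 1) * (clauseCost S + 2 * S + 60) + 40) := Nat.mul_le_mul_right _ (by omega)
    have h5 : (E.length + 1) * (2 * ((S + 1) * (fracBits x + 1)) + 60) ≤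
      (S + 1) * (2 * ((S + 1) * (β + 1)) + 60) := by gcongr
    simp only [mainTime, coverTime]
    rw [← hS, ← hβ]
    omega
  · have hxinv : 0 < (fracVal x)⁻¹ := inv_pos.2 hxpos
    have hclose' := hclose.inv hxpos hmu
    have h1 := hbudget W F (b / a + 1) X (x.2, x.1) hWnd hB (Nat.le_add_left 1 _)
      (by rw [hWlen]) hx2 hx1 (by rw [fracVal_swap]; exact hclose')
    rw [fracVal_swap] at h1
    have h2 := hclose'.indepSum (by positivity) hxinv (inv_pos.2 hmu) W.toFinset F
    have h3 := (h1.trans h2).mul (hclose.pow hxpos.le hmu.le E.length) (fracVal_nonneg _)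
      (indepSum_nonneg (inv_pos.2 hmu) _ _) (by positivity) (by positivity)
    have hval : fracVal (z.1 * x.1 ^ E.length, z.2 * x.2 ^ E.length) =
        fracVal z * fracVal x ^ E.length := by
      simp only [fracVal, div_pow]; push_cast; rw [mul_div_mul_comm]
    have hFeq : H.edgeCoverPartition mu = indepSum mu⁻¹ W.toFinset F * mu ^ E.length := by
      rw [edgeCoverPartition_eq hmu hVset hEnd hEset, mul_comm]
    have hZ : 0 ≤ H.edgeCoverPartition mu := by
      rw [hFeq]; exact mul_nonneg (indepSum_nonneg (inv_pos.2 hmu) _ _) (by positivity)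
    refine abs_sub_le_of_expClose (fracVal_nonneg _) hZ ha (by omega) rfl ?_
    rw [hval, hFeq]
    refine h3.mono (mul_nonneg (fracVal_nonneg _) (by positivity)) (hFeq ▸ hZ) ?_
    rw [List.toFinset_card_of_nodup hWnd, hWlen]
    have hX0 : (0 : ℝ) < X := by exact_mod_cast (by omega : 0 < X)
    have hm0 : (0 : ℝ) < ((b / a + 1 : ℕ) : ℝ) := by positivity
    have hc' : (16 : ℝ) ≤ c := by exact_mod_cast hc
    have h3 : (E.length : ℝ) * (2 / X) ≤ 1 / (8 * ((b / a + 1 : ℕ) : ℝ)) := by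
      rw [← mul_div_assoc, div_le_div_iff₀ hX0 (by positivity)]
      have hXr : (X : ℝ) = c * ((E.length + 1) * ((b / a + 1 : ℕ) : ℝ)) := by
        rw [hX]; push_cast; ring
      rw [hXr]
      nlinarith [mul_nonneg (Nat.cast_nonneg E.length : (0 : ℝ) ≤ _) hm0.le]
    -- Three shares of the error: the recursion, the activity inside the dual partition function,
    -- and the factor `mu ^ E.length`. The last two account for `c ≥ 16`.
    have h4 : 1 / (2 * ((b / a + 1 : ℕ) : ℝ)) = 1 / (4 * ((b / a + 1 : ℕ) : ℝ)) +
        1 / (8 * ((b / a + 1 : ℕ) : ℝ)) + 1 / (8 * ((b / a + 1 : ℕ) : ℝ)) := by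
      field_simp; norm_num
    rw [h4]
    linarith

/-- For `Δ > 2` the threshold is the reciprocal of `invCritical (Δ - 1)`; for `Δ = 2` the latter is
0, in keeping with an infinite threshold. -/
theorem mul_invCritical_lt_one {Δ : ℕ} {lam : ℝ} (hΔ : 2 ≤ Δ)
    (h : 2 < Δ → lam < ((Δ : ℝ) - 1) ^ (Δ - 1) / ((Δ : ℝ) - 2) ^ Δ) :
    lam * invCritical (Δ - 1) < 1 := by
  obtain ⟨k, rfl⟩ := Nat.exists_eq_add_of_le' hΔ
  rcases Nat.eq_zero_or_pos k with rfl | hk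
  · simp [invCritical]
  · have h1 := h (by omega)
    have hk' : (0 : ℝ) < k := by exact_mod_cast hk
    have e1 : ((k + 2 : ℕ) : ℝ) - 1 = k + 1 := by push_cast; ring
    have e2 : ((k + 2 : ℕ) : ℝ) - 2 = k := by push_cast; ring
    rw [show k + 2 - 1 = k + 1 from rfl, e1, e2, lt_div_iff₀ (by positivity)] at h1
    rw [show k + 2 - 1 = k + 1 from rfl, invCritical]
    push_cast
    rw [add_sub_cancel_right, ← mul_div_assoc, div_lt_one (by positivity)]
    exact h1

theorem theorem1 :
    (∀ (Δ : ℕ) (lam : ℝ), 2 ≤ Δ → 0 < lam → EfficientlyApproximable lam →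
      (2 < Δ → lam < ((Δ : ℝ) - 1) ^ (Δ - 1) / ((Δ : ℝ) - 2) ^ Δ) →
      HasFPTAS (Hypergraph.ofMaxDegree Δ) Hypergraph.IsEncodedBy
        (fun H => H.hardcorePartition lam)) ∧
    (∀ mu : ℝ, 0 < mu → EfficientlyApproximable mu →
      HasFPTAS Hypergraph.finiteGraphs Hypergraph.IsEncodedBy
        (fun G => G.edgeCoverPartition mu)) := by
  refine ⟨fun Δ lam hΔ hlam happ hcrit => ?_, fun mu hmu happ => hasFPTAS_edgeCoverPartition hmu happ⟩
  have h := hasFPTAS_hardcorePartition (d := Δ - 1) (by omega) hlam happ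
    (mul_invCritical_lt_one hΔ hcrit)
  rwa [Nat.sub_add_cancel (by omega)] at h
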